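/- Let $\Sigma$ be a closed orientable hyperbolic surface, $\Sigma=\mathbb H/\rho_0(G)$ with $G=\pi_1(\Sigma)$, and let $\mathcal T(\Sigma)$ be its Teichmüller space, i.e. the connected component of $\rho_0$ in the space of representations $G\to \mathrm{PSL}(2,\mathbb R)$ (taken up to conjugacy). Closed geodesics are unoriented; a closed geodesic on $\Sigma$ is identified with the closed geodesic in the same free homotopy class on $\mathbb H/\rho(G)$, for each $\rho\in\mathcal T(\Sigma)$. Likewise a transverse intersection point $z$ of closed geodesics $\alpha,\beta$ is given by a pair of axes of elements $a,b\in G$ (representing $\alpha,\beta$) that cross over $z$, and for each $\rho\in\mathcal T(\Sigma)$ it is followed to the projection of the crossing point of the axes of $\rho(a),\rho(b)$. Let $\alpha\angle_z\beta\in\,]0,\pi[$ be the angle at this point measured counter-clockwise from $\alpha$ to $\beta$, regarded as a function on $\mathcal T(\Sigma)$. Let $\alpha_1,\alpha_2$ be simple closed geodesics on $\Sigma$ that meet in a single point $z$, and let $\beta_1,\beta_2$ be primitive closed geodesics on $\Sigma$ that meet transversely at a point $z'$ (other intersection points are allowed, as is a transverse self-intersection of $\beta_1=\beta_2$). If the difference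 $$\alpha_1\angle_z\alpha_2-\beta_1\angle_{z'}\beta_2$$ is constant on $\mathcal T(\Sigma)$, then $\alpha_1\angle_z\alpha_2=\beta_1\angle_{z'}\beta_2$ on all of $\mathcal T(\Sigma)$, $z=z'$ (on $\Sigma$ and on $\mathbb H/\rho(G)$ for every $\rho\in\mathcal T(\Sigma)$), and, after possibly exchanging $\beta_1$ and $\beta_2$, $\alpha_1=\beta_1$ and $\alpha_2=\beta_2$. -/

import Mathlib

open scoped MatrixGroups UpperHalfPlane

noncomputable section

namespace AngleRigidity

/-- The group `PSL(2,ℝ) = SL(2,ℝ) / {±1}`, with the quotient topology. -/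
abbrev PSL2R : Type := Matrix.ProjectiveSpecialLinearGroup (Fin 2) ℝ

/-- The centre of `SL(2,ℝ)` acts trivially on the upper half plane. -/
theorem smul_eq_of_mem_center (g : SL(2, ℝ)) (hg : g ∈ Subgroup.center SL(2, ℝ)) (z : ℍ) :
    g • z = z := by
  obtain ⟨r, hr, hg⟩ := Matrix.SpecialLinearGroup.mem_center_iff.1 hg
  have hr' : r = 1 ∨ r = -1 := by
    have h2 : r ^ 2 = 1 := by simpa using hr
    have h3 : (r - 1) * (r + 1) = 0 := by linear_combination h2
    rcases mul_eq_zero.1 h3 with h | h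
    · exact Or.inl (by linarith)
    · exact Or.inr (by linarith)
  rcases hr' with rfl | rfl
  · have : g = 1 := by
      apply Subtype.ext
      rw [← hg]
      simp
    rw [this, one_smul]
  · have : g = -1 := by
      apply Subtype.ext
      rw [← hg]
      ext i j
      fin_cases i <;> fin_cases j <;> simp
    apply UpperHalfPlane.ext
    rw [this, UpperHalfPlane.specialLinearGroup_apply]
    simp

/-- The action of `PSL(2,ℝ)` on the upper half plane by Möbius transformations, as a
homomorphism; it is induced by the action of `SL(2,ℝ)`. -/
def moebiusHom : PSL2R →* Equiv.Perm ℍ :=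
  QuotientGroup.lift (Subgroup.center SL(2, ℝ)) (MulAction.toPermHom SL(2, ℝ) ℍ)
    (fun g hg => Equiv.ext fun z => smul_eq_of_mem_center g hg z)

/-- `PSL(2,ℝ)` acts on the hyperbolic plane `ℍ` by Möbius transformations. -/
instance instMulActionPSL2R : MulAction PSL2R ℍ := MulAction.compHom ℍ moebiusHom

theorem mk_smul (g : SL(2, ℝ)) (z : ℍ) : (QuotientGroup.mk g : PSL2R) • z = g • z := rfl

/-! ### The hyperbolic plane: axes and angles -/

/-- The axis of an isometry `g` of the hyperbolic plane: the set of points at which the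
displacement `z ↦ dist z (g z)` is minimal. If `g` is hyperbolic, then this is the complete
geodesic joining the two fixed points of `g` at infinity. -/
def axis (g : PSL2R) : Set ℍ :=
  {z | ∀ w : ℍ, dist z (g • z) ≤ dist w (g • w)}

/-- The Cayley transform that identifies `ℍ` with the Poincaré disc and sends `z` to `0`. It is
holomorphic, hence preserves oriented angles, and it maps geodesics through `z` to diameters. -/
def discChart (z w : ℍ) : ℂ := ((w : ℂ) - (z : ℂ)) / ((w : ℂ) - (starRingEnd ℂ) (z : ℂ))

/-- The angle at `z`, measured counter-clockwise and taken in `[0, π)`, from the unoriented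
geodesic through `z` and `w₁` to the unoriented geodesic through `z` and `w₂`
(`w₁, w₂ ≠ z`). -/
def ccwAngle (z w₁ w₂ : ℍ) : ℝ :=
  toIcoMod Real.pi_pos 0 (Complex.arg (discChart z w₂ / discChart z w₁))

open Classical in
/-- The counter-clockwise angle from the axis of `g` to the axis of `h` at their intersection
point, for hyperbolic `g`, `h` whose axes cross (so that the intersection is a single point); it
lies in `(0, π)`. Note that `g • z` is a second point of the axis of `g`. If the axes do not meet,
the value is `0`. -/
def axisAngle (g h : PSL2R) : ℝ :=
  if H : (axis g ∩ axis h).Nonempty then ccwAngle H.some (g • H.some) (h • H.some) else 0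

/-! ### Closed hyperbolic surfaces -/

variable {G : Type*} [Group G]

/-- `ρ` makes `G` act freely, properly discontinuously and cocompactly on `ℍ`. Equivalently,
`ρ` is an isomorphism of `G` with the fundamental group of the closed oriented hyperbolic
surface `ℍ / ρ(G)`, as a group of deck transformations. -/
structure IsClosedSurfaceRep (ρ : G →* PSL2R) : Prop where
  free : ∀ (g : G) (z : ℍ), ρ g • z = z → g = 1
  properlyDiscontinuous : ∀ K : Set ℍ, IsCompact K →
    {g : G | ((fun z => ρ g • z) '' K ∩ K).Nonempty}.Finite
  cocompact : CompactSpace (MulAction.orbitRel.Quotient ρ.range ℍ)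

/-- The surface `ℍ / ρ(G)`. -/
abbrev Surface (ρ : G →* PSL2R) : Type := MulAction.orbitRel.Quotient ρ.range ℍ

/-- The covering projection `ℍ → ℍ / ρ(G)`. -/
def proj (ρ : G →* PSL2R) (z : ℍ) : Surface ρ := Quotient.mk _ z

/-- The (unoriented) closed geodesic on `ℍ / ρ(G)` in the free homotopy class of `a`: the
projection of the axis of `ρ a`. -/
def closedGeodesic (ρ : G →* PSL2R) (a : G) : Set (Surface ρ) := proj ρ '' axis (ρ a)

/-- `a` is nontrivial and not a proper power: its closed geodesic is primitive. -/
def IsPrimitive (a : G) : Prop := a ≠ 1 ∧ ∀ (c : G) (n : ℕ), c ^ n = a → n = 1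

/-- The closed geodesic of `a` is simple: the closed curve `axis (ρ a) / ⟨ρ a⟩ → ℍ / ρ(G)` is
injective. -/
def IsSimple (ρ : G →* PSL2R) (a : G) : Prop :=
  a ≠ 1 ∧ ∀ z ∈ axis (ρ a), ∀ w ∈ axis (ρ a), proj ρ z = proj ρ w → ∃ n : ℤ, w = ρ (a ^ n) • z

/-- The projection to `ℍ / ρ(G)` of the intersection of the axes of `ρ a` and `ρ b`. If these axes
cross, then this is one point, at which the closed geodesics of `a` and `b` meet. -/
def meetingPoint (ρ : G →* PSL2R) (a b : G) : Set (Surface ρ) :=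
  proj ρ '' (axis (ρ a) ∩ axis (ρ b))

/-- The Teichmüller space of the surface `ℍ / ρ₀(G)`: the connected component of `ρ₀` in the space
of representations `Hom(G, PSL(2,ℝ))` with the topology of pointwise convergence. Points of
Teichmüller space are usually conjugacy classes of such representations; the angle functions
below depend only on the conjugacy class. -/
def teichmueller (ρ₀ : G →* PSL2R) : Set (G →* PSL2R) :=
  {ρ | (ρ : G → PSL2R) ∈
    connectedComponentIn (Set.range fun σ : G →* PSL2R => (σ : G → PSL2R)) (ρ₀ : G → PSL2R)}

/-- The angle function on representations: the counter-clockwise angle, on the surface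
`ℍ / ρ(G)`, from the closed geodesic of `a` to the closed geodesic of `b`, at the intersection
point given by the crossing axes of `ρ a` and `ρ b`. -/
def angle (ρ : G →* PSL2R) (a b : G) : ℝ := axisAngle (ρ a) (ρ b)

end AngleRigidity

end

open Filter Topology

noncomputable section

namespace AngleRigidity

variable {G : Type*} [Group G]

/-! Everything rests on the Fenchel–Nielsen twist along a simple closed geodesic. Since α₁ and α₂
are simple and meet once, twisting along α₁ leaves the translation along α₁ unchanged and multiplies
the one along α₂ by a single translation with the axis of α₁. The cotangent of their angle becomes a
fixed multiple of `p cosh t + q sinh t` with `p² < q²`, so it tends to infinities of opposite signs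
as t → ±∞ (`tendsto_cot_twist`). An angle that sweeps out all of (0, π) cannot be shifted by a
nonzero constant and stay in [0, π), hence the constant difference is 0 (`eq_zero_of_tendsto_cot`),
and the angle between β₁ and β₂ has the same behaviour at both ends.

The heart of the proof is `exists_wall_of_tendsto_cot`: such behaviour forces β₁ or β₂ to be α₁. The
lifts of α₁ are walls in ℍ, pairwise disjoint and without common endpoints. The twist multiplies
ρ(b) by the ordered product of translations along the walls between x and ρ(b)x. For x on the axis
of b, and if walls are crossed, the rescaled matrix tends to a rank one matrix built from an
endpoint of the first wall met in each of the two directions of the axis; t → -∞ selects the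
opposite endpoints (`tendsto_flowProd`, `tendsto_twistSL`). If neither β is a lift of α₁, there are
two cases. Either the limits are transverse, and then the cotangent stays bounded; or the two axes
share one of these first walls. In the second case a Plücker relation shows that the sign of the
cosine is decided by which walls are shared, and not by the sign of t, so the cotangent has the same
sign at both ends. Both cases contradict opposite infinities.

Exchanging α₁ and α₂, one of the β's is also α₂, and it cannot be the same one. The axes of b₁ and
b₂ are therefore lifts of α₁ and α₂ that meet, necessarily over z. By simplicity and primitivity the
pair is conjugate to (a₁, a₂) by one group element, up to inverses and order (`exists_conj_pair`),
and this algebraic relation persists for every representation.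

Geometry is computed with matrices: `height` cuts out axes, `crossDet` detects crossing, and the
cotangent of an angle is `crossNum / (2k)` with `k² = crossDet`, the sign of k being that of an
entry of the commutator. -/

/-! ### Heights, displacement and axes of matrices -/

/-- Real `2 × 2` matrices. -/
abbrev Mat2 : Type := Matrix (Fin 2) (Fin 2) ℝ

/-- The symplectic pairing of two vectors of `ℝ²`. -/
def wedge (u v : Fin 2 → ℝ) : ℝ := u 0 * v 1 - u 1 * v 0

/-- A linear form in `M` that vanishes exactly on the axis of `M` when `M` is hyperbolic; up to a
factor it is `sinh` of the signed distance to the axis. -/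
def height (M : Mat2) (z : ℍ) : ℝ :=
  (M 1 0 * (z.re ^ 2 + z.im ^ 2) + (M 1 1 - M 0 0) * z.re - M 0 1) / z.im

/-- The quadratic polynomial whose roots are the fixed points of `M`. -/
def fixQuad (M : Mat2) (z : ℍ) : ℂ :=
  (M 1 0 : ℂ) * (z : ℂ) ^ 2 + ((M 1 1 : ℂ) - (M 0 0 : ℂ)) * (z : ℂ) - (M 0 1 : ℂ)

theorem fixQuad_re (M : Mat2) (z : ℍ) :
    (fixQuad M z).re = M 1 0 * (z.re ^ 2 - z.im ^ 2) + (M 1 1 - M 0 0) * z.re - M 0 1 := by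
  simp [fixQuad, pow_two]

theorem fixQuad_im (M : Mat2) (z : ℍ) :
    (fixQuad M z).im = (2 * M 1 0 * z.re + (M 1 1 - M 0 0)) * z.im := by
  simp [fixQuad, pow_two]; ring

theorem height_mul_im (M : Mat2) (z : ℍ) :
    height M z * z.im = M 1 0 * (z.re ^ 2 + z.im ^ 2) + (M 1 1 - M 0 0) * z.re - M 0 1 :=
  div_mul_cancel₀ _ z.im_ne_zero

theorem height_add (M N : Mat2) (z : ℍ) : height (M + N) z = height M z + height N z := by
  simp only [height, Matrix.add_apply]; ring

theorem height_smul_mat (r : ℝ) (M : Mat2) (z : ℍ) : height (r • M) z = r * height M z := by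
  simp only [height, Matrix.smul_apply, smul_eq_mul]; ring

theorem height_one (z : ℍ) : height 1 z = 0 := by simp [height]

/-- Links fixed points, height and discriminant: where the height vanishes, not being fixed is the
same as having positive discriminant. -/
theorem normSq_fixQuad (M : Mat2) (z : ℍ) :
    Complex.normSq (fixQuad M z) =
      z.im ^ 2 * (height M z ^ 2 + M.trace ^ 2 - 4 * M.det) := by
  have h := height_mul_im M z
  rw [Complex.normSq_apply, fixQuad_re, fixQuad_im, Matrix.trace_fin_two, Matrix.det_fin_two]
  have : z.im ^ 2 * (height M z ^ 2 + (M 0 0 + M 1 1) ^ 2 - 4 * (M 0 0 * M 1 1 - M 0 1 * M 1 0)) =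
    (height M z * z.im) ^ 2 + z.im ^ 2 * ((M 0 0 + M 1 1) ^ 2 -
      4 * (M 0 0 * M 1 1 - M 0 1 * M 1 0)) := by ring
  rw [this, h]; ring

theorem SL2_det (X : SL(2, ℝ)) : X.1 0 0 * X.1 1 1 - X.1 0 1 * X.1 1 0 = 1 := by
  rw [← Matrix.det_fin_two]; exact X.2

theorem SL2_inv_coe (X : SL(2, ℝ)) :
    ((X⁻¹ : SL(2, ℝ)) : Mat2) = !![X.1 1 1, -X.1 0 1; -X.1 1 0, X.1 0 0] := by
  rw [Matrix.SpecialLinearGroup.coe_inv, Matrix.adjugate_fin_two]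

theorem denomSq_pos (X : SL(2, ℝ)) (z : ℍ) :
    0 < (X.1 1 0 * z.re + X.1 1 1) ^ 2 + (X.1 1 0 * z.im) ^ 2 := by
  have hd := SL2_det X
  rcases eq_or_ne (X.1 1 0) 0 with h | h
  · rw [h] at hd ⊢
    have : X.1 1 1 ≠ 0 := by rintro h'; rw [h'] at hd; simp at hd
    have := sq_pos_of_ne_zero this
    simpa using this
  · have := sq_pos_of_ne_zero (mul_ne_zero h z.im_ne_zero)
    positivity

theorem denom_ne_zero' (X : SL(2, ℝ)) (z : ℍ) : ((X.1 1 0 : ℂ) * z + (X.1 1 1 : ℂ)) ≠ 0 := by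
  intro h
  have h1 := congrArg Complex.re h
  have h2 := congrArg Complex.im h
  simp at h1 h2
  have := denomSq_pos X z
  rw [h1] at this
  rcases h2 with h2 | h2
  · simp [h2] at this
  · exact z.im_ne_zero h2

theorem SL2_smul_coe (X : SL(2, ℝ)) (z : ℍ) :
    ((X • z : ℍ) : ℂ) = ((X.1 0 0 : ℂ) * z + X.1 0 1) / ((X.1 1 0 : ℂ) * z + X.1 1 1) := by
  rw [UpperHalfPlane.specialLinearGroup_apply]; rfl

theorem SL2_smul_re (X : SL(2, ℝ)) (z : ℍ) :
    (X • z).re = ((X.1 0 0 * z.re + X.1 0 1) * (X.1 1 0 * z.re + X.1 1 1) +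
      X.1 0 0 * X.1 1 0 * z.im ^ 2) / ((X.1 1 0 * z.re + X.1 1 1) ^ 2 + (X.1 1 0 * z.im) ^ 2) := by
  have := congrArg Complex.re (SL2_smul_coe X z)
  rw [Complex.div_re] at this
  simp only [UpperHalfPlane.coe_re] at this
  rw [this]
  simp [Complex.normSq_apply]
  rw [← add_div]; congr 1 <;> ring

theorem SL2_smul_im (X : SL(2, ℝ)) (z : ℍ) :
    (X • z).im = z.im / ((X.1 1 0 * z.re + X.1 1 1) ^ 2 + (X.1 1 0 * z.im) ^ 2) := by
  have := congrArg Complex.im (SL2_smul_coe X z)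
  rw [Complex.div_im] at this
  simp only [UpperHalfPlane.coe_im] at this
  rw [this]
  simp [Complex.normSq_apply]
  rw [← sub_div]; congr 1
  · linear_combination z.im * SL2_det X
  · ring

/-- Möbius transformations move heights by conjugation. -/
theorem height_smul (M : Mat2) (X : SL(2, ℝ)) (z : ℍ) :
    height M (X • z) = height ((X⁻¹ : SL(2, ℝ)).1 * M * X.1) z := by
  have hd := SL2_det X
  have hN := (denomSq_pos X z).ne'
  have hy := z.im_ne_zero
  have e1 : (X⁻¹ : SL(2, ℝ)).1 = !![X.1 1 1, -X.1 0 1; -X.1 1 0, X.1 0 0] := SL2_inv_coe X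
  rw [e1]
  simp only [height]
  rw [SL2_smul_im, SL2_smul_re]
  simp only [Matrix.mul_apply, Fin.sum_univ_two, Matrix.of_apply, Matrix.cons_val', Matrix.cons_val_zero,
    Matrix.cons_val_one, Matrix.cons_val_fin_one]
  generalize X.1 0 0 = a at *
  generalize X.1 0 1 = b at *
  generalize X.1 1 0 = c at *
  generalize X.1 1 1 = d at *
  generalize z.re = x at *
  generalize z.im = y at *
  set N := (c * x + d) ^ 2 + (c * y) ^ 2 with hNdef
  have key : ((a * x + b) * (c * x + d) + a * c * y ^ 2) ^ 2 + y ^ 2 =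
      ((a * x + b) ^ 2 + (a * y) ^ 2) * N := by
    rw [hNdef]
    linear_combination (-(a * d - b * c + 1) * y ^ 2) * hd
  clear_value N
  field_simp
  subst hNdef
  linear_combination (M 1 0) * key

/-- The trace term does not depend on the point, so minimizing the displacement amounts to
minimizing the squared height. No hyperbolicity is needed. -/
theorem four_sinh_sq (X : SL(2, ℝ)) (z : ℍ) :
    4 * Real.sinh (dist z (X • z) / 2) ^ 2 = height X.1 z ^ 2 + X.1.trace ^ 2 - 4 := by
  have hd := SL2_det X
  have hN := (denomSq_pos X z).ne'
  have hy := z.im_ne_zero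
  rw [UpperHalfPlane.sinh_half_dist, div_pow, mul_pow, Real.sq_sqrt
    (mul_pos z.im_pos (X • z).im_pos).le, Complex.dist_eq, ← Complex.normSq_eq_norm_sq,
    Complex.normSq_apply]
  simp only [Complex.sub_re, Complex.sub_im, UpperHalfPlane.coe_re, UpperHalfPlane.coe_im]
  rw [SL2_smul_im, SL2_smul_re, Matrix.trace_fin_two]
  simp only [height]
  generalize X.1 0 0 = a at *
  generalize X.1 0 1 = b at *
  generalize X.1 1 0 = c at *
  generalize X.1 1 1 = d at *
  generalize z.re = x at *
  generalize z.im = y at *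
  set N := (c * x + d) ^ 2 + (c * y) ^ 2 with hNdef
  have key : ((a * x + b) * (c * x + d) + a * c * y ^ 2) ^ 2 + y ^ 2 =
      ((a * x + b) ^ 2 + (a * y) ^ 2) * N := by
    rw [hNdef]
    linear_combination (-(a * d - b * c + 1) * y ^ 2) * hd
  clear_value N
  field_simp
  have e : (x * N - ((a * x + b) * (c * x + d) + a * c * y ^ 2)) ^ 2 + y ^ 2 * (N - 1) ^ 2 =
    N * ((c * (x ^ 2 + y ^ 2) + (d - a) * x - b) ^ 2 + ((a + d) ^ 2 - 4) * y ^ 2) := by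
    have : (x * N - ((a * x + b) * (c * x + d) + a * c * y ^ 2)) ^ 2 + y ^ 2 * (N - 1) ^ 2 =
      (x ^ 2 + y ^ 2) * N ^ 2 - 2 * N * (x * ((a * x + b) * (c * x + d) + a * c * y ^ 2) + y ^ 2) +
      ((((a * x + b) * (c * x + d) + a * c * y ^ 2)) ^ 2 + y ^ 2) := by ring
    rw [this, key]
    rw [hNdef]
    linear_combination (-2 * y ^ 2 * ((c * x + d) ^ 2 + (c * y) ^ 2)) * hd
  linear_combination 4 * e

/-- The class in `PSL(2,ℝ)` of a matrix. -/
abbrev toPSL (X : SL(2, ℝ)) : PSL2R := QuotientGroup.mk X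

theorem toPSL_smul (X : SL(2, ℝ)) (z : ℍ) : toPSL X • z = X • z := mk_smul X z

theorem exists_toPSL (p : PSL2R) : ∃ X : SL(2, ℝ), toPSL X = p := QuotientGroup.mk_surjective p

theorem mem_axis_toPSL (X : SL(2, ℝ)) (z : ℍ) :
    z ∈ axis (toPSL X) ↔ ∀ w, height X.1 z ^ 2 ≤ height X.1 w ^ 2 := by
  have key : ∀ w, dist z (X • z) ≤ dist w (X • w) ↔ height X.1 z ^ 2 ≤ height X.1 w ^ 2 := by
    intro w
    have h1 := four_sinh_sq X z
    have h2 := four_sinh_sq X w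
    have hz : 0 ≤ Real.sinh (dist z (X • z) / 2) := Real.sinh_nonneg_iff.2 (by positivity)
    have hw : 0 ≤ Real.sinh (dist w (X • w) / 2) := Real.sinh_nonneg_iff.2 (by positivity)
    rw [← div_le_div_iff_of_pos_right (zero_lt_two' ℝ), ← Real.sinh_le_sinh,
      ← pow_le_pow_iff_left₀ hz hw two_ne_zero]
    constructor <;> intro h <;> linarith
  exact forall_congr' key

theorem smul_eq_self_iff (X : SL(2, ℝ)) (z : ℍ) :
    X • z = z ↔ height X.1 z ^ 2 + X.1.trace ^ 2 - 4 = 0 := by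
  rw [← four_sinh_sq, eq_comm, ← dist_eq_zero]
  constructor
  · intro h; simp [h]
  · intro h
    have : Real.sinh (dist z (X • z) / 2) = 0 := by simpa using h
    have := Real.sinh_eq_zero.1 this
    linarith

theorem continuous_height (M : Mat2) : Continuous (height M) := by
  unfold height
  refine Continuous.div ?_ UpperHalfPlane.continuous_im (fun z => z.im_ne_zero)
  have := UpperHalfPlane.continuous_im
  have := UpperHalfPlane.continuous_re
  fun_prop

/-- The point of the upper half plane with given coordinates. -/
def pt (x y : ℝ) (hy : 0 < y) : ℍ := ⟨⟨x, y⟩, hy⟩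

theorem pt_re (x y : ℝ) (hy : 0 < y) : (pt x y hy).re = x := rfl

theorem pt_im (x y : ℝ) (hy : 0 < y) : (pt x y hy).im = y := rfl

theorem continuous_pt {T : Type*} [TopologicalSpace T] {x y : T → ℝ} (hx : Continuous x)
    (hy : Continuous y) (h : ∀ s, 0 < y s) : Continuous fun s => pt (x s) (y s) (h s) := by
  refine UpperHalfPlane.isEmbedding_coe.continuous_iff.2 ?_
  change Continuous fun s => (⟨x s, y s⟩ : ℂ)
  have : (fun s => (⟨x s, y s⟩ : ℂ)) = fun s => (x s : ℂ) + (y s : ℂ) * Complex.I := by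
    ext s; apply Complex.ext <;> simp
  rw [this]; fun_prop

/-- The gradient of the height is essentially `fixQuad`: the derivative along a horizontal path
gives its imaginary part, the derivative along a vertical path (parametrized by an exponential to
stay in ℍ) its real part. -/
theorem fixQuad_eq_zero_of_isLocalExtr (M : Mat2) (z : ℍ) (h : IsLocalExtr (height M) z) :
    fixQuad M z = 0 := by
  have hy := z.im_ne_zero
  have pull : ∀ c : ℝ → ℍ, Continuous c → c 0 = z → IsLocalExtr (height M ∘ c) 0 := by
    intro c hc h0
    rw [← h0] at h
    exact h.comp_continuous hc.continuousAt
  have h1 : 2 * M 1 0 * z.re + (M 1 1 - M 0 0) = 0 := by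
    have hc := pull (fun s => pt (z.re + s) z.im z.im_pos)
      (continuous_pt (by fun_prop) (by fun_prop) _)
      (UpperHalfPlane.ext (Complex.ext (by simp [pt]) (by simp [pt])))
    have hd : HasDerivAt (height M ∘ fun s => pt (z.re + s) z.im z.im_pos)
        ((M 1 0 * (2 * (z.re + 0) * 1) + (M 1 1 - M 0 0) * 1) / z.im) 0 := by
      have e : HasDerivAt (fun s : ℝ => z.re + s) 1 0 := (hasDerivAt_id' 0).const_add _
      have e2 : HasDerivAt (fun s : ℝ => (M 1 0 * ((z.re + s) ^ 2 + z.im ^ 2) +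
        (M 1 1 - M 0 0) * (z.re + s) - M 0 1) / z.im)
        ((M 1 0 * ((2 : ℕ) * (z.re + 0) ^ 1 * 1) + (M 1 1 - M 0 0) * 1) / z.im) 0 :=
        ((((((e.pow 2).add_const (z.im ^ 2)).const_mul (M 1 0)).add
          (e.const_mul (M 1 1 - M 0 0))).sub_const (M 0 1)).div_const z.im)
      simp only [Nat.cast_ofNat, pow_one] at e2
      exact e2
    have := hc.hasDerivAt_eq_zero hd
    rw [div_eq_zero_iff] at this
    rcases this with h | h
    · linarith
    · exact absurd h hy
  have h2 : M 1 0 * (z.re ^ 2 - z.im ^ 2) + (M 1 1 - M 0 0) * z.re - M 0 1 = 0 := by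
    have hpos : ∀ s : ℝ, 0 < z.im * Real.exp s := fun s => mul_pos z.im_pos (Real.exp_pos s)
    have hc := pull (fun s => pt z.re (z.im * Real.exp s) (hpos s))
      (continuous_pt (by fun_prop) (by fun_prop) _)
      (UpperHalfPlane.ext (Complex.ext (by simp [pt]) (by simp [pt])))
    have e : HasDerivAt (fun s : ℝ => z.im * Real.exp s) (z.im * Real.exp 0) 0 :=
      (Real.hasDerivAt_exp 0).const_mul _
    have hd := ((((e.pow 2).const_add (z.re ^ 2)).const_mul (M 1 0)).add_const
      ((M 1 1 - M 0 0) * z.re)).sub_const (M 0 1) |>.div e (hpos 0).ne'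
    have := hc.hasDerivAt_eq_zero hd
    simp only [Real.exp_zero, mul_one, div_eq_zero_iff, Nat.cast_ofNat, Nat.add_one_sub_one,
      pow_one, Pi.pow_apply] at this
    rcases this with h | h
    · have h' : z.im * (M 1 0 * (z.re ^ 2 - z.im ^ 2) + (M 1 1 - M 0 0) * z.re - M 0 1) = 0 := by
        linear_combination -h
      exact (mul_eq_zero.1 h').resolve_left hy
    · exact absurd h (by simpa using hy)
  apply Complex.ext
  · rw [fixQuad_re, h2]; simp
  · rw [fixQuad_im, h1]; simp

theorem fixQuad_eq_zero_iff_smul (X : SL(2, ℝ)) (z : ℍ) : fixQuad X.1 z = 0 ↔ X • z = z := by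
  rw [smul_eq_self_iff, ← Complex.normSq_eq_zero, normSq_fixQuad, X.2]
  have := pow_ne_zero 2 z.im_ne_zero
  constructor
  · intro h
    have := (mul_eq_zero.1 h).resolve_left this
    linarith
  · intro h
    rw [mul_eq_zero]; right; linarith

/-- Where the squared height is minimal and nonzero, the height itself has a local extremum, and
such a point is fixed. -/
theorem height_eq_zero_of_mem_axis (X : SL(2, ℝ)) (z : ℍ) (hz : z ∈ axis (toPSL X))
    (hm : X • z ≠ z) : height X.1 z = 0 := by
  by_contra h0
  apply hm
  rw [← fixQuad_eq_zero_iff_smul]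
  apply fixQuad_eq_zero_of_isLocalExtr
  rw [mem_axis_toPSL] at hz
  rcases lt_or_gt_of_ne h0 with h | h
  · right
    filter_upwards [(continuous_height X.1).continuousAt.eventually (gt_mem_nhds h)] with w hw
    have := hz w
    nlinarith
  · left
    filter_upwards [(continuous_height X.1).continuousAt.eventually (lt_mem_nhds h)] with w hw
    have := hz w
    nlinarith

theorem mem_axis_of_height_eq_zero (X : SL(2, ℝ)) (z : ℍ) (h : height X.1 z = 0) :
    z ∈ axis (toPSL X) := by
  rw [mem_axis_toPSL]; intro w; rw [h]; nlinarith [sq_nonneg (height X.1 w)]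

/-- Seen from a point of the axis, the direction of the axis is `I * fixQuad` up to a real factor,
so angles between axes are arguments of quotients of values of `fixQuad`. -/
theorem discChart_smul (X : SL(2, ℝ)) (z : ℍ) (h : height X.1 z = 0) :
    discChart z (X • z) = Complex.I * fixQuad X.1 z / (z.im * X.1.trace : ℝ) := by
  have hh := height_mul_im X.1 z
  rw [h, zero_mul] at hh
  have hden := denom_ne_zero' X z
  have hconj : (starRingEnd ℂ) (z : ℂ) = (z.re : ℂ) - z.im * Complex.I := by
    apply Complex.ext <;> simp
  have hz : (z : ℂ) = (z.re : ℂ) + z.im * Complex.I := by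
    apply Complex.ext <;> simp
  have hhc : (X.1 1 0 : ℂ) * (z.re ^ 2 + z.im ^ 2) + (X.1 1 1 - X.1 0 0) * z.re - X.1 0 1 = 0 := by
    exact_mod_cast hh.symm
  rw [discChart, SL2_smul_coe, Matrix.trace_fin_two]
  have e1 : ((X.1 0 0 : ℂ) * z + X.1 0 1) / (X.1 1 0 * z + X.1 1 1) - z =
      -fixQuad X.1 z / (X.1 1 0 * z + X.1 1 1) := by
    rw [fixQuad, eq_div_iff hden, sub_mul, div_mul_cancel₀ _ hden]; ring
  have e2 : ((X.1 0 0 : ℂ) * z + X.1 0 1) / (X.1 1 0 * z + X.1 1 1) - (starRingEnd ℂ) (z : ℂ) =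
      Complex.I * (z.im * (X.1 0 0 + X.1 1 1) : ℝ) / (X.1 1 0 * z + X.1 1 1) := by
    rw [eq_div_iff hden, sub_mul, div_mul_cancel₀ _ hden, hconj]
    push_cast
    rw [hz]
    linear_combination (-1 : ℂ) * hhc + (X.1 1 0 : ℂ) * z.im ^ 2 * Complex.I_sq
  rw [e1, e2, div_div_div_cancel_right₀ hden]
  rcases eq_or_ne ((z.im * (X.1 0 0 + X.1 1 1) : ℝ) : ℂ) 0 with h0 | h0
  · rw [h0]; simp
  · field_simp
    rw [Complex.I_sq]; ring

/-! ### The angle between crossing axes -/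

/-- The commutator of two matrices. -/
def comm (X Y : Mat2) : Mat2 := X * Y - Y * X

/-- Positive exactly when `X`, `Y` are hyperbolic with crossing axes. -/
def crossDet (X Y : Mat2) : ℝ := (comm X Y).det

/-- Up to a factor, the cosine of the angle between the axes. -/
def crossNum (X Y : Mat2) : ℝ := 2 * (X * Y).trace - X.trace * Y.trace

theorem crossNum_eq (X Y : Mat2) : crossNum X Y =
    (X 0 0 - X 1 1) * (Y 0 0 - Y 1 1) + 2 * (X 0 1 * Y 1 0 + X 1 0 * Y 0 1) := by
  simp only [crossNum, Matrix.trace_fin_two, Matrix.mul_apply, Fin.sum_univ_two]; ring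

theorem comm_one_zero (X Y : Mat2) :
    comm X Y 1 0 = X 1 0 * (Y 0 0 - Y 1 1) - Y 1 0 * (X 0 0 - X 1 1) := by
  simp only [comm, Matrix.sub_apply, Matrix.mul_apply, Fin.sum_univ_two]; ring

theorem comm_zero_zero (X Y : Mat2) :
    comm X Y 0 0 = X 0 1 * Y 1 0 - Y 0 1 * X 1 0 := by
  simp only [comm, Matrix.sub_apply, Matrix.mul_apply, Fin.sum_univ_two]; ring

theorem comm_one_one (X Y : Mat2) :
    comm X Y 1 1 = -(X 0 1 * Y 1 0 - Y 0 1 * X 1 0) := by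
  simp only [comm, Matrix.sub_apply, Matrix.mul_apply, Fin.sum_univ_two]; ring

theorem comm_zero_one (X Y : Mat2) :
    comm X Y 0 1 = Y 0 1 * (X 0 0 - X 1 1) - X 0 1 * (Y 0 0 - Y 1 1) := by
  simp only [comm, Matrix.sub_apply, Matrix.mul_apply, Fin.sum_univ_two]; ring

theorem crossDet_eq (X Y : Mat2) : crossDet X Y = -(X 0 1 * Y 1 0 - Y 0 1 * X 1 0) ^ 2 -
    (Y 0 1 * (X 0 0 - X 1 1) - X 0 1 * (Y 0 0 - Y 1 1)) *
      (X 1 0 * (Y 0 0 - Y 1 1) - Y 1 0 * (X 0 0 - X 1 1)) := by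
  rw [crossDet, Matrix.det_fin_two, comm_one_one, comm_one_zero, comm_zero_one, comm_zero_zero]
  ring

theorem entry_of_height_eq_zero {X : Mat2} {z : ℍ} (hX : height X z = 0) :
    X 0 1 = X 1 0 * (z.re ^ 2 + z.im ^ 2) + (X 1 1 - X 0 0) * z.re := by
  have := height_mul_im X z
  rw [hX] at this; linarith

/-- At a common point of the axes `crossDet` is a square; the root `comm X Y 1 0 * z.im` is the one
whose sign records the orientation of the angle. -/
theorem crossDet_of_heights {X Y : Mat2} {z : ℍ} (hX : height X z = 0)
    (hY : height Y z = 0) : crossDet X Y = (comm X Y 1 0 * z.im) ^ 2 := by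
  rw [crossDet_eq, comm_one_zero, entry_of_height_eq_zero hX, entry_of_height_eq_zero hY]; ring

theorem fixQuad_mul_conj_re {X Y : Mat2} {z : ℍ} (hX : height X z = 0)
    (hY : height Y z = 0) :
    (fixQuad Y z * (starRingEnd ℂ) (fixQuad X z)).re = crossNum X Y * z.im ^ 2 := by
  rw [Complex.mul_re, Complex.conj_re, Complex.conj_im, fixQuad_re, fixQuad_re, fixQuad_im,
    fixQuad_im, crossNum_eq, entry_of_height_eq_zero hX, entry_of_height_eq_zero hY]; ring

theorem fixQuad_mul_conj_im {X Y : Mat2} {z : ℍ} (hX : height X z = 0)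
    (hY : height Y z = 0) :
    (fixQuad Y z * (starRingEnd ℂ) (fixQuad X z)).im = 2 * comm X Y 1 0 * z.im ^ 3 := by
  rw [Complex.mul_im, Complex.conj_re, Complex.conj_im, fixQuad_re, fixQuad_re, fixQuad_im,
    fixQuad_im, comm_one_zero, entry_of_height_eq_zero hX, entry_of_height_eq_zero hY]; ring

theorem toIcoMod_pi_arg_of_im_eq_zero (w : ℂ) (h : w.im = 0) :
    toIcoMod Real.pi_pos 0 (Complex.arg w) = 0 := by
  rw [toIcoMod_eq_iff]
  refine ⟨by simp [Real.pi_pos], ?_⟩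
  rcases le_or_gt 0 w.re with h' | h'
  · exact ⟨0, by simp [Complex.arg_eq_zero_iff.2 ⟨h', h⟩]⟩
  · exact ⟨1, by simp [Complex.arg_eq_pi_iff.2 ⟨h', h⟩]⟩

/-- Reduction modulo π multiplies sine and cosine by the same sign, so the cotangent survives it. -/
theorem toIcoMod_pi_arg_of_im_ne_zero (w : ℂ) (h : w.im ≠ 0) :
    0 < toIcoMod Real.pi_pos 0 (Complex.arg w) ∧
    toIcoMod Real.pi_pos 0 (Complex.arg w) < Real.pi ∧
    Real.cos (toIcoMod Real.pi_pos 0 (Complex.arg w)) /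
      Real.sin (toIcoMod Real.pi_pos 0 (Complex.arg w)) = w.re / w.im := by
  set φ := toIcoMod Real.pi_pos 0 (Complex.arg w) with hφ
  have hmem : φ ∈ Set.Ico (0 : ℝ) (0 + Real.pi) := toIcoMod_mem_Ico _ _ _
  obtain ⟨k, hk⟩ : ∃ k : ℤ, Complex.arg w = φ + k • Real.pi :=
    ((toIcoMod_eq_iff Real.pi_pos).1 hφ.symm).2
  have hw : w ≠ 0 := by rintro rfl; simp at h
  have hn : ‖w‖ ≠ 0 := norm_ne_zero_iff.2 hw
  have hφ' : φ = Complex.arg w - k * Real.pi := by rw [hk]; simp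
  have hs : Real.sin φ = (-1) ^ k * (w.im / ‖w‖) := by
    rw [hφ', Real.sin_sub_int_mul_pi, Complex.sin_arg]
  have hc : Real.cos φ = (-1) ^ k * (w.re / ‖w‖) := by
    rw [hφ', Real.cos_sub_int_mul_pi, Complex.cos_arg hw]
  have hne : ((-1 : ℝ)) ^ k ≠ 0 := zpow_ne_zero _ (by norm_num)
  have hs0 : Real.sin φ ≠ 0 := by
    rw [hs]; exact mul_ne_zero hne (div_ne_zero h hn)
  refine ⟨lt_of_le_of_ne hmem.1 ?_, by simpa using hmem.2, ?_⟩
  · intro h0; rw [← h0] at hs0; simp at hs0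
  · rw [hs, hc]; field_simp

theorem trace_ne_zero_of_height (X : SL(2, ℝ)) (z : ℍ) (hX : height X.1 z = 0)
    (h : fixQuad X.1 z ≠ 0) : 4 < X.1.trace ^ 2 := by
  have h1 := normSq_fixQuad X.1 z
  have h2 := Complex.normSq_pos.2 h
  rw [h1, hX, X.2] at h2
  have := pos_of_mul_pos_right h2 (by positivity)
  linarith

/-- The angle at a common point of two axes in terms of matrices. -/
theorem ccwAngle_eq (X Y : SL(2, ℝ)) (z : ℍ) (hX : height X.1 z = 0) (hY : height Y.1 z = 0)
    (h1 : fixQuad X.1 z ≠ 0) (h2 : fixQuad Y.1 z ≠ 0) :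
    (comm X.1 Y.1 1 0 = 0 → ccwAngle z (X • z) (Y • z) = 0) ∧
    (comm X.1 Y.1 1 0 ≠ 0 → 0 < ccwAngle z (X • z) (Y • z) ∧
      ccwAngle z (X • z) (Y • z) < Real.pi ∧
      Real.cos (ccwAngle z (X • z) (Y • z)) / Real.sin (ccwAngle z (X • z) (Y • z)) =
        crossNum X.1 Y.1 / (2 * (comm X.1 Y.1 1 0 * z.im))) := by
  have hy := z.im_ne_zero
  have ht1 : X.1.trace ≠ 0 := by
    intro h; have := trace_ne_zero_of_height X z hX h1; rw [h] at this; norm_num at this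
  have ht2 : Y.1.trace ≠ 0 := by
    intro h; have := trace_ne_zero_of_height Y z hY h2; rw [h] at this; norm_num at this
  set w := discChart z (Y • z) / discChart z (X • z) with hw
  -- The real factor `r` may be negative, according to the signs of the traces; this is harmless
  -- because the angle is taken modulo π.
  set r : ℝ := X.1.trace / (Y.1.trace * Complex.normSq (fixQuad X.1 z)) with hr
  have hr0 : r ≠ 0 := div_ne_zero ht1 (mul_ne_zero ht2 (Complex.normSq_pos.2 h1).ne')
  have hwr : w = r * (fixQuad Y.1 z * (starRingEnd ℂ) (fixQuad X.1 z)) := by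
    rw [hw, discChart_smul X z hX, discChart_smul Y z hY, hr]
    push_cast
    rw [Complex.normSq_eq_conj_mul_self]
    have : (starRingEnd ℂ) (fixQuad X.1 z) ≠ 0 := by simpa using h1
    have a1 : (X.1.trace : ℂ) ≠ 0 := by exact_mod_cast ht1
    have a2 : (Y.1.trace : ℂ) ≠ 0 := by exact_mod_cast ht2
    have a3 : (z.im : ℂ) ≠ 0 := by exact_mod_cast hy
    have a4 := Complex.I_ne_zero
    field_simp
  have hre : w.re = r * (crossNum X.1 Y.1 * z.im ^ 2) := by
    rw [hwr, Complex.re_ofReal_mul, fixQuad_mul_conj_re hX hY]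
  have him : w.im = r * (2 * comm X.1 Y.1 1 0 * z.im ^ 3) := by
    rw [hwr, Complex.im_ofReal_mul, fixQuad_mul_conj_im hX hY]
  have hcc : ccwAngle z (X • z) (Y • z) = toIcoMod Real.pi_pos 0 (Complex.arg w) := rfl
  rw [hcc]
  constructor
  · intro h
    exact toIcoMod_pi_arg_of_im_eq_zero w (by rw [him, h]; ring)
  · intro h
    obtain ⟨b1, b2, b3⟩ := toIcoMod_pi_arg_of_im_ne_zero w
      (by rw [him]; exact mul_ne_zero hr0 (mul_ne_zero (mul_ne_zero two_ne_zero h)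
        (pow_ne_zero 3 hy)))
    refine ⟨b1, b2, ?_⟩
    rw [b3, hre, him]
    field_simp

theorem ccwAngle_eq_zero_left (z w : ℍ) : ccwAngle z z w = 0 := by
  have h0 : discChart z z = 0 := by simp [discChart]
  rw [ccwAngle, h0, div_zero]
  exact toIcoMod_pi_arg_of_im_eq_zero 0 rfl

theorem ccwAngle_eq_zero_right (z w : ℍ) : ccwAngle z w z = 0 := by
  have h0 : discChart z z = 0 := by simp [discChart]
  rw [ccwAngle, h0, zero_div]
  exact toIcoMod_pi_arg_of_im_eq_zero 0 rfl

/-- A nonzero angle alone certifies crossing axes, because disjoint axes, fixed points and parallel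
directions all give the value 0. This is how crossing is known for twisted representations. -/
theorem crossDet_pos_of_axisAngle_ne_zero (X Y : SL(2, ℝ))
    (h : axisAngle (toPSL X) (toPSL Y) ≠ 0) : 0 < crossDet X.1 Y.1 := by
  unfold axisAngle at h
  split_ifs at h with H
  · have hz := H.some_mem
    set z := H.some
    rw [toPSL_smul, toPSL_smul] at h
    have m1 : X • z ≠ z := by intro h1; rw [h1, ccwAngle_eq_zero_left] at h; exact h rfl
    have m2 : Y • z ≠ z := by intro h1; rw [h1, ccwAngle_eq_zero_right] at h; exact h rfl
    have e1 := height_eq_zero_of_mem_axis X z hz.1 m1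
    have e2 := height_eq_zero_of_mem_axis Y z hz.2 m2
    have e3 := mt (fixQuad_eq_zero_iff_smul X z).1 m1
    have e4 := mt (fixQuad_eq_zero_iff_smul Y z).1 m2
    rw [crossDet_of_heights e1 e2]
    have : comm X.1 Y.1 1 0 ≠ 0 := fun h0 => h ((ccwAngle_eq X Y z e1 e2 e3 e4).1 h0)
    exact sq_pos_of_ne_zero (mul_ne_zero this z.im_ne_zero)
  · exact absurd rfl h

theorem comm_one_zero_ne_zero (X Y : Mat2) (h : 0 < crossDet X Y) : comm X Y 1 0 ≠ 0 := by
  intro h0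
  rw [comm_one_zero] at h0
  rw [crossDet_eq, h0] at h
  nlinarith [sq_nonneg (X 0 1 * Y 1 0 - Y 0 1 * X 1 0)]

theorem exists_heights_eq_zero (X Y : Mat2) (h : 0 < crossDet X Y) :
    ∃ z, height X z = 0 ∧ height Y z = 0 := by
  have hk := comm_one_zero_ne_zero X Y h
  have hpos : 0 < Real.sqrt (crossDet X Y) / |comm X Y 1 0| :=
    div_pos (Real.sqrt_pos.2 h) (abs_pos.2 hk)
  -- Eliminating `x² + y²` from the two linear equations gives the real part; the imaginary part is
  -- then forced by `crossDet_of_heights`.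
  refine ⟨pt (comm X Y 0 0 / comm X Y 1 0) _ hpos, ?_, ?_⟩
  all_goals
    rw [height, pt_re, pt_im, div_eq_zero_iff]
    left
    rw [div_pow, div_pow, Real.sq_sqrt h.le, sq_abs, ← add_div, crossDet_eq, comm_zero_zero]
    rw [comm_one_zero] at *
    field_simp
    ring

theorem trace_sq_of_crossDet_pos (X Y : SL(2, ℝ)) (h : 0 < crossDet X.1 Y.1) :
    4 < X.1.trace ^ 2 ∧ 4 < Y.1.trace ^ 2 := by
  obtain ⟨z, hX, hY⟩ := exists_heights_eq_zero X.1 Y.1 h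
  have h3 := fixQuad_mul_conj_im hX hY
  have hk := comm_one_zero_ne_zero X.1 Y.1 h
  have h4 : 2 * comm X.1 Y.1 1 0 * z.im ^ 3 ≠ 0 :=
    mul_ne_zero (mul_ne_zero two_ne_zero hk) (pow_ne_zero 3 z.im_ne_zero)
  constructor
  · apply trace_ne_zero_of_height X z hX
    intro h0; rw [h0] at h3; simp at h3; exact hk (h3.resolve_right z.im_ne_zero)
  · apply trace_ne_zero_of_height Y z hY
    intro h0; rw [h0] at h3; simp at h3; exact hk (h3.resolve_right z.im_ne_zero)

/-- The cotangent of the angle between crossing axes. -/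
theorem axisAngle_of_crossDet_pos (X Y : SL(2, ℝ)) (h : 0 < crossDet X.1 Y.1) :
    0 < axisAngle (toPSL X) (toPSL Y) ∧ axisAngle (toPSL X) (toPSL Y) < Real.pi ∧
    ∃ k : ℝ, k ^ 2 = crossDet X.1 Y.1 ∧ 0 < k * comm X.1 Y.1 1 0 ∧
      Real.cos (axisAngle (toPSL X) (toPSL Y)) / Real.sin (axisAngle (toPSL X) (toPSL Y)) =
        crossNum X.1 Y.1 / (2 * k) := by
  obtain ⟨z₀, hX₀, hY₀⟩ := exists_heights_eq_zero X.1 Y.1 h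
  have H : (axis (toPSL X) ∩ axis (toPSL Y)).Nonempty :=
    ⟨z₀, mem_axis_of_height_eq_zero X z₀ hX₀, mem_axis_of_height_eq_zero Y z₀ hY₀⟩
  obtain ⟨t1, t2⟩ := trace_sq_of_crossDet_pos X Y h
  have hz := H.some_mem
  have e : axisAngle (toPSL X) (toPSL Y) = ccwAngle H.some (X • H.some) (Y • H.some) := by
    rw [axisAngle, dif_pos H]; rfl
  rw [e]
  generalize H.some = z at hz
  have m1 : X • z ≠ z := by
    rw [Ne, smul_eq_self_iff]; nlinarith [sq_nonneg (height X.1 z)]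
  have m2 : Y • z ≠ z := by
    rw [Ne, smul_eq_self_iff]; nlinarith [sq_nonneg (height Y.1 z)]
  have e1 := height_eq_zero_of_mem_axis X z hz.1 m1
  have e2 := height_eq_zero_of_mem_axis Y z hz.2 m2
  have e3 := mt (fixQuad_eq_zero_iff_smul X z).1 m1
  have e4 := mt (fixQuad_eq_zero_iff_smul Y z).1 m2
  have hk := comm_one_zero_ne_zero X.1 Y.1 h
  obtain ⟨b1, b2, b3⟩ := (ccwAngle_eq X Y z e1 e2 e3 e4).2 hk
  refine ⟨b1, b2, comm X.1 Y.1 1 0 * z.im, (crossDet_of_heights e1 e2).symm, ?_, b3⟩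
  have := mul_pos (sq_pos_of_ne_zero hk) z.im_pos
  nlinarith

/-! ### Lifts to SL(2,ℝ), wedge products and rank one matrices -/

theorem toPSL_eq_iff (X Y : SL(2, ℝ)) : toPSL X = toPSL Y ↔ X.1 = Y.1 ∨ X.1 = -Y.1 := by
  rw [toPSL, toPSL, QuotientGroup.eq, Matrix.SpecialLinearGroup.mem_center_iff]
  constructor
  · rintro ⟨r, hr, h⟩
    have hY : Y.1 = r • X.1 := by
      have h1 : Y = X * (X⁻¹ * Y) := by group
      have h2 : Y.1 = X.1 * (X⁻¹ * Y).1 := by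
        conv_lhs => rw [h1]
        rfl
      rw [h2, ← h]; ext i j
      fin_cases j <;> simp [Matrix.mul_apply, Fin.sum_univ_two, mul_comm]
    have hr' : (r - 1) * (r + 1) = 0 := by
      have : r ^ 2 = 1 := by simpa using hr
      linear_combination this
    rcases mul_eq_zero.1 hr' with h' | h'
    · left; rw [hY, show r = 1 by linarith, one_smul]
    · right; rw [hY, show r = -1 by linarith, neg_smul, one_smul, neg_neg]
  · rintro (h | h)
    · refine ⟨1, by simp, ?_⟩
      have : X = Y := Subtype.ext h
      rw [this]; simp
    · refine ⟨-1, by simp, ?_⟩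
      have : X = -Y := Subtype.ext h
      rw [this]
      have : (-Y)⁻¹ * Y = -1 := by
        apply Subtype.ext
        rw [Matrix.SpecialLinearGroup.coe_mul, SL2_inv_coe, Matrix.SpecialLinearGroup.coe_neg,
          Matrix.SpecialLinearGroup.coe_neg]
        have := SL2_det Y
        ext i j
        fin_cases i <;> fin_cases j <;>
          simp [Matrix.mul_apply, Fin.sum_univ_two] <;> linarith
      rw [this]; ext i j; fin_cases i <;> fin_cases j <;> simp

theorem mul_mul_inv_coe (X Y : SL(2, ℝ)) : (X * Y * X⁻¹).1 = X.1 * Y.1 * X⁻¹.1 := rfl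

theorem coe_mul_coe_inv (X : SL(2, ℝ)) : X.1 * (X⁻¹).1 = 1 := by
  have : (X * X⁻¹).1 = (1 : SL(2, ℝ)).1 := by rw [mul_inv_cancel]
  exact this

theorem coe_inv_mul_coe (X : SL(2, ℝ)) : (X⁻¹).1 * X.1 = 1 := by
  have : (X⁻¹ * X).1 = (1 : SL(2, ℝ)).1 := by rw [inv_mul_cancel]
  exact this

theorem trace_conj (X : SL(2, ℝ)) (M : Mat2) : (X.1 * M * (X⁻¹).1).trace = M.trace := by
  rw [Matrix.trace_mul_comm, ← mul_assoc, coe_inv_mul_coe, one_mul]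

/-- The rank one matrix `x ↦ wedge w x • u`. -/
def rankOne (u w : Fin 2 → ℝ) : Mat2 := !![-(u 0 * w 1), u 0 * w 0; -(u 1 * w 1), u 1 * w 0]

/-- Two parallel matrices have the same axis. -/
theorem height_eq_zero_of_comm_eq_zero (X Y : Mat2) (z : ℍ) (h : X * Y = Y * X)
    (hX : X 1 0 ≠ 0 ∨ X 0 1 ≠ 0 ∨ X 1 1 - X 0 0 ≠ 0) (hz : height X z = 0) : height Y z = 0 := by
  have h0 : comm X Y = 0 := by rw [comm, h, sub_self]
  have h1 := comm_one_zero X Y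
  have h2 := comm_zero_zero X Y
  have h3 := comm_zero_one X Y
  rw [h0] at h1 h2 h3
  simp only [Matrix.zero_apply] at h1 h2 h3
  have hl := height_mul_im X z
  rw [hz, zero_mul] at hl
  have hq : Y 1 0 * (z.re ^ 2 + z.im ^ 2) + (Y 1 1 - Y 0 0) * z.re - Y 0 1 = 0 := by
    rcases hX with h | h | h
    · apply (mul_eq_zero.1 _).resolve_left h
      linear_combination -(Y 1 0) * hl + z.re * h1 - h2
    · apply (mul_eq_zero.1 _).resolve_left h
      linear_combination -(Y 0 1) * hl - (z.re ^ 2 + z.im ^ 2) * h2 - z.re * h3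
    · apply (mul_eq_zero.1 _).resolve_left h
      linear_combination -(Y 1 1 - Y 0 0) * hl - (z.re ^ 2 + z.im ^ 2) * h1 - h3
  rw [height, hq, zero_div]

theorem nonscalar_of_trace_sq (X : SL(2, ℝ)) (h : 4 < X.1.trace ^ 2) :
    X.1 1 0 ≠ 0 ∨ X.1 0 1 ≠ 0 ∨ X.1 1 1 - X.1 0 0 ≠ 0 := by
  by_contra! hc
  obtain ⟨h1, h2, h3⟩ := hc
  have hd := SL2_det X
  rw [Matrix.trace_fin_two] at h
  rw [h1, h2] at hd
  have : X.1 1 1 = X.1 0 0 := by linarith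
  rw [this] at h hd
  nlinarith

theorem wedge_smul_right (r : ℝ) (u v : Fin 2 → ℝ) : wedge u (r • v) = r * wedge u v := by
  simp [wedge]; ring

theorem wedge_smul_left (r : ℝ) (u v : Fin 2 → ℝ) : wedge (r • u) v = r * wedge u v := by
  simp [wedge]; ring

theorem wedge_self (u : Fin 2 → ℝ) : wedge u u = 0 := by simp [wedge]; ring

theorem exists_smul_of_wedge_eq_zero {u v : Fin 2 → ℝ} (hu : u ≠ 0) (h : wedge u v = 0) :
    ∃ r : ℝ, v = r • u := by
  have hne : u 0 ≠ 0 ∨ u 1 ≠ 0 := by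
    by_contra! hc
    apply hu; ext i; fin_cases i
    · exact hc.1
    · exact hc.2
  have h' : u 0 * v 1 = u 1 * v 0 := by unfold wedge at h; linarith
  rcases hne with hh | hh
  · refine ⟨v 0 / u 0, ?_⟩
    ext i; fin_cases i
    · simp [hh]
    · simp; field_simp; linarith
  · refine ⟨v 1 / u 1, ?_⟩
    ext i; fin_cases i
    · simp; field_simp; linarith
    · simp [hh]

theorem mulVec_zero_apply (M : Mat2) (v : Fin 2 → ℝ) : M.mulVec v 0 = M 0 0 * v 0 + M 0 1 * v 1 := by
  simp [Matrix.mulVec, dotProduct, Fin.sum_univ_two]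

theorem mulVec_one_apply (M : Mat2) (v : Fin 2 → ℝ) : M.mulVec v 1 = M 1 0 * v 0 + M 1 1 * v 1 := by
  simp [Matrix.mulVec, dotProduct, Fin.sum_univ_two]

theorem wedge_mulVec_mulVec (M : Mat2) (u v : Fin 2 → ℝ) :
    wedge (M.mulVec u) (M.mulVec v) = M.det * wedge u v := by
  simp only [wedge, mulVec_zero_apply, mulVec_one_apply, Matrix.det_fin_two]; ring

theorem mul_rankOne (M : Mat2) (u w : Fin 2 → ℝ) : M * rankOne u w = rankOne (M.mulVec u) w := by
  ext i j
  fin_cases i <;> fin_cases j <;>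
    simp [rankOne, Matrix.mul_apply, Fin.sum_univ_two, mulVec_zero_apply, mulVec_one_apply] <;> ring

theorem rankOne_mul (X : SL(2, ℝ)) (u w : Fin 2 → ℝ) :
    rankOne u w * X.1 = rankOne u ((X⁻¹).1.mulVec w) := by
  ext i j
  fin_cases i <;> fin_cases j <;>
    simp [rankOne, Matrix.mul_apply, Fin.sum_univ_two, mulVec_zero_apply, mulVec_one_apply,
      SL2_inv_coe, -Matrix.SpecialLinearGroup.coe_inv] <;> ring

theorem rankOne_smul_left (r : ℝ) (u w : Fin 2 → ℝ) : rankOne (r • u) w = r • rankOne u w := by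
  ext i j
  fin_cases i <;> fin_cases j <;> simp [rankOne] <;> ring

theorem rankOne_smul_right (r : ℝ) (u w : Fin 2 → ℝ) : rankOne u (r • w) = r • rankOne u w := by
  ext i j
  fin_cases i <;> fin_cases j <;> simp [rankOne] <;> ring

theorem rankOne_mul_rankOne (u w u' w' : Fin 2 → ℝ) :
    rankOne u w * rankOne u' w' = wedge w u' • rankOne u w' := by
  ext i j
  fin_cases i <;> fin_cases j <;>
    simp [rankOne, Matrix.mul_apply, Fin.sum_univ_two, wedge] <;> ring

theorem trace_rankOne (u w : Fin 2 → ℝ) : (rankOne u w).trace = wedge w u := by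
  simp [rankOne, Matrix.trace_fin_two, wedge]; ring

/-- For `k ≠ 0` this vanishes only if `u` or `w` is parallel to its image under `X`, that is, if a
limit endpoint is an endpoint of the axis of `X`. -/
theorem crossDet_rankOne (X : Mat2) (k : ℝ) (u w : Fin 2 → ℝ) :
    crossDet X (k • rankOne u w) =
      -(k ^ 2 * wedge u (X.mulVec u) * wedge w (X.mulVec w)) := by
  rw [crossDet_eq]
  simp [rankOne, wedge, mulVec_zero_apply, mulVec_one_apply]
  ring

/-- A traceless singular `2 × 2` matrix is nilpotent, so its image lies in its kernel line. -/
theorem eq_smul_rankOne_of_mulVec_eq_zero (K : Mat2) (e : Fin 2 → ℝ) (he : e ≠ 0)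
    (hK : K.mulVec e = 0) (ht : K.trace = 0) : ∃ k : ℝ, K = k • rankOne e e := by
  have h0 := congrFun hK 0
  have h1 := congrFun hK 1
  rw [mulVec_zero_apply] at h0
  rw [mulVec_one_apply] at h1
  rw [Matrix.trace_fin_two] at ht
  simp only [Pi.zero_apply] at h0 h1
  have h11 : K 1 1 = -K 0 0 := by linarith
  rw [h11] at h1
  have hne : e 0 ≠ 0 ∨ e 1 ≠ 0 := by
    by_contra! hc
    apply he; ext i; fin_cases i
    · exact hc.1
    · exact hc.2
  rcases hne with h | h
  · refine ⟨K 0 1 / e 0 ^ 2, ?_⟩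
    have a0 : K 0 0 = -(K 0 1 * e 1) / e 0 := by field_simp; linarith
    have a1 : K 1 0 = -(K 0 1 * e 1 ^ 2) / e 0 ^ 2 := by
      have : K 1 0 = K 0 0 * e 1 / e 0 := by field_simp; linarith
      rw [this, a0]; field_simp
    ext i j
    fin_cases i <;> fin_cases j <;> simp [rankOne, h11, a0, a1] <;> field_simp
  · refine ⟨-K 1 0 / e 1 ^ 2, ?_⟩
    have a0 : K 0 0 = K 1 0 * e 0 / e 1 := by field_simp; linarith
    have a1 : K 0 1 = -(K 1 0 * e 0 ^ 2) / e 1 ^ 2 := by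
      have : K 0 1 = -(K 0 0 * e 0) / e 1 := by field_simp; linarith
      rw [this, a0]; field_simp
    ext i j
    fin_cases i <;> fin_cases j <;> simp [rankOne, h11, a0, a1] <;> field_simp

theorem comm_trace (X Y : Mat2) : (comm X Y).trace = 0 := by
  rw [comm, Matrix.trace_sub, Matrix.trace_mul_comm, sub_self]

/-! ### Discreteness and common fixed points at infinity -/

theorem eigenvalue_ne_zero (X : SL(2, ℝ)) {e : Fin 2 → ℝ} (he : e ≠ 0) {k : ℝ}
    (h : X.1.mulVec e = k • e) : k ≠ 0 := by
  rintro rfl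
  rw [zero_smul] at h
  have : (X⁻¹).1.mulVec (X.1.mulVec e) = 0 := by rw [h, Matrix.mulVec_zero]
  rw [Matrix.mulVec_mulVec, coe_inv_mul_coe, Matrix.one_mulVec] at this
  exact he this

theorem inv_mulVec_eigen (X : SL(2, ℝ)) {e : Fin 2 → ℝ} (he : e ≠ 0) {k : ℝ}
    (h : X.1.mulVec e = k • e) : (X⁻¹).1.mulVec e = k⁻¹ • e := by
  have hk := eigenvalue_ne_zero X he h
  have : (X⁻¹).1.mulVec (X.1.mulVec e) = e := by
    rw [Matrix.mulVec_mulVec, coe_inv_mul_coe, Matrix.one_mulVec]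
  rw [h, Matrix.mulVec_smul] at this
  conv_rhs => rw [← this]
  rw [smul_smul, inv_mul_cancel₀ hk, one_smul]

theorem eigenvalue_sq_ne_one (X : SL(2, ℝ)) (ht : 4 < X.1.trace ^ 2) {e : Fin 2 → ℝ} (he : e ≠ 0)
    {k : ℝ} (h : X.1.mulVec e = k • e) : k ^ 2 ≠ 1 := by
  intro hk
  have hdet : (X.1 - k • (1 : Mat2)).det = 0 := by
    rw [← Matrix.exists_mulVec_eq_zero_iff]
    refine ⟨e, he, ?_⟩
    rw [Matrix.sub_mulVec, h, Matrix.smul_mulVec, Matrix.one_mulVec, sub_self]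
  have hd := SL2_det X
  rw [Matrix.det_fin_two] at hdet
  simp at hdet
  rw [Matrix.trace_fin_two] at ht
  have e1 : k * (X.1 0 0 + X.1 1 1) = 2 := by
    linear_combination hd - hdet + hk
  have : k ^ 2 * (X.1 0 0 + X.1 1 1) ^ 2 = 4 := by
    rw [← mul_pow, e1]; norm_num
  rw [hk] at this; linarith

/-- In a discrete group, two hyperbolic elements that share a fixed point at infinity commute;
here under the assumption that the shared eigenvalue is contracting. -/
theorem commute_of_contracting_eigenvector {ρ : G →* PSL2R} (hρ : IsClosedSurfaceRep ρ) {g h : G}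
    {X Y : SL(2, ℝ)} (hX : toPSL X = ρ g) (hY : toPSL Y = ρ h) (hYt : 4 < Y.1.trace ^ 2)
    {e : Fin 2 → ℝ} (he : e ≠ 0) {k l : ℝ} (hXe : X.1.mulVec e = k • e)
    (hYe : Y.1.mulVec e = l • e) (hk : k ^ 2 < 1) : X.1 * Y.1 = Y.1 * X.1 := by
  by_contra hne
  set K := comm X.1 Y.1 with hK
  have hK0 : K ≠ 0 := fun h0 => hne (sub_eq_zero.1 h0)
  have hk0 := eigenvalue_ne_zero X he hXe
  have hk2 : 0 < k ^ 2 := by positivity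
  have hKe : K.mulVec e = 0 := by
    rw [hK, comm, Matrix.sub_mulVec, ← Matrix.mulVec_mulVec, ← Matrix.mulVec_mulVec, hXe, hYe,
      Matrix.mulVec_smul, Matrix.mulVec_smul, hXe, hYe, smul_smul, smul_smul, mul_comm, sub_self]
  obtain ⟨κ, hκ⟩ := eq_smul_rankOne_of_mulVec_eq_zero K e he hKe (comm_trace _ _)
  have hKX : K * (X⁻¹).1 = k • K := by
    rw [hκ, Matrix.smul_mul, rankOne_mul, inv_inv, hXe, rankOne_smul_right, smul_comm]
  have hXK : X.1 * K = k • K := by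
    rw [hκ, Matrix.mul_smul, mul_rankOne, hXe, rankOne_smul_left, smul_comm]
  -- Conjugation by `X` sends `Y` to `Y + k K` and scales `K` by `k²`, so `s` solves `s (n + 1) = k
  -- + k² s n` with `s 0 = 0`. It stays bounded because `k² < 1`.
  let s : ℕ → ℝ := fun n => k * ((k ^ 2) ^ n - 1) / (k ^ 2 - 1)
  have hs : ∀ n, s n = k * ((k ^ 2) ^ n - 1) / (k ^ 2 - 1) := fun n => rfl
  have hk1 : k ^ 2 - 1 ≠ 0 := by linarith
  have hconj : ∀ n : ℕ, (X ^ n * Y * (X ^ n)⁻¹).1 = Y.1 + s n • K := by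
    intro n
    induction n with
    | zero => simp [hs]
    | succ n ih =>
      have e1 : X ^ (n + 1) * Y * (X ^ (n + 1))⁻¹ = X * (X ^ n * Y * (X ^ n)⁻¹) * X⁻¹ := by
        rw [pow_succ']; group
      have e2 : X.1 * Y.1 * (X⁻¹).1 = Y.1 + k • K := by
        have : X.1 * Y.1 = K + Y.1 * X.1 := by rw [hK, comm]; abel
        rw [this, add_mul, hKX, mul_assoc, coe_mul_coe_inv, mul_one, add_comm]
      rw [e1, mul_mul_inv_coe, ih, mul_add, add_mul, e2, Matrix.mul_smul, hXK, Matrix.smul_mul,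
        Matrix.smul_mul, hKX, smul_smul, smul_smul, add_assoc, ← add_smul]
      congr 2
      rw [hs, hs]; field_simp; ring
  have hsb : ∀ n, |s n| ≤ |k| / (1 - k ^ 2) := by
    intro n
    rw [hs, abs_div, abs_mul, abs_of_neg (by linarith : k ^ 2 - 1 < 0), neg_sub]
    have h1 : (k ^ 2) ^ n ≤ 1 := pow_le_one₀ hk2.le hk.le
    have h2 : 0 < (k ^ 2) ^ n := pow_pos hk2 n
    have h3 : |(k ^ 2) ^ n - 1| ≤ 1 := by rw [abs_le]; constructor <;> linarith
    have h4 : 0 < 1 - k ^ 2 := by linarith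
    gcongr
    exact mul_le_of_le_one_right (abs_nonneg k) h3
  have htr : ∀ n, (Y.1 + s n • K).trace = Y.1.trace := by
    intro n; rw [Matrix.trace_add, Matrix.trace_smul, hK, comm_trace]; simp
  set B := |k| / (1 - k ^ 2)
  -- The conjugates have constant trace and bounded height at `I`, so they all move `I` a bounded
  -- distance; proper discontinuity leaves only finitely many of them.
  obtain ⟨R, hR⟩ : ∃ R, ∀ n : ℕ, dist UpperHalfPlane.I ((X ^ n * Y * (X ^ n)⁻¹) • UpperHalfPlane.I) ≤ R := by
    refine ⟨(|height Y.1 UpperHalfPlane.I| + B * |height K UpperHalfPlane.I|) ^ 2 + Y.1.trace ^ 2, fun n => ?_⟩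
    have h1 := four_sinh_sq (X ^ n * Y * (X ^ n)⁻¹) UpperHalfPlane.I
    rw [hconj, htr, height_add, height_smul_mat] at h1
    set d := dist UpperHalfPlane.I ((X ^ n * Y * (X ^ n)⁻¹) • UpperHalfPlane.I)
    have hd : 0 ≤ d := dist_nonneg
    have h2 : d / 2 ≤ Real.sinh (d / 2) := Real.self_le_sinh_iff.2 (by positivity)
    have h3 : |height Y.1 UpperHalfPlane.I + s n * height K UpperHalfPlane.I| ≤
        |height Y.1 UpperHalfPlane.I| + B * |height K UpperHalfPlane.I| := by
      refine (abs_add_le _ _).trans ?_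
      rw [abs_mul]; gcongr; exact hsb n
    have h4 := pow_le_pow_left₀ (abs_nonneg _) h3 2
    rw [sq_abs] at h4
    nlinarith
  have hfin := hρ.properlyDiscontinuous (Metric.closedBall UpperHalfPlane.I R)
    (isCompact_closedBall _ _)
  have hmem : ∀ n : ℕ, g ^ n * h * (g ^ n)⁻¹ ∈
      {g : G | ((fun z => ρ g • z) '' Metric.closedBall UpperHalfPlane.I R ∩
        Metric.closedBall UpperHalfPlane.I R).Nonempty} := by
    intro n
    have e1 : ρ (g ^ n * h * (g ^ n)⁻¹) = toPSL (X ^ n * Y * (X ^ n)⁻¹) := by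
      simp only [map_mul, map_inv, map_pow, ← hX, ← hY]; rfl
    refine ⟨ρ (g ^ n * h * (g ^ n)⁻¹) • UpperHalfPlane.I, ⟨UpperHalfPlane.I, ?_, rfl⟩, ?_⟩
    · exact Metric.mem_closedBall_self (dist_nonneg.trans (hR 0))
    · rw [e1, toPSL_smul, Metric.mem_closedBall, dist_comm]; exact hR n
  obtain ⟨n, -, m, -, hnm, heq⟩ := Set.infinite_univ.exists_ne_map_eq_of_mapsTo
    (fun n _ => hmem n) hfin
  have e1 : toPSL (X ^ n * Y * (X ^ n)⁻¹) = toPSL (X ^ m * Y * (X ^ m)⁻¹) := by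
    have := congrArg ρ heq
    simp only [map_mul, map_inv, map_pow, ← hX, ← hY] at this
    exact this
  -- Two conjugates coincide in PSL. With equal signs, two different powers of `k²` would agree;
  -- with opposite signs, the trace of `Y` would vanish.
  rcases (toPSL_eq_iff _ _).1 e1 with h1 | h1
  · rw [hconj, hconj, add_right_inj] at h1
    have h2 : (s n - s m) • K = 0 := by rw [sub_smul, h1, sub_self]
    have h3 := (smul_eq_zero.1 h2).resolve_right hK0
    rw [hs, hs] at h3
    have h4 : (k ^ 2) ^ n = (k ^ 2) ^ m := by
      have : k * ((k ^ 2) ^ n - 1) / (k ^ 2 - 1) = k * ((k ^ 2) ^ m - 1) / (k ^ 2 - 1) := by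
        linarith
      field_simp at this
      linarith
    exact hnm (pow_right_injective₀ hk2 hk.ne h4)
  · have h2 := congrArg Matrix.trace h1
    rw [Matrix.trace_neg, hconj, hconj, htr, htr] at h2
    have : Y.1.trace = 0 := by linarith
    rw [this] at hYt; norm_num at hYt

/-- In a discrete group, two hyperbolic elements that share a fixed point at infinity commute. -/
theorem commute_of_common_eigenvector {ρ : G →* PSL2R} (hρ : IsClosedSurfaceRep ρ) {g h : G}
    {X Y : SL(2, ℝ)} (hX : toPSL X = ρ g) (hY : toPSL Y = ρ h) (hXt : 4 < X.1.trace ^ 2)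
    (hYt : 4 < Y.1.trace ^ 2) {e : Fin 2 → ℝ} (he : e ≠ 0) {k l : ℝ}
    (hXe : X.1.mulVec e = k • e) (hYe : Y.1.mulVec e = l • e) : X.1 * Y.1 = Y.1 * X.1 := by
  have h1 := eigenvalue_sq_ne_one X hXt he hXe
  have hk0 := eigenvalue_ne_zero X he hXe
  rcases lt_or_gt_of_ne h1 with h | h
  · exact commute_of_contracting_eigenvector hρ hX hY hYt he hXe hYe h
  · have hX' : toPSL X⁻¹ = ρ g⁻¹ := by rw [map_inv, ← hX]; rfl
    have h2 := commute_of_contracting_eigenvector hρ hX' hY hYt he (inv_mulVec_eigen X he hXe) hYe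
      (by rw [inv_pow]; exact inv_lt_one_of_one_lt₀ h)
    have h3 : X.1 * ((X⁻¹).1 * Y.1) * X.1 = X.1 * (Y.1 * (X⁻¹).1) * X.1 := by rw [h2]
    rw [← mul_assoc, coe_mul_coe_inv, one_mul, mul_assoc, mul_assoc, coe_inv_mul_coe, mul_one] at h3
    exact h3.symm

/-! ### Abstract wall systems and the transport cocycle -/

section Walls

variable {W Ω Γ : Type*} [Group Γ]

/-- The walls that separate two points. -/
def separating (side : W → Ω → Prop) (x y : Ω) : Set W := {c | ¬(side c x ↔ side c y)}

/-- Seen from `x`, the wall `c` lies before the wall `c'`. -/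
def IsBefore (side : W → Ω → Prop) (x : Ω) (c c' : W) : Prop :=
  ∀ p, (side c p ↔ side c x) → (side c' p ↔ side c' x)

/-- A family of pairwise nested walls in a space, finitely many between any two points. -/
structure IsWallSystem (side : W → Ω → Prop) : Prop where
  finite : ∀ x y, (separating side x y).Finite
  nested : ∀ c c', c ≠ c' → ∃ a b : Prop, ∀ p, ¬((side c p ↔ a) ∧ (side c' p ↔ b))
  ext : ∀ c c', (∀ p q, (side c p ↔ side c q) ↔ (side c' p ↔ side c' q)) → c = c'

/-- The list `l` consists of the walls between `x` and `y` in the order from `x` to `y`. -/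
structure IsChain (side : W → Ω → Prop) (x y : Ω) (l : List W) : Prop where
  nodup : l.Nodup
  mem : ∀ c, c ∈ l ↔ c ∈ separating side x y
  sorted : l.Pairwise (IsBefore side x)

theorem exists_sorted_list {α : Type*} (r : α → α → Prop) (S : Set α) (hS : S.Finite)
    (htot : ∀ a ∈ S, ∀ b ∈ S, r a b ∨ r b a) (htrans : ∀ a b c, r a b → r b c → r a c) :
    ∃ l : List α, l.Nodup ∧ (∀ a, a ∈ l ↔ a ∈ S) ∧ l.Pairwise r := by
  classical
  have : Fintype S := hS.fintype
  let r' : S → S → Prop := fun a b => r a b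
  have : Std.Total r' := ⟨fun a b => htot a a.2 b b.2⟩
  have : IsTrans S r' := ⟨fun a b c => htrans a b c⟩
  let l := List.insertionSort r' (Finset.univ : Finset S).toList
  have hp : l.Perm (Finset.univ : Finset S).toList := List.perm_insertionSort _ _
  refine ⟨l.map Subtype.val, ?_, ?_, ?_⟩
  · exact ((hp.nodup_iff).2 (Finset.nodup_toList _)).map Subtype.val_injective
  · intro a
    rw [List.mem_map]
    constructor
    · rintro ⟨b, -, rfl⟩; exact b.2
    · intro ha; exact ⟨⟨a, ha⟩, hp.mem_iff.2 (by simp), rfl⟩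
  · rw [List.pairwise_map]
    exact List.pairwise_insertionSort r' _

variable {side : W → Ω → Prop}

theorem IsBefore.trans {x : Ω} {a b c : W} (h : IsBefore side x a b) (h' : IsBefore side x b c) :
    IsBefore side x a c := fun p hp => h' p (h p hp)

namespace IsWallSystem

/-- The points x and y occupy opposite quadrants of the two walls, so the quadrant that nestedness
makes empty is one of the other two. Which of them it is decides the order. -/
theorem total (hw : IsWallSystem side) {x y : Ω} {c c' : W}
    (hc : c ∈ separating side x y) (hc' : c' ∈ separating side x y) :
    IsBefore side x c c' ∨ IsBefore side x c' c := by
  by_cases h : c = c'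
  · subst h; exact Or.inl fun p hp => hp
  obtain ⟨a, b, hab⟩ := hw.nested c c' h
  have hx := hab x
  have hy := hab y
  simp only [separating, Set.mem_ofPred_eq] at hc hc'
  by_cases ha : (side c x ↔ a)
  · left; intro p hp
    have := hab p
    grind
  · right; intro p hp
    have := hab p
    grind

/-- Walls that lie before each other have the same half containing `x`, hence cut the space in the
same way. -/
theorem antisymm (hw : IsWallSystem side) {x : Ω} {c c' : W}
    (h : IsBefore side x c c') (h' : IsBefore side x c' c) : c = c' := by
  apply hw.ext
  intro p q
  have := h p
  have := h q
  have := h' p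
  have := h' q
  by_cases h1 : side c x <;> by_cases h2 : side c' x <;> by_cases h3 : side c p <;>
    by_cases h4 : side c q <;> simp_all

theorem exists_isChain (hw : IsWallSystem side) (x y : Ω) : ∃ l, IsChain side x y l := by
  obtain ⟨l, h1, h2, h3⟩ := exists_sorted_list (IsBefore side x) (separating side x y)
    (hw.finite x y) (fun a ha b hb => hw.total ha hb) (fun a b c => IsBefore.trans)
  exact ⟨l, h1, h2, h3⟩

theorem chain_unique (hw : IsWallSystem side) {x y : Ω} {l l' : List W} (h : IsChain side x y l)
    (h' : IsChain side x y l') : l = l' := by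
  apply List.Perm.eq_of_pairwise (le := IsBefore side x) _ h.sorted h'.sorted
  · rw [List.perm_ext_iff_of_nodup h.nodup h'.nodup]
    intro c; rw [h.mem, h'.mem]
  · intro a b _ _ hab hba
    exact hw.antisymm hab hba

end IsWallSystem

/-- The walls between two points, in order. -/
def chain (hw : IsWallSystem side) (x y : Ω) : List W := (hw.exists_isChain x y).choose

theorem isChain_chain (hw : IsWallSystem side) (x y : Ω) : IsChain side x y (chain hw x y) :=
  (hw.exists_isChain x y).choose_spec

open Classical in
/-- The jump at the wall `c` when it is crossed coming from `x`. -/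
def jump (side : W → Ω → Prop) (T : W → Γ) (x : Ω) (c : W) : Γ :=
  if side c x then (T c)⁻¹ else T c

/-- The ordered product of the jumps at the walls between two points. -/
def transport (hw : IsWallSystem side) (T : W → Γ) (x y : Ω) : Γ :=
  ((chain hw x y).map (jump side T x)).prod

theorem transport_eq (hw : IsWallSystem side) (T : W → Γ) {x y : Ω} {l : List W}
    (h : IsChain side x y l) : transport hw T x y = (l.map (jump side T x)).prod := by
  rw [transport, hw.chain_unique (isChain_chain hw x y) h]

theorem jump_of_mem (T : W → Γ) {x y : Ω} {c : W} (h : c ∈ separating side x y) :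
    jump side T y c = (jump side T x c)⁻¹ := by
  unfold jump
  simp only [separating, Set.mem_ofPred_eq] at h
  by_cases h1 : side c x <;> by_cases h2 : side c y <;> simp [h1, h2] <;> grind

theorem jump_of_iff (T : W → Γ) {x y : Ω} {c : W} (h : side c x ↔ side c y) :
    jump side T y c = jump side T x c := by
  by_cases h1 : side c x
  · rw [jump, jump, if_pos h1, if_pos (h.1 h1)]
  · rw [jump, jump, if_neg h1, if_neg (mt h.2 h1)]

theorem prod_map_inv_reverse (f : W → Γ) (l : List W) :
    (l.reverse.map fun c => (f c)⁻¹).prod = ((l.map f).prod)⁻¹ := by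
  rw [List.prod_inv_reverse, List.map_reverse, List.map_map]; rfl

/-- The transport is a cocycle. -/
theorem transport_mul (hw : IsWallSystem side) (T : W → Γ) (x y z : Ω) :
    transport hw T x y * transport hw T y z = transport hw T x z := by
  have key : ∀ u v : Ω, ∀ S ⊆ separating side u v, ∃ l : List W, l.Nodup ∧ (∀ a, a ∈ l ↔ a ∈ S) ∧
      l.Pairwise (IsBefore side u) := fun u v S hS =>
    exists_sorted_list (IsBefore side u) S ((hw.finite u v).subset hS)
      (fun a ha b hb => hw.total (hS ha) (hS hb)) (fun a b c => IsBefore.trans)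
  -- The tripod of three points: a wall that separates some of them cuts off exactly one. The lists
  -- collect the walls that cut off x (`l1`), y (`l2`) and z (`l3`). Each chain runs along two legs,
  -- and the leg of y is traversed back and forth, so that it cancels.
  obtain ⟨l1, n1, m1, s1⟩ := key x y (separating side x y ∩ separating side x z)
    Set.inter_subset_left
  obtain ⟨l2, n2, m2, s2⟩ := key x y (separating side x y ∩ separating side y z)
    Set.inter_subset_left
  obtain ⟨l3, n3, m3, s3⟩ := key x z (separating side x z ∩ separating side y z)
    Set.inter_subset_left
  simp only [separating, Set.mem_inter_iff, Set.mem_ofPred_eq] at m1 m2 m3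
  have c12 : IsChain side x y (l1 ++ l2) := by
    refine ⟨?_, ?_, ?_⟩
    · rw [List.nodup_append]
      refine ⟨n1, n2, ?_⟩
      rintro a ha b hb rfl
      rw [m1] at ha; rw [m2] at hb; grind
    · intro c
      rw [List.mem_append, m1, m2]
      simp only [separating, Set.mem_ofPred_eq]; grind
    · rw [List.pairwise_append]
      refine ⟨s1, s2, ?_⟩
      intro a ha b hb
      rw [m1] at ha; rw [m2] at hb
      rcases hw.total (x := x) (y := y) (c := a) (c' := b) ha.1 hb.1 with h | h
      · exact h
      · have := h z; grind
  have c13 : IsChain side x z (l1 ++ l3) := by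
    refine ⟨?_, ?_, ?_⟩
    · rw [List.nodup_append]
      refine ⟨n1, n3, ?_⟩
      rintro a ha b hb rfl
      rw [m1] at ha; rw [m3] at hb; grind
    · intro c
      rw [List.mem_append, m1, m3]
      simp only [separating, Set.mem_ofPred_eq]; grind
    · rw [List.pairwise_append]
      refine ⟨s1, s3, ?_⟩
      intro a ha b hb
      rw [m1] at ha; rw [m3] at hb
      rcases hw.total (x := x) (y := z) (c := a) (c' := b) ha.2 hb.1 with h | h
      · exact h
      · have := h y; grind
  have c23 : IsChain side y z (l2.reverse ++ l3) := by
    refine ⟨?_, ?_, ?_⟩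
    · rw [List.nodup_append]
      refine ⟨List.nodup_reverse.2 n2, n3, ?_⟩
      rintro a ha b hb rfl
      rw [List.mem_reverse, m2] at ha; rw [m3] at hb; grind
    · intro c
      rw [List.mem_append, List.mem_reverse, m2, m3]
      simp only [separating, Set.mem_ofPred_eq]; grind
    · rw [List.pairwise_append]
      refine ⟨?_, ?_, ?_⟩
      · rw [List.pairwise_reverse]
        refine s2.imp_of_mem ?_
        intro a b ha hb hab p hp
        rw [m2] at ha hb
        have := hab p
        grind
      · refine s3.imp_of_mem ?_
        intro a b ha hb hab p hp
        rw [m3] at ha hb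
        have := hab p
        grind
      · intro a ha b hb
        rw [List.mem_reverse, m2] at ha; rw [m3] at hb
        rcases hw.total (x := y) (y := z) (c := a) (c' := b) ha.2 hb.2 with h | h
        · exact h
        · have := h x; grind
  rw [transport_eq hw T c12, transport_eq hw T c13, transport_eq hw T c23]
  simp only [List.map_append, List.prod_append]
  have e2 : l2.reverse.map (jump side T y) = l2.reverse.map fun c => (jump side T x c)⁻¹ := by
    apply List.map_congr_left
    intro c hc
    rw [List.mem_reverse, m2] at hc
    exact jump_of_mem T hc.1
  have e3 : l3.map (jump side T y) = l3.map (jump side T x) := by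
    apply List.map_congr_left
    intro c hc
    rw [m3] at hc
    exact jump_of_iff T (by grind)
  rw [e2, e3, prod_map_inv_reverse]
  group

theorem transport_self (hw : IsWallSystem side) (T : W → Γ) (x : Ω) :
    transport hw T x x = 1 := by
  have := transport_mul hw T x x x
  exact mul_eq_left.1 this

/-- The transport commutes with symmetries of the wall system. -/
theorem transport_equivariant (hw : IsWallSystem side) (T : W → Γ) (σ : W ≃ W) (τ : Ω ≃ Ω)
    (hσ : ∀ c p, side (σ c) (τ p) ↔ side c p) (φ : Γ →* Γ) (hT : ∀ c, T (σ c) = φ (T c))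
    (x y : Ω) : transport hw T (τ x) (τ y) = φ (transport hw T x y) := by
  have hc := isChain_chain hw x y
  have h : IsChain side (τ x) (τ y) ((chain hw x y).map σ) := by
    refine ⟨hc.nodup.map σ.injective, ?_, ?_⟩
    · intro c
      rw [List.mem_map]
      constructor
      · rintro ⟨d, hd, rfl⟩
        rw [hc.mem] at hd
        simpa only [separating, Set.mem_ofPred_eq, hσ] using hd
      · intro h
        refine ⟨σ.symm c, ?_, σ.apply_symm_apply c⟩
        rw [hc.mem]
        simp only [separating, Set.mem_ofPred_eq] at h ⊢
        rw [← hσ, ← hσ (σ.symm c) y, σ.apply_symm_apply]; exact h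
    · rw [List.pairwise_map]
      refine hc.sorted.imp ?_
      intro a b hab p hp
      have := hab (τ.symm p)
      rw [← hσ a (τ.symm p), ← hσ a x, ← hσ b (τ.symm p), ← hσ b x, τ.apply_symm_apply] at this
      exact this hp
  rw [transport_eq hw T h, transport, map_list_prod, List.map_map, List.map_map]
  congr 1
  apply List.map_congr_left
  intro c _
  have := hσ c x
  by_cases h1 : side c x
  · simp [jump, h1, this.2 h1, hT]
  · simp [jump, h1, mt this.1 h1, hT]

end Walls

/-! ### One-parameter groups of translations -/

/-- Traceless matrices of determinant `-1`: the infinitesimal translations along geodesics. -/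
structure IsGenerator (J : Mat2) : Prop where
  trace_eq : J.trace = 0
  det_eq : J.det = -1

theorem IsGenerator.entry {J : Mat2} (h : IsGenerator J) :
    J 1 1 = -J 0 0 ∧ J 0 0 ^ 2 + J 0 1 * J 1 0 = 1 := by
  have h1 := h.1
  have h2 := h.2
  rw [Matrix.trace_fin_two] at h1
  rw [Matrix.det_fin_two] at h2
  have : J 1 1 = -J 0 0 := by linarith
  rw [this] at h2
  exact ⟨this, by linarith⟩

theorem IsGenerator.mul_self {J : Mat2} (h : IsGenerator J) : J * J = 1 := by
  obtain ⟨h1, h2⟩ := h.entry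
  ext i j
  fin_cases i <;> fin_cases j <;> simp [Matrix.mul_apply, Fin.sum_univ_two, h1] <;> linarith

theorem IsGenerator.nonscalar {J : Mat2} (h : IsGenerator J) :
    J 1 0 ≠ 0 ∨ J 0 1 ≠ 0 ∨ J 1 1 - J 0 0 ≠ 0 := by
  obtain ⟨h1, h2⟩ := h.entry
  by_contra! hc
  obtain ⟨a, b, c⟩ := hc
  have : J 0 0 = 0 := by linarith
  rw [a, this] at h2; norm_num at h2

theorem IsGenerator.exists_height_pos {J : Mat2} (h : IsGenerator J) {z : ℍ}
    (hz : height J z = 0) : ∃ w, 0 < height J w := by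
  by_contra! hc
  have hext : IsLocalExtr (height J) z :=
    Or.inr (Filter.Eventually.of_forall fun w => by rw [hz]; exact hc w)
  have h0 := fixQuad_eq_zero_of_isLocalExtr J z hext
  have h1 := normSq_fixQuad J z
  rw [h0, hz, h.1, h.2] at h1
  have := z.im_ne_zero
  simp at h1
  exact this h1

/-- The one-parameter group of translations generated by `J`. -/
def flowMat (J : Mat2) (t : ℝ) : Mat2 := Real.cosh t • (1 : Mat2) + Real.sinh t • J

theorem flowMat_det {J : Mat2} (h : IsGenerator J) (t : ℝ) : (flowMat J t).det = 1 := by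
  obtain ⟨h1, h2⟩ := h.entry
  have := Real.cosh_sq t
  rw [Matrix.det_fin_two]
  simp [flowMat, h1]
  linear_combination this - Real.sinh t ^ 2 * h2

/-- The translations generated by `J`, in `SL(2,ℝ)`. -/
def flow {J : Mat2} (h : IsGenerator J) (t : ℝ) : SL(2, ℝ) := ⟨flowMat J t, flowMat_det h t⟩

theorem flow_coe {J : Mat2} (h : IsGenerator J) (t : ℝ) : (flow h t).1 = flowMat J t := rfl

theorem flowMat_add {J : Mat2} (h : IsGenerator J) (s t : ℝ) :
    flowMat J (s + t) = flowMat J s * flowMat J t := by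
  have hJ := h.mul_self
  simp only [flowMat, Real.cosh_add, Real.sinh_add, mul_add, add_mul, Matrix.smul_mul,
    Matrix.mul_smul, one_mul, mul_one, hJ, smul_smul, add_smul]
  rw [mul_comm (Real.sinh t) (Real.cosh s), mul_comm (Real.sinh t) (Real.sinh s),
    mul_comm (Real.cosh t) (Real.cosh s), mul_comm (Real.cosh t) (Real.sinh s)]
  abel

theorem flow_add {J : Mat2} (h : IsGenerator J) (s t : ℝ) :
    flow h (s + t) = flow h s * flow h t := Subtype.ext (flowMat_add h s t)

theorem flow_zero {J : Mat2} (h : IsGenerator J) : flow h 0 = 1 := by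
  apply Subtype.ext; rw [flow_coe]; simp [flowMat]

theorem flow_neg {J : Mat2} (h : IsGenerator J) (t : ℝ) : flow h (-t) = (flow h t)⁻¹ := by
  rw [eq_inv_iff_mul_eq_one, ← flow_add, neg_add_cancel, flow_zero]

theorem continuous_flowMat (J : Mat2) : Continuous (flowMat J) := by
  unfold flowMat
  exact (Real.continuous_cosh.smul continuous_const).add
    (Real.continuous_sinh.smul continuous_const)

theorem continuous_flow {J : Mat2} (h : IsGenerator J) : Continuous (flow h) :=
  Continuous.subtype_mk (continuous_flowMat J) _

theorem flowMat_trace {J : Mat2} (h : IsGenerator J) (t : ℝ) :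
    (flowMat J t).trace = 2 * Real.cosh t := by
  rw [flowMat, Matrix.trace_add, Matrix.trace_smul, Matrix.trace_smul, h.1, Matrix.trace_one]
  simp [mul_comm]

theorem height_flowMat (J : Mat2) (t : ℝ) (z : ℍ) :
    height (flowMat J t) z = Real.sinh t * height J z := by
  rw [flowMat, height_add, height_smul_mat, height_smul_mat, height_one]; ring

theorem commute_flowMat (J : Mat2) (t : ℝ) : J * flowMat J t = flowMat J t * J := by
  simp [flowMat, mul_add, add_mul]

/-- The generator of the one-parameter group that contains a hyperbolic matrix. -/
def gen (X : SL(2, ℝ)) : Mat2 :=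
  (Real.sign X.1.trace / Real.sqrt (X.1.trace ^ 2 - 4)) • ((2 : ℝ) • X.1 - X.1.trace • (1 : Mat2))

theorem sign_sq_of_trace_sq {t : ℝ} (h : 4 < t ^ 2) : Real.sign t ^ 2 = 1 := by
  have : t ≠ 0 := by rintro rfl; norm_num at h
  rcases lt_or_gt_of_ne this with h | h
  · rw [Real.sign_of_neg h]; norm_num
  · rw [Real.sign_of_pos h]; norm_num

theorem isGenerator_gen {X : SL(2, ℝ)} (h : 4 < X.1.trace ^ 2) : IsGenerator (gen X) := by
  have hs := sign_sq_of_trace_sq h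
  have hd := SL2_det X
  have hpos : 0 < X.1.trace ^ 2 - 4 := by linarith
  have hr : (Real.sign X.1.trace / Real.sqrt (X.1.trace ^ 2 - 4)) ^ 2 * (X.1.trace ^ 2 - 4) = 1 := by
    rw [div_pow, hs, Real.sq_sqrt hpos.le]; field_simp
  generalize hrr : Real.sign X.1.trace / Real.sqrt (X.1.trace ^ 2 - 4) = r at hr
  constructor
  · rw [gen, Matrix.trace_smul, Matrix.trace_sub, Matrix.trace_smul, Matrix.trace_smul,
      Matrix.trace_one]
    simp; right; ring
  · rw [gen, hrr, Matrix.det_fin_two]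
    rw [Matrix.trace_fin_two] at hr ⊢
    simp only [Matrix.smul_apply, Matrix.sub_apply, smul_eq_mul, Matrix.one_apply]
    simp only [Fin.isValue, if_true, zero_ne_one, one_ne_zero, if_false]
    linear_combination -hr + 4 * r ^ 2 * hd

/-- The sign of the trace in `gen` compensates the sign of the matrix, so the generator, and with it
an orientation of the axis, descends to PSL(2,ℝ). -/
theorem gen_neg {X Y : SL(2, ℝ)} (h : X.1 = -Y.1) : gen X = gen Y := by
  rw [gen, gen, h, Matrix.trace_neg, Real.sign_neg, neg_sq, neg_div, neg_smul, ← smul_neg]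
  congr 1; rw [smul_neg, neg_smul]; abel

theorem coe_eq_gen {X : SL(2, ℝ)} (h : 4 < X.1.trace ^ 2) :
    X.1 = (X.1.trace / 2) • (1 : Mat2) +
      (Real.sign X.1.trace * Real.sqrt (X.1.trace ^ 2 - 4) / 2) • gen X := by
  have hs := sign_sq_of_trace_sq h
  have hpos : 0 < Real.sqrt (X.1.trace ^ 2 - 4) := Real.sqrt_pos.2 (by linarith)
  have e : Real.sign X.1.trace * Real.sqrt (X.1.trace ^ 2 - 4) / 2 *
      (Real.sign X.1.trace / Real.sqrt (X.1.trace ^ 2 - 4)) = 1 / 2 := by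
    field_simp; exact hs
  rw [gen, smul_smul, e, smul_sub, smul_smul, smul_smul]
  rw [show (1 / 2 * (2 : ℝ)) = 1 by norm_num, one_smul, one_div, div_eq_inv_mul,
    add_sub_cancel]

theorem gen_conj (X Y : SL(2, ℝ)) : gen (Y * X * Y⁻¹) = Y.1 * gen X * (Y⁻¹).1 := by
  rw [gen, gen, mul_mul_inv_coe, trace_conj, Matrix.mul_smul, Matrix.smul_mul, mul_sub, sub_mul,
    Matrix.mul_smul, Matrix.mul_smul, Matrix.smul_mul, Matrix.smul_mul, mul_one, coe_mul_coe_inv]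

/-- A hyperbolic matrix is, up to sign, a translation along its axis. -/
theorem exists_flow {X : SL(2, ℝ)} (h : 4 < X.1.trace ^ 2) :
    ∃ l : ℝ, 0 < l ∧ toPSL X = toPSL (flow (isGenerator_gen h) l) := by
  have hs := sign_sq_of_trace_sq h
  have hpos : 0 < Real.sqrt (X.1.trace ^ 2 - 4) := Real.sqrt_pos.2 (by linarith)
  -- The trace of the flow is `2 cosh l`, so `l` has to satisfy `cosh l = |trace| / 2`; it is half
  -- the translation length.
  refine ⟨Real.arsinh (Real.sqrt (X.1.trace ^ 2 - 4) / 2), Real.arsinh_pos_iff.2 (by positivity), ?_⟩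
  have hc : Real.cosh (Real.arsinh (Real.sqrt (X.1.trace ^ 2 - 4) / 2)) = |X.1.trace| / 2 := by
    rw [Real.cosh_arsinh, div_pow, Real.sq_sqrt (by linarith), ← Real.sqrt_sq_eq_abs,
      show 1 + (X.1.trace ^ 2 - 4) / 2 ^ 2 = X.1.trace ^ 2 / 2 ^ 2 by ring,
      Real.sqrt_div (by positivity), Real.sqrt_sq (by norm_num : (0:ℝ) ≤ 2)]
  rw [toPSL_eq_iff, flow_coe, flowMat, hc, Real.sinh_arsinh]
  have ht : X.1.trace ≠ 0 := by intro h0; rw [h0] at h; norm_num at h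
  have hX := coe_eq_gen h
  rcases lt_or_gt_of_ne ht with h' | h'
  · right
    rw [Real.sign_of_neg h'] at hX
    rw [abs_of_neg h']
    conv_lhs => rw [hX]
    rw [neg_add, ← neg_smul, ← neg_smul]; congr 2 <;> ring
  · left
    rw [Real.sign_of_pos h'] at hX
    rw [abs_of_pos h']
    conv_lhs => rw [hX]
    congr 2; ring

theorem height_gen {X : SL(2, ℝ)} (h : 4 < X.1.trace ^ 2) (z : ℍ) :
    height (gen X) z = 0 ↔ height X.1 z = 0 := by
  have hs := sign_sq_of_trace_sq h
  have hpos : 0 < Real.sqrt (X.1.trace ^ 2 - 4) := Real.sqrt_pos.2 (by linarith)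
  have hne : Real.sign X.1.trace * Real.sqrt (X.1.trace ^ 2 - 4) / 2 ≠ 0 := by
    have : Real.sign X.1.trace ≠ 0 := by intro h0; rw [h0] at hs; norm_num at hs
    positivity
  conv_rhs => rw [coe_eq_gen h, height_add, height_smul_mat, height_smul_mat, height_one]
  simp [hne]

/-- A lift to `SL(2,ℝ)`. -/
def lift (p : PSL2R) : SL(2, ℝ) := (exists_toPSL p).choose

theorem toPSL_lift (p : PSL2R) : toPSL (lift p) = p := (exists_toPSL p).choose_spec

/-- The generator of a hyperbolic element of `PSL(2,ℝ)`. -/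
def genP (p : PSL2R) : Mat2 := gen (lift p)

theorem genP_toPSL (X : SL(2, ℝ)) : genP (toPSL X) = gen X := by
  rcases (toPSL_eq_iff _ _).1 (toPSL_lift (toPSL X)) with h | h
  · rw [genP, show lift (toPSL X) = X from Subtype.ext h]
  · exact gen_neg h

/-- Hyperbolic elements of `PSL(2,ℝ)`. -/
def IsHyp (p : PSL2R) : Prop := 4 < (lift p).1.trace ^ 2

theorem IsHyp.isGenerator {p : PSL2R} (h : IsHyp p) : IsGenerator (genP p) := isGenerator_gen h

theorem genP_conj (X : SL(2, ℝ)) (p : PSL2R) :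
    genP (toPSL X * p * (toPSL X)⁻¹) = X.1 * genP p * (X⁻¹).1 := by
  have h : toPSL X * p * (toPSL X)⁻¹ = toPSL (X * lift p * X⁻¹) := by
    conv_lhs => rw [← toPSL_lift p]
    rfl
  rw [h, genP_toPSL, gen_conj]; rfl

/-- The signed height is equivariant, so the action respects the sides of axes and not merely the
axes. -/
theorem height_genP_conj (q p : PSL2R) (z : ℍ) :
    height (genP (q * p * q⁻¹)) (q • z) = height (genP p) z := by
  obtain ⟨X, rfl⟩ := exists_toPSL q
  rw [toPSL_smul, height_smul, genP_conj, ← mul_assoc, ← mul_assoc, coe_inv_mul_coe, one_mul,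
    mul_assoc, coe_inv_mul_coe, mul_one]

theorem dist_smul_smul (q : PSL2R) (z w : ℍ) : dist (q • z) (q • w) = dist z w := by
  obtain ⟨X, rfl⟩ := exists_toPSL q
  rw [toPSL_smul, toPSL_smul]; exact dist_smul X z w

theorem smul_mem_axis_conj (q p : PSL2R) (z : ℍ) : q • z ∈ axis (q * p * q⁻¹) ↔ z ∈ axis p := by
  have h : ∀ w : ℍ, dist (q • w) ((q * p * q⁻¹) • q • w) = dist w (p • w) := by
    intro w
    rw [← dist_smul_smul q w (p • w)]; congr 1
    rw [smul_smul, smul_smul]; congr 1; group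
  constructor
  · intro hz w
    have := hz (q • w)
    rwa [h, h] at this
  · intro hz w
    have h2 := h (q⁻¹ • w)
    rw [smul_inv_smul] at h2
    rw [h, h2]; exact hz _

theorem axis_conj (q p : PSL2R) : axis (q * p * q⁻¹) = (fun z => q • z) '' axis p := by
  ext z
  constructor
  · intro hz
    refine ⟨q⁻¹ • z, ?_, smul_inv_smul q z⟩
    rw [← smul_mem_axis_conj q, smul_inv_smul]; exact hz
  · rintro ⟨w, hw, rfl⟩; exact (smul_mem_axis_conj q p w).2 hw

theorem axis_inv (p : PSL2R) : axis p⁻¹ = axis p := by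
  have h : ∀ w : ℍ, dist w (p⁻¹ • w) = dist w (p • w) := by
    intro w
    rw [← dist_smul_smul p w (p⁻¹ • w), smul_inv_smul, dist_comm]
  ext z; simp only [axis, Set.mem_ofPred_eq, h]

/-! ### Elements of a surface group -/

section Surface

variable {ρ : G →* PSL2R}

theorem mem_axis_iff (hρ : IsClosedSurfaceRep ρ) {g : G} (hg : g ≠ 1) {X : SL(2, ℝ)}
    (hX : toPSL X = ρ g) (z : ℍ) : z ∈ axis (ρ g) ↔ height X.1 z = 0 := by
  rw [← hX]
  refine ⟨fun h => height_eq_zero_of_mem_axis X z h ?_, mem_axis_of_height_eq_zero X z⟩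
  intro h0
  exact hg (hρ.free g z (by rw [← hX]; exact h0))

/-- The displacement attains its minimum at `z`, and `z` is not fixed because the action is free. So
the height vanishes at `z` and the discriminant is positive. -/
theorem isHyp_of_mem_axis (hρ : IsClosedSurfaceRep ρ) {g : G} (hg : g ≠ 1) {z : ℍ}
    (hz : z ∈ axis (ρ g)) : IsHyp (ρ g) := by
  have h1 := (mem_axis_iff hρ hg (toPSL_lift (ρ g)) z).1 hz
  refine trace_ne_zero_of_height _ z h1 ?_
  rw [Ne, fixQuad_eq_zero_iff_smul]
  intro h0
  apply hg
  apply hρ.free g z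
  rw [← toPSL_lift (ρ g)]; exact h0

theorem mem_axis_iff_genP (hρ : IsClosedSurfaceRep ρ) {g : G} (hg : g ≠ 1) (hh : IsHyp (ρ g))
    (z : ℍ) : z ∈ axis (ρ g) ↔ height (genP (ρ g)) z = 0 := by
  rw [mem_axis_iff hρ hg (toPSL_lift _), genP, height_gen hh]

theorem eigenvector_of_genP {X : SL(2, ℝ)} (hh : 4 < X.1.trace ^ 2) {u : Fin 2 → ℝ} {k : ℝ}
    (h : (gen X).mulVec u = k • u) : ∃ l : ℝ, X.1.mulVec u = l • u := by
  refine ⟨X.1.trace / 2 + Real.sign X.1.trace * Real.sqrt (X.1.trace ^ 2 - 4) / 2 * k, ?_⟩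
  conv_lhs => rw [coe_eq_gen hh]
  rw [Matrix.add_mulVec, Matrix.smul_mulVec, Matrix.smul_mulVec, h, Matrix.one_mulVec, smul_smul,
    ← add_smul]

/-- Two elements of a surface group whose axes share an endpoint have the same axis. -/
theorem axis_eq_of_common_eigenvector (hρ : IsClosedSurfaceRep ρ) {g h : G} (hg : g ≠ 1)
    (hh : h ≠ 1) {X Y : SL(2, ℝ)} (hX : toPSL X = ρ g) (hY : toPSL Y = ρ h)
    (hXt : 4 < X.1.trace ^ 2) (hYt : 4 < Y.1.trace ^ 2) {e : Fin 2 → ℝ} (he : e ≠ 0) {k l : ℝ}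
    (hXe : X.1.mulVec e = k • e) (hYe : Y.1.mulVec e = l • e) : axis (ρ g) = axis (ρ h) := by
  have hc := commute_of_common_eigenvector hρ hX hY hXt hYt he hXe hYe
  ext z
  rw [mem_axis_iff hρ hg hX, mem_axis_iff hρ hh hY]
  exact ⟨height_eq_zero_of_comm_eq_zero _ _ z hc (nonscalar_of_trace_sq X hXt),
    height_eq_zero_of_comm_eq_zero _ _ z hc.symm (nonscalar_of_trace_sq Y hYt)⟩

theorem proj_eq_iff (ρ : G →* PSL2R) (z w : ℍ) : proj ρ z = proj ρ w ↔ ∃ g : G, ρ g • w = z := by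
  rw [proj, proj, Quotient.eq, MulAction.orbitRel_apply, MulAction.mem_orbit_iff]
  constructor
  · rintro ⟨⟨_, g, rfl⟩, h⟩; exact ⟨g, h⟩
  · rintro ⟨g, h⟩; exact ⟨⟨ρ g, g, rfl⟩, h⟩

/-- Simplicity provides a power of `a` with the same effect on `z`, and freeness identifies the two
elements. -/
theorem IsSimple.stabilizer (hρ : IsClosedSurfaceRep ρ) {a : G} (ha : IsSimple ρ a) {z : ℍ} {g : G}
    (hz : z ∈ axis (ρ a)) (hgz : ρ g • z ∈ axis (ρ a)) : ∃ n : ℤ, g = a ^ n := by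
  obtain ⟨n, hn⟩ := ha.2 z hz _ hgz ((proj_eq_iff ρ _ _).2 ⟨g⁻¹, by rw [map_inv, inv_smul_smul]⟩)
  refine ⟨n, ?_⟩
  have : (a ^ n)⁻¹ * g = 1 := by
    apply hρ.free _ z
    rw [map_mul, mul_smul, hn, map_inv, inv_smul_smul]
  exact (inv_mul_eq_one.1 this).symm

/-- A Gram determinant identity for the traceless matrices `J`, `J'` and their commutator. The right
side is nonnegative, so for `|trace (J * J')| > 2` the heights cannot agree (trace positive), or be
opposite (trace negative), at any point. -/
theorem height_identity {J J' : Mat2} (h : IsGenerator J) (h' : IsGenerator J') (z : ℍ) :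
    height J z ^ 2 + height J' z ^ 2 - (J * J').trace * height J z * height J' z -
      ((J * J').trace ^ 2 - 4) = (height (comm J J') z) ^ 2 / 4 := by
  obtain ⟨h1, h2⟩ := h.entry
  obtain ⟨h3, h4⟩ := h'.entry
  have hy := z.im_ne_zero
  rw [Matrix.trace_fin_two]
  simp only [height, comm_one_zero, comm_zero_zero, comm_one_one, comm_zero_one, Matrix.mul_apply,
    Fin.sum_univ_two, h1, h3]
  field_simp
  have e1 : J 0 0 ^ 2 = 1 - J 0 1 * J 1 0 := by linarith
  have e2 : J' 0 0 ^ 2 = 1 - J' 0 1 * J' 1 0 := by linarith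
  ring_nf
  simp only [e1, e2]
  ring

/-- Gives the trichotomy by `|trace (J * J')|`: below 2 the axes cross, at 2 they share an endpoint,
and the remaining case is that of disjoint axes without common endpoints. -/
theorem crossDet_of_isGenerator {J J' : Mat2} (h : IsGenerator J) (h' : IsGenerator J') :
    crossDet J J' = 4 - (J * J').trace ^ 2 := by
  obtain ⟨h1, h2⟩ := h.entry
  obtain ⟨h3, h4⟩ := h'.entry
  rw [crossDet_eq, Matrix.trace_fin_two]
  simp only [Matrix.mul_apply, Fin.sum_univ_two, h1, h3]
  linear_combination (4 : ℝ) * (J' 0 0 ^ 2 + J' 0 1 * J' 1 0) * h2 + 4 * h4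

end Surface

/-! ### The lifts of a simple closed geodesic as a wall system -/

/-- The lifts of the closed geodesic of `a`, indexed by the conjugates of `a`. -/
def WallOf (a : G) : Type _ := {c : G // IsConj a c}

/-- The generator of the translations along a wall. -/
def wallGen (ρ : G →* PSL2R) {a : G} (c : WallOf a) : Mat2 := genP (ρ c.1)

/-- The sides of the walls in the hyperbolic plane. -/
def wallSide (ρ : G →* PSL2R) (a : G) (c : WallOf a) (z : ℍ) : Prop := 0 < height (wallGen ρ c) z

/-- The group acts on the walls. -/
def wallMove {a : G} (g : G) : WallOf a ≃ WallOf a where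
  toFun c := ⟨g * c.1 * g⁻¹, c.2.trans (isConj_iff.2 ⟨g, rfl⟩)⟩
  invFun c := ⟨g⁻¹ * c.1 * g, c.2.trans (isConj_iff.2 ⟨g⁻¹, by rw [inv_inv]⟩)⟩
  left_inv c := by apply Subtype.ext; change g⁻¹ * (g * c.1 * g⁻¹) * g = c.1; group
  right_inv c := by apply Subtype.ext; change g * (g⁻¹ * c.1 * g) * g⁻¹ = c.1; group

theorem wallMove_coe {a : G} (g : G) (c : WallOf a) : (wallMove g c).1 = g * c.1 * g⁻¹ := rfl

theorem height_wallMove (ρ : G →* PSL2R) {a : G} (g : G) (c : WallOf a) (z : ℍ) :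
    height (wallGen ρ (wallMove g c)) (ρ g • z) = height (wallGen ρ c) z := by
  rw [wallGen, wallMove_coe, map_mul, map_mul, map_inv, height_genP_conj]; rfl

theorem wallSide_wallMove (ρ : G →* PSL2R) {a : G} (g : G) (c : WallOf a) (z : ℍ) :
    wallSide ρ a (wallMove g c) (ρ g • z) ↔ wallSide ρ a c z := by
  rw [wallSide, height_wallMove]; rfl

theorem wallGen_wallMove (ρ : G →* PSL2R) {a : G} (g : G) (c : WallOf a) {X : SL(2, ℝ)}
    (hX : toPSL X = ρ g) : wallGen ρ (wallMove g c) = X.1 * wallGen ρ c * (X⁻¹).1 := by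
  rw [wallGen, wallMove_coe, map_mul, map_mul, map_inv, ← hX, genP_conj]; rfl

/-- The closed geodesic of `a` is a simple closed geodesic on a closed surface. -/
structure HasSimpleAxis (ρ : G →* PSL2R) (a : G) : Prop where
  rep : IsClosedSurfaceRep ρ
  simple : IsSimple ρ a
  nonempty : (axis (ρ a)).Nonempty

theorem exists_pos_or_neg {f : ℍ → ℝ} (hf : Continuous f) (h : ∀ z, f z ≠ 0) :
    (∀ z, 0 < f z) ∨ (∀ z, f z < 0) := by
  by_contra! hc
  obtain ⟨⟨z, hz⟩, w, hw⟩ := hc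
  obtain ⟨p, hp⟩ := mem_range_of_exists_le_of_exists_ge hf ⟨z, hz⟩ ⟨w, hw⟩
  exact h p hp

theorem mulVec_rankOne (u w v : Fin 2 → ℝ) : (rankOne u w).mulVec v = wedge w v • u := by
  ext i
  fin_cases i <;> simp [rankOne, Matrix.mulVec, dotProduct, Fin.sum_univ_two, wedge] <;> ring

/-- Because `J² = 1`, the matrix `J` anticommutes with its commutators and therefore preserves their
kernels. -/
theorem mul_comm_of_isGenerator {J J' : Mat2} (h : IsGenerator J) :
    J * comm J J' = -(comm J J' * J) := by
  have := h.mul_self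
  simp only [comm, mul_sub, sub_mul, ← mul_assoc, this]
  rw [mul_assoc J' J J, this, mul_one, one_mul, neg_sub]

/-- Two translations with asymptotic axes share an eigenvector. -/
theorem exists_common_eigenvector {J J' : Mat2} (h : IsGenerator J) (h' : IsGenerator J')
    (hne : comm J J' ≠ 0) (hd : crossDet J J' = 0) :
    ∃ u : Fin 2 → ℝ, u ≠ 0 ∧ (∃ r : ℝ, J.mulVec u = r • u) ∧ ∃ r : ℝ, J'.mulVec u = r • u := by
  obtain ⟨u, hu, hKu⟩ := Matrix.exists_mulVec_eq_zero_iff.2 hd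
  obtain ⟨k, hk⟩ := eq_smul_rankOne_of_mulVec_eq_zero _ u hu hKu (comm_trace J J')
  have hk0 : k ≠ 0 := by rintro rfl; rw [zero_smul] at hk; exact hne hk
  have key : ∀ M : Mat2, M * comm J J' = -(comm J J' * M) → ∃ r : ℝ, M.mulVec u = r • u := by
    intro M hM
    apply exists_smul_of_wedge_eq_zero hu
    have h1 : (comm J J').mulVec (M.mulVec u) = 0 := by
      have : (comm J J' * M).mulVec u = (-(M * comm J J')).mulVec u := by rw [hM, neg_neg]
      rw [Matrix.mulVec_mulVec, this, Matrix.neg_mulVec, ← Matrix.mulVec_mulVec, hKu,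
        Matrix.mulVec_zero, neg_zero]
    rw [hk, Matrix.smul_mulVec, mulVec_rankOne, smul_smul] at h1
    exact (mul_eq_zero.1 ((smul_eq_zero.1 h1).resolve_right hu)).resolve_left hk0
  refine ⟨u, hu, key J (mul_comm_of_isGenerator h), key J' ?_⟩
  have h1 := mul_comm_of_isGenerator (J := J') (J' := J) h'
  have h2 : comm J' J = -comm J J' := by simp [comm]
  rw [h2, mul_neg, neg_mul, neg_inj] at h1
  rw [h1]

namespace HasSimpleAxis

variable {ρ : G →* PSL2R} {a : G} (hs : HasSimpleAxis ρ a)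

theorem wall_ne_one (hs : HasSimpleAxis ρ a) (c : WallOf a) : c.1 ≠ 1 := by
  intro h
  have := c.2
  rw [h, isConj_comm, isConj_one_right] at this
  exact hs.simple.1 this

theorem wall_conj (c : WallOf a) : ∃ g : G, c.1 = g * a * g⁻¹ := by
  obtain ⟨g, hg⟩ := isConj_iff.1 c.2
  exact ⟨g, hg.symm⟩

theorem wall_nonempty (hs : HasSimpleAxis ρ a) (c : WallOf a) : (axis (ρ c.1)).Nonempty := by
  obtain ⟨g, hg⟩ := wall_conj c
  rw [hg, map_mul, map_mul, map_inv, axis_conj]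
  exact hs.nonempty.image _

theorem wall_isHyp (hs : HasSimpleAxis ρ a) (c : WallOf a) : IsHyp (ρ c.1) := by
  obtain ⟨z, hz⟩ := hs.wall_nonempty c
  exact isHyp_of_mem_axis hs.rep (hs.wall_ne_one c) hz

theorem isGenerator (hs : HasSimpleAxis ρ a) (c : WallOf a) : IsGenerator (wallGen ρ c) :=
  (hs.wall_isHyp c).isGenerator

theorem mem_wall_iff (hs : HasSimpleAxis ρ a) (c : WallOf a) (z : ℍ) :
    z ∈ axis (ρ c.1) ↔ height (wallGen ρ c) z = 0 :=
  mem_axis_iff_genP hs.rep (hs.wall_ne_one c) (hs.wall_isHyp c) z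

theorem exists_mem_wall (hs : HasSimpleAxis ρ a) (c : WallOf a) :
    ∃ z, height (wallGen ρ c) z = 0 := by
  obtain ⟨z, hz⟩ := hs.wall_nonempty c
  exact ⟨z, (hs.mem_wall_iff c z).1 hz⟩

/-- Different walls are disjoint. -/
theorem wall_eq_of_mem (hs : HasSimpleAxis ρ a) {c c' : WallOf a} {z : ℍ}
    (h : height (wallGen ρ c) z = 0) (h' : height (wallGen ρ c') z = 0) : c = c' := by
  obtain ⟨g, hg⟩ := wall_conj c
  obtain ⟨k, hk⟩ := wall_conj c'
  rw [← hs.mem_wall_iff, hg, map_mul, map_mul, map_inv, ← smul_inv_smul (ρ g) z,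
    smul_mem_axis_conj] at h
  rw [← hs.mem_wall_iff, hk, map_mul, map_mul, map_inv, ← smul_inv_smul (ρ k) z,
    smul_mem_axis_conj] at h'
  obtain ⟨n, hn⟩ := hs.simple.stabilizer hs.rep (g := k⁻¹ * g) h
    (by rw [map_mul, map_inv, mul_smul, smul_inv_smul]; exact h')
  apply Subtype.ext
  -- The conjugating elements differ by a power of `a`, which commutes with `a`, so the two
  -- conjugates are equal as group elements and not only up to inversion.
  have : g = k * a ^ n := by rw [← hn]; group
  rw [hg, hk, this]; group

theorem eigenvector (hs : HasSimpleAxis ρ a) (c : WallOf a) {u : Fin 2 → ℝ} {r : ℝ}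
    (h : (wallGen ρ c).mulVec u = r • u) : ∃ l : ℝ, (lift (ρ c.1)).1.mulVec u = l • u :=
  eigenvector_of_genP (hs.wall_isHyp c) h

/-- Different walls do not share endpoints. -/
theorem wall_eq_of_eigenvector (hs : HasSimpleAxis ρ a) {c c' : WallOf a} {u : Fin 2 → ℝ}
    (hu : u ≠ 0) {r s : ℝ} (h : (wallGen ρ c).mulVec u = r • u)
    (h' : (wallGen ρ c').mulVec u = s • u) : c = c' := by
  obtain ⟨l, hl⟩ := hs.eigenvector c h
  obtain ⟨m, hm⟩ := hs.eigenvector c' h'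
  have := axis_eq_of_common_eigenvector hs.rep (hs.wall_ne_one c) (hs.wall_ne_one c')
    (toPSL_lift _) (toPSL_lift _) (hs.wall_isHyp c) (hs.wall_isHyp c') hu hl hm
  obtain ⟨z, hz⟩ := hs.wall_nonempty c
  exact hs.wall_eq_of_mem ((hs.mem_wall_iff c z).1 hz)
    ((hs.mem_wall_iff c' z).1 (by rw [← this]; exact hz))

/-- A smaller value means crossing, excluded by simplicity; equality means a common endpoint or
commuting generators, excluded by discreteness and by disjointness of different walls. -/
theorem four_lt_trace_sq (hs : HasSimpleAxis ρ a) {c c' : WallOf a} (hne : c ≠ c') :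
    4 < (wallGen ρ c * wallGen ρ c').trace ^ 2 := by
  have hJ := hs.isGenerator c
  have hJ' := hs.isGenerator c'
  by_contra! hle
  have hcd := crossDet_of_isGenerator hJ hJ'
  rcases hle.lt_or_eq with hlt | heq
  · obtain ⟨z, h1, h2⟩ := exists_heights_eq_zero _ _
      (show 0 < crossDet (wallGen ρ c) (wallGen ρ c') by rw [hcd]; linarith)
    exact hne (hs.wall_eq_of_mem h1 h2)
  · by_cases h0 : comm (wallGen ρ c) (wallGen ρ c') = 0
    · obtain ⟨z, hz⟩ := hs.exists_mem_wall c
      exact hne (hs.wall_eq_of_mem hz (height_eq_zero_of_comm_eq_zero _ _ z (sub_eq_zero.1 h0)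
        hJ.nonscalar hz))
    · obtain ⟨u, hu, ⟨r, hr⟩, s, hs'⟩ := exists_common_eigenvector hJ hJ' h0
        (by rw [hcd, heq, sub_self])
      exact hne (hs.wall_eq_of_eigenvector hu hr hs')

/-- The height functions of two different walls differ everywhere, up to sign. -/
theorem height_cases (hs : HasSimpleAxis ρ a) {c c' : WallOf a} (hne : c ≠ c') :
    ((∀ z, 0 < height (wallGen ρ c) z - height (wallGen ρ c') z) ∨
      (∀ z, height (wallGen ρ c) z - height (wallGen ρ c') z < 0)) ∨
    ((∀ z, 0 < height (wallGen ρ c) z + height (wallGen ρ c') z) ∨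
      (∀ z, height (wallGen ρ c) z + height (wallGen ρ c') z < 0)) := by
  have h4 := hs.four_lt_trace_sq hne
  have hid := height_identity (hs.isGenerator c) (hs.isGenerator c')
  set T := (wallGen ρ c * wallGen ρ c').trace
  have hT : T < -2 ∨ 2 < T := by
    by_contra! hc
    nlinarith
  rcases hT with hT | hT
  · right
    apply exists_pos_or_neg ((continuous_height _).add (continuous_height _))
    intro z h0
    change _ = (0 : ℝ) at h0
    simp only [Pi.add_apply] at h0
    have := hid z
    rw [show height (wallGen ρ c) z = -height (wallGen ρ c') z by linarith] at this
    nlinarith [sq_nonneg (height (comm (wallGen ρ c) (wallGen ρ c')) z),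
      mul_nonneg (sq_nonneg (height (wallGen ρ c') z)) (show 0 ≤ -2 - T by linarith)]
  · left
    apply exists_pos_or_neg ((continuous_height _).sub (continuous_height _))
    intro z h0
    change _ = (0 : ℝ) at h0
    simp only [Pi.sub_apply] at h0
    have := hid z
    rw [show height (wallGen ρ c) z = height (wallGen ρ c') z by linarith] at this
    nlinarith [sq_nonneg (height (comm (wallGen ρ c) (wallGen ρ c')) z),
      mul_nonneg (sq_nonneg (height (wallGen ρ c') z)) (show 0 ≤ T - 2 by linarith)]

theorem wall_nested (hs : HasSimpleAxis ρ a) (c c' : WallOf a) (hne : c ≠ c') :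
    ∃ p q : Prop, ∀ z, ¬((wallSide ρ a c z ↔ p) ∧ (wallSide ρ a c' z ↔ q)) := by
  unfold wallSide
  rcases hs.height_cases hne with (h | h) | (h | h)
  · refine ⟨False, True, fun z hz => ?_⟩
    simp only [iff_false, iff_true, not_lt] at hz
    have := h z; linarith [hz.1, hz.2]
  · refine ⟨True, False, fun z hz => ?_⟩
    simp only [iff_false, iff_true, not_lt] at hz
    have := h z; linarith [hz.1, hz.2]
  · refine ⟨False, False, fun z hz => ?_⟩
    simp only [iff_false, not_lt] at hz
    have := h z; linarith [hz.1, hz.2]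
  · refine ⟨True, True, fun z hz => ?_⟩
    simp only [iff_true] at hz
    have := h z; linarith [hz.1, hz.2]

/-- If the heights differ by a fixed sign, or have negative sum, two explicit points are separated
by one wall only. If their sum is positive, equal partitions would make an open half plane equal to
a closed one, against connectedness of ℍ. -/
theorem wall_ext (hs : HasSimpleAxis ρ a) (c c' : WallOf a)
    (h : ∀ p q, (wallSide ρ a c p ↔ wallSide ρ a c q) ↔ (wallSide ρ a c' p ↔ wallSide ρ a c' q)) :
    c = c' := by
  by_contra hne
  unfold wallSide at h
  obtain ⟨z, hz⟩ := hs.exists_mem_wall c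
  obtain ⟨z', hz'⟩ := hs.exists_mem_wall c'
  obtain ⟨w, hw⟩ := (hs.isGenerator c).exists_height_pos hz
  rcases hs.height_cases hne with (hh | hh) | (hh | hh)
  · have h1 := hh z
    have h2 := hh z'
    have h3 := h z z'
    rw [hz, hz'] at *
    have e1 : ¬ 0 < height (wallGen ρ c') z := by linarith
    have e2 : 0 < height (wallGen ρ c) z' := by linarith
    simp [e1, e2] at h3
  · have h1 := hh z
    have h2 := hh z'
    have h3 := h z z'
    rw [hz, hz'] at *
    have e1 : 0 < height (wallGen ρ c') z := by linarith
    have e2 : ¬ 0 < height (wallGen ρ c) z' := by linarith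
    simp [e1, e2] at h3
  · have h1 := hh z
    have h2 := hh z'
    rw [hz] at h1
    rw [hz'] at h2
    have hcl : {p | 0 < height (wallGen ρ c) p} = {p | height (wallGen ρ c') p ≤ 0} := by
      ext p
      have h3 := h p z
      have e1 : 0 < height (wallGen ρ c') z := by linarith
      rw [hz] at h3
      simp only [e1, lt_irrefl, iff_false, iff_true] at h3
      simp only [Set.mem_ofPred_eq]
      rw [← not_lt, ← h3, not_not]
    have hclopen : IsClopen {p | 0 < height (wallGen ρ c) p} := by
      refine ⟨?_, isOpen_lt continuous_const (continuous_height _)⟩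
      rw [hcl]; exact isClosed_le (continuous_height _) continuous_const
    rcases isClopen_iff.1 hclopen with h5 | h5
    · have : w ∈ {p | 0 < height (wallGen ρ c) p} := hw
      rw [h5] at this; exact this
    · have : z ∈ {p | 0 < height (wallGen ρ c) p} := by rw [h5]; trivial
      rw [Set.mem_ofPred_eq, hz] at this; exact lt_irrefl _ this
  · have h1 := hh z
    have h2 := hh w
    have h3 := h z w
    rw [hz] at *
    have e1 : ¬ 0 < height (wallGen ρ c') z := by linarith
    have e2 : ¬ 0 < height (wallGen ρ c') w := by linarith
    simp [e1, e2, hw] at h3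

/-- Conjugate elements have the same translation length; the uniform bound feeds the finiteness of
walls between two points. -/
theorem exists_dist_eq (hs : HasSimpleAxis ρ a) :
    ∃ d : ℝ, ∀ c : WallOf a, ∀ z, height (wallGen ρ c) z = 0 → dist z (ρ c.1 • z) = d := by
  obtain ⟨z₀, hz₀⟩ := hs.nonempty
  refine ⟨dist z₀ (ρ a • z₀), fun c z hz => ?_⟩
  rw [← hs.mem_wall_iff] at hz
  obtain ⟨g, hg⟩ := wall_conj c
  rw [hg, map_mul, map_mul, map_inv] at hz ⊢
  rw [← smul_inv_smul (ρ g) z, smul_mem_axis_conj] at hz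
  rw [← dist_smul_smul (ρ g)⁻¹ z, smul_smul]
  have e : (ρ g)⁻¹ * (ρ g * ρ a * (ρ g)⁻¹) = ρ a * (ρ g)⁻¹ := by group
  rw [e, mul_smul]
  exact le_antisymm (hz z₀) (hz₀ _)

theorem wall_finite (hs : HasSimpleAxis ρ a) (x y : ℍ) :
    (separating (wallSide ρ a) x y).Finite := by
  obtain ⟨d, hd⟩ := hs.exists_dist_eq
  have hpos : ∀ s : ℝ, 0 < Real.exp ((1 - s) * Real.log x.im + s * Real.log y.im) :=
    fun s => Real.exp_pos _
  -- Any compact path from x to y would do. A wall separating x and y meets it, and the element of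
  -- that wall moves the meeting point by `d`, so it returns a fixed ball to itself.
  let γ : ℝ → ℍ := fun s => pt ((1 - s) * x.re + s * y.re) _ (hpos s)
  have hγ : Continuous γ := continuous_pt (by fun_prop) (by fun_prop) _
  have h0 : γ 0 = x := UpperHalfPlane.ext (Complex.ext (by simp [γ, pt])
    (by simp [γ, pt, Real.exp_log x.im_pos]))
  have h1 : γ 1 = y := UpperHalfPlane.ext (Complex.ext (by simp [γ, pt])
    (by simp [γ, pt, Real.exp_log y.im_pos]))
  obtain ⟨R, hR⟩ := ((isCompact_Icc (a := (0 : ℝ)) (b := 1)).image hγ).isBounded.subset_closedBall x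
  have hfin := hs.rep.properlyDiscontinuous (Metric.closedBall x (R + |d|)) (isCompact_closedBall _ _)
  refine (hfin.preimage (Subtype.val_injective (p := fun c => IsConj a c)).injOn).subset ?_
  intro c hc
  have hex : ∃ s ∈ Set.Icc (0 : ℝ) 1, height (wallGen ρ c) (γ s) = 0 := by
    have hcont : ContinuousOn (fun s => height (wallGen ρ c) (γ s)) (Set.Icc 0 1) :=
      ((continuous_height _).comp hγ).continuousOn
    simp only [separating, wallSide] at hc
    by_cases hx : 0 < height (wallGen ρ c) x
    · have hy : height (wallGen ρ c) y ≤ 0 := by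
        by_contra! h; exact hc ⟨fun _ => h, fun _ => hx⟩
      exact intermediate_value_Icc' zero_le_one hcont ⟨by rw [h1]; exact hy, by rw [h0]; exact hx.le⟩
    · have hy : 0 < height (wallGen ρ c) y := by
        by_contra h; exact hc ⟨fun h' => absurd h' hx, fun h' => absurd h' h⟩
      exact intermediate_value_Icc zero_le_one hcont
        ⟨by rw [h0]; exact not_lt.1 hx, by rw [h1]; exact hy.le⟩
  obtain ⟨s, hs1, hs2⟩ := hex
  have hz : γ s ∈ Metric.closedBall x R := hR ⟨s, hs1, rfl⟩
  rw [Metric.mem_closedBall] at hz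
  refine ⟨ρ c.1 • γ s, ⟨γ s, ?_, rfl⟩, ?_⟩
  · rw [Metric.mem_closedBall]; have := abs_nonneg d; linarith
  · rw [Metric.mem_closedBall]
    have := dist_triangle (ρ c.1 • γ s) (γ s) x
    rw [dist_comm (ρ c.1 • γ s) (γ s), hd c _ hs2] at this
    have := le_abs_self d
    linarith

theorem isWallSystem (hs : HasSimpleAxis ρ a) : IsWallSystem (wallSide ρ a) :=
  ⟨hs.wall_finite, hs.wall_nested, hs.wall_ext⟩

/-! ### The twist deformation -/

/-- The translation by `t` along a wall. -/
def wallFlow (hs : HasSimpleAxis ρ a) (t : ℝ) (c : WallOf a) : PSL2R :=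
  toPSL (flow (hs.isGenerator c) t)

theorem wallFlow_wallMove (hs : HasSimpleAxis ρ a) (t : ℝ) (g : G) (c : WallOf a) :
    hs.wallFlow t (wallMove g c) = MulAut.conj (ρ g) (hs.wallFlow t c) := by
  obtain ⟨X, hX⟩ := exists_toPSL (ρ g)
  rw [MulAut.conj_apply, ← hX, wallFlow, wallFlow]
  change toPSL _ = toPSL (X * flow (hs.isGenerator c) t * X⁻¹)
  congr 1
  apply Subtype.ext
  rw [mul_mul_inv_coe, flow_coe, flow_coe, flowMat, flowMat, wallGen_wallMove ρ g c hX, mul_add,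
    add_mul, Matrix.mul_smul, Matrix.mul_smul, Matrix.smul_mul, Matrix.smul_mul, mul_one,
    coe_mul_coe_inv]

theorem transport_smul (hs : HasSimpleAxis ρ a) (t : ℝ) (g : G) (x y : ℍ) :
    transport hs.isWallSystem (hs.wallFlow t) (ρ g • x) (ρ g • y) =
      ρ g * transport hs.isWallSystem (hs.wallFlow t) x y * (ρ g)⁻¹ :=
  transport_equivariant hs.isWallSystem (hs.wallFlow t) (wallMove g) (MulAction.toPerm (ρ g))
    (fun c p => wallSide_wallMove ρ g c p) (MulAut.conj (ρ g)).toMonoidHom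
    (fun c => hs.wallFlow_wallMove t g c) x y

/-- The twist deformation along the closed geodesic of `a`, based at `x`. -/
def twist (hs : HasSimpleAxis ρ a) (x : ℍ) (t : ℝ) : G →* PSL2R where
  toFun g := transport hs.isWallSystem (hs.wallFlow t) x (ρ g • x) * ρ g
  map_one' := by rw [map_one, one_smul, transport_self, one_mul]
  map_mul' g h := by
    have h1 := transport_mul hs.isWallSystem (hs.wallFlow t) x (ρ g • x) (ρ (g * h) • x)
    rw [← h1, map_mul, mul_smul, transport_smul]
    group

theorem twist_apply (hs : HasSimpleAxis ρ a) (x : ℍ) (t : ℝ) (g : G) : hs.twist x t g =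
    transport hs.isWallSystem (hs.wallFlow t) x (ρ g • x) * ρ g := rfl

theorem continuous_wallFlow (hs : HasSimpleAxis ρ a) (c : WallOf a) :
    Continuous fun t => hs.wallFlow t c :=
  continuous_quotient_mk'.comp (continuous_flow (hs.isGenerator c))

theorem continuous_twist_apply (hs : HasSimpleAxis ρ a) (x : ℍ) (g : G) :
    Continuous fun t => hs.twist x t g := by
  simp only [twist_apply, transport]
  refine Continuous.mul ?_ continuous_const
  refine continuous_list_prod _ fun c _ => ?_
  unfold jump
  by_cases h : wallSide ρ a c x
  · simp only [if_pos h]; exact (hs.continuous_wallFlow c).inv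
  · simp only [if_neg h]; exact hs.continuous_wallFlow c

theorem twist_zero (hs : HasSimpleAxis ρ a) (x : ℍ) : hs.twist x 0 = ρ := by
  ext1 g
  have h : ∀ c, jump (wallSide ρ a) (hs.wallFlow 0) x c = 1 := by
    intro c
    have : hs.wallFlow 0 c = 1 := by rw [wallFlow, flow_zero]; rfl
    unfold jump
    rw [this]; simp
  have h2 : ∀ l : List (WallOf a), (l.map (jump (wallSide ρ a) (hs.wallFlow 0) x)).prod = 1 := by
    intro l
    apply List.prod_eq_one
    intro p hp
    obtain ⟨c, -, rfl⟩ := List.mem_map.1 hp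
    exact h c
  rw [twist_apply, transport, h2, one_mul]

theorem twist_mem_teichmueller (hs : HasSimpleAxis ρ a) (x : ℍ) (t : ℝ) :
    hs.twist x t ∈ teichmueller ρ := by
  have hc : Continuous fun t : ℝ => (hs.twist x t : G → PSL2R) :=
    continuous_pi fun g => hs.continuous_twist_apply x g
  have hpre : IsPreconnected (Set.range fun t : ℝ => (hs.twist x t : G → PSL2R)) :=
    isPreconnected_range hc
  have hsub : (Set.range fun t : ℝ => (hs.twist x t : G → PSL2R)) ⊆
      Set.range fun σ : G →* PSL2R => (σ : G → PSL2R) := by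
    rintro _ ⟨s, rfl⟩; exact ⟨hs.twist x s, rfl⟩
  have h0 : (ρ : G → PSL2R) ∈ Set.range fun t : ℝ => (hs.twist x t : G → PSL2R) :=
    ⟨0, by simp only [hs.twist_zero x]⟩
  exact hpre.subset_connectedComponentIn h0 hsub ⟨t, rfl⟩

end HasSimpleAxis

/-! ### Limits of the twist deformation -/

/-- `u` spans the eigenline of `J` for the eigenvalue `e`: an endpoint of the axis. -/
def IsEnd (J : Mat2) (e : ℝ) (u : Fin 2 → ℝ) : Prop := u ≠ 0 ∧ J.mulVec u = e • u

theorem IsGenerator.exists_isEnd {J : Mat2} (h : IsGenerator J) {e : ℝ} (he : e ^ 2 = 1) :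
    ∃ u, IsEnd J e u := by
  obtain ⟨h1, h2⟩ := h.entry
  have hd : (J - e • (1 : Mat2)).det = 0 := by
    rw [Matrix.det_fin_two]
    simp [h1]
    linear_combination he - h2
  obtain ⟨u, hu, h0⟩ := Matrix.exists_mulVec_eq_zero_iff.2 hd
  refine ⟨u, hu, ?_⟩
  rw [Matrix.sub_mulVec, Matrix.smul_mulVec, Matrix.one_mulVec, sub_eq_zero] at h0
  exact h0

theorem eq_zero_of_mulVec_eq_zero {M : Mat2} {u w : Fin 2 → ℝ} (hu : M.mulVec u = 0)
    (hw : M.mulVec w = 0) (h : wedge u w ≠ 0) : M = 0 := by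
  have a0 := congrFun hu 0
  have a1 := congrFun hu 1
  have b0 := congrFun hw 0
  have b1 := congrFun hw 1
  rw [mulVec_zero_apply, Pi.zero_apply] at a0 b0
  rw [mulVec_one_apply, Pi.zero_apply] at a1 b1
  unfold wedge at h
  ext i j
  fin_cases i <;> fin_cases j <;> apply (mul_eq_zero.1 _).resolve_right h
  · change M 0 0 * _ = 0; linear_combination w 1 * a0 - u 1 * b0
  · change M 0 1 * _ = 0; linear_combination u 0 * b0 - w 0 * a0
  · change M 1 0 * _ = 0; linear_combination w 1 * a1 - u 1 * b1
  · change M 1 1 * _ = 0; linear_combination u 0 * b1 - w 0 * a1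

theorem IsEnd.wedge_ne_zero {J : Mat2} {e : ℝ} (he : e ^ 2 = 1) {u w : Fin 2 → ℝ}
    (hu : IsEnd J e u) (hw : IsEnd J (-e) w) : wedge w u ≠ 0 := by
  intro h0
  obtain ⟨r, rfl⟩ := exists_smul_of_wedge_eq_zero hw.1 h0
  have h1 := hu.2
  rw [Matrix.mulVec_smul, hw.2, smul_comm, neg_smul] at h1
  have h2 : (2 * e) • r • w = 0 := by
    rw [mul_smul, two_smul]
    nth_rewrite 1 [← h1]
    abel
  rcases smul_eq_zero.1 h2 with h3 | h3
  · have : e = 0 := by linarith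
    rw [this] at he; norm_num at he
  · exact hu.1 h3

/-- The spectral projection of a generator. -/
theorem IsEnd.projection {J : Mat2} {e : ℝ} (he : e ^ 2 = 1) {u w : Fin 2 → ℝ}
    (hu : IsEnd J e u) (hw : IsEnd J (-e) w) :
    (1 / 2 : ℝ) • ((1 : Mat2) + e • J) = (wedge w u)⁻¹ • rankOne u w := by
  have hne := hu.wedge_ne_zero he hw
  rw [← sub_eq_zero]
  apply eq_zero_of_mulVec_eq_zero (u := w) (w := u) _ _ hne
  · rw [Matrix.sub_mulVec, Matrix.smul_mulVec, Matrix.smul_mulVec, Matrix.add_mulVec,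
      Matrix.smul_mulVec, Matrix.one_mulVec, hw.2, mulVec_rankOne, wedge_self, smul_smul]
    have : e * -e = -1 := by linear_combination -he
    rw [this]; simp
  · rw [Matrix.sub_mulVec, Matrix.smul_mulVec, Matrix.smul_mulVec, Matrix.add_mulVec,
      Matrix.smul_mulVec, Matrix.one_mulVec, hu.2, mulVec_rankOne, smul_smul, smul_smul,
      inv_mul_cancel₀ hne, one_smul]
    have : e * e = 1 := by linear_combination he
    rw [this, one_smul, ← two_smul ℝ u, smul_smul]; norm_num

/-- After rescaling only the dominant eigenvalue survives: the limit is the spectral projection to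
the attracting endpoint. -/
theorem tendsto_exp_smul_flowMat (J : Mat2) {e : ℝ} (he : e = 1 ∨ e = -1) :
    Tendsto (fun t => Real.exp (-t) • flowMat J (e * t)) atTop
      (𝓝 ((1 / 2 : ℝ) • ((1 : Mat2) + e • J))) := by
  have h : (fun t => Real.exp (-t) • flowMat J (e * t)) = fun t =>
      ((1 + Real.exp (-t) * Real.exp (-t)) / 2) • (1 : Mat2) +
        (e * (1 - Real.exp (-t) * Real.exp (-t)) / 2) • J := by
    funext t
    have h1 : Real.exp (-t) * Real.exp t = 1 := by rw [← Real.exp_add]; simp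
    have hc : Real.exp (-t) * Real.cosh (e * t) = (1 + Real.exp (-t) * Real.exp (-t)) / 2 := by
      have : Real.cosh (e * t) = Real.cosh t := by rcases he with rfl | rfl <;> simp
      rw [this, Real.cosh_eq]; linear_combination h1 / 2
    have hs : Real.exp (-t) * Real.sinh (e * t) =
        e * (1 - Real.exp (-t) * Real.exp (-t)) / 2 := by
      have : Real.sinh (e * t) = e * Real.sinh t := by rcases he with rfl | rfl <;> simp
      rw [this, Real.sinh_eq]; linear_combination e * h1 / 2
    rw [flowMat, smul_add, smul_smul, smul_smul, hc, hs]
  rw [h]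
  have hexp : Tendsto (fun t : ℝ => Real.exp (-t)) atTop (𝓝 0) :=
    Real.tendsto_exp_atBot.comp tendsto_neg_atTop_atBot
  have h2 : (1 / 2 : ℝ) • ((1 : Mat2) + e • J) =
      ((1 + 0 * 0) / 2 : ℝ) • (1 : Mat2) + (e * (1 - 0 * 0) / 2) • J := by
    rw [smul_add, smul_smul]; congr 2 <;> ring
  rw [h2]
  exact (((hexp.mul hexp).const_add 1).div_const 2 |>.smul_const _).add
    (((hexp.mul hexp).const_sub 1).const_mul e |>.div_const 2 |>.smul_const _)

open Classical in
/-- The direction in which a wall is sheared, seen from `x`. -/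
def wallSign (ρ : G →* PSL2R) (a : G) (x : ℍ) (c : WallOf a) : ℝ :=
  if wallSide ρ a c x then -1 else 1

theorem wallSign_cases (ρ : G →* PSL2R) (a : G) (x : ℍ) (c : WallOf a) :
    wallSign ρ a x c = 1 ∨ wallSign ρ a x c = -1 := by
  unfold wallSign; split_ifs <;> simp

namespace HasSimpleAxis

variable {ρ : G →* PSL2R} {a : G}

/-- The wedge of endpoints of different walls does not vanish. -/
theorem wedge_ne_zero (hs : HasSimpleAxis ρ a) {c c' : WallOf a} (hne : c ≠ c') {e e' : ℝ}
    {u u' : Fin 2 → ℝ} (hu : IsEnd (wallGen ρ c) e u) (hu' : IsEnd (wallGen ρ c') e' u') :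
    wedge u u' ≠ 0 := by
  intro h0
  obtain ⟨r, rfl⟩ := exists_smul_of_wedge_eq_zero hu.1 h0
  have hr : r ≠ 0 := by rintro rfl; exact hu'.1 (zero_smul _ _)
  have h1 := hu'.2
  rw [Matrix.mulVec_smul, smul_comm] at h1
  have h2 : (wallGen ρ c').mulVec u = e' • u := by
    have := congrArg (fun v => r⁻¹ • v) h1
    simpa [smul_smul, hr, mul_comm, mul_assoc] using this
  exact hne (hs.wall_eq_of_eigenvector hu.1 hu.2 h2)

/-- A lift of the product of translations along a list of walls. -/
def flowProd (hs : HasSimpleAxis ρ a) (f : WallOf a → ℝ) (l : List (WallOf a)) (t : ℝ) :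
    SL(2, ℝ) := (l.map fun c => flow (hs.isGenerator c) (f c * t)).prod

theorem continuous_flowProd (hs : HasSimpleAxis ρ a) (f : WallOf a → ℝ) (l : List (WallOf a)) :
    Continuous (hs.flowProd f l) :=
  continuous_list_prod _ fun c _ => (continuous_flow (hs.isGenerator c)).comp (by fun_prop)

/-- Each rescaled factor tends to a rank one projection, and a product of rank one matrices keeps
only the outer vectors: the attracting endpoint of the first wall and the repelling endpoint of the
last. The scalar is nonzero because consecutive walls are different and so share no endpoint. -/
theorem tendsto_flowProd (hs : HasSimpleAxis ρ a) (f : WallOf a → ℝ)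
    (hf : ∀ c, f c = 1 ∨ f c = -1) (l : List (WallOf a)) (hl : l.Nodup) (hne : l ≠ []) :
    ∃ (k : ℝ) (u w : Fin 2 → ℝ), k ≠ 0 ∧ IsEnd (wallGen ρ (l.head hne)) (f (l.head hne)) u ∧
      IsEnd (wallGen ρ (l.getLast hne)) (-f (l.getLast hne)) w ∧
      Tendsto (fun t => Real.exp (-(l.length * t)) • (hs.flowProd f l t).1) atTop
        (𝓝 (k • rankOne u w)) := by
  have hsq : ∀ c, f c ^ 2 = 1 := fun c => by rcases hf c with h | h <;> rw [h] <;> norm_num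
  induction l with
  | nil => exact absurd rfl hne
  | cons c l ih =>
    obtain ⟨u, hu⟩ := (hs.isGenerator c).exists_isEnd (hsq c)
    obtain ⟨w, hw⟩ := (hs.isGenerator c).exists_isEnd (e := -f c) (by rw [neg_sq]; exact hsq c)
    have hwu := hu.wedge_ne_zero (hsq c) hw
    have hlim := tendsto_exp_smul_flowMat (wallGen ρ c) (hf c)
    rw [hu.projection (hsq c) hw] at hlim
    cases l with
    | nil =>
      refine ⟨(wedge w u)⁻¹, u, w, inv_ne_zero hwu, hu, hw, ?_⟩
      simpa [flowProd, flow_coe] using hlim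
    | cons d l =>
      obtain ⟨k, u', w', hk, hu', hw', hlim'⟩ := ih (List.nodup_cons.1 hl).2 (by simp)
      have hcd : c ≠ d := by
        rintro rfl
        exact (List.nodup_cons.1 hl).1 (by simp)
      have hwu' := hs.wedge_ne_zero hcd hw hu'
      refine ⟨(wedge w u)⁻¹ * k * wedge w u', u, w',
        mul_ne_zero (mul_ne_zero (inv_ne_zero hwu) hk) hwu', hu, hw', ?_⟩
      have h3 := hlim.mul hlim'
      rw [Matrix.smul_mul, Matrix.mul_smul, rankOne_mul_rankOne, smul_smul, smul_smul] at h3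
      refine h3.congr fun t => ?_
      rw [Matrix.smul_mul, Matrix.mul_smul, smul_smul, ← Real.exp_add]
      congr 1
      · congr 1
        rw [List.length_cons, List.length_cons, List.length_cons]; push_cast; ring

/-- A lift of the twist deformation to `SL(2,ℝ)`. -/
def twistSL (hs : HasSimpleAxis ρ a) (x : ℍ) (b : G) (B : SL(2, ℝ)) (t : ℝ) : SL(2, ℝ) :=
  hs.flowProd (wallSign ρ a x) (chain hs.isWallSystem x (ρ b • x)) t * B

theorem jump_wallFlow (hs : HasSimpleAxis ρ a) (x : ℍ) (t : ℝ) (c : WallOf a) :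
    jump (wallSide ρ a) (hs.wallFlow t) x c =
      toPSL (flow (hs.isGenerator c) (wallSign ρ a x c * t)) := by
  unfold jump wallSign wallFlow
  by_cases h : wallSide ρ a c x
  · rw [if_pos h, if_pos h, neg_one_mul, flow_neg]; rfl
  · rw [if_neg h, if_neg h, one_mul]

theorem toPSL_twistSL (hs : HasSimpleAxis ρ a) (x : ℍ) {b : G} {B : SL(2, ℝ)}
    (hB : toPSL B = ρ b) (t : ℝ) : toPSL (hs.twistSL x b B t) = hs.twist x t b := by
  rw [twist_apply, transport, ← hB, twistSL, flowProd]
  change toPSL _ * toPSL B = _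
  congr 1
  change (QuotientGroup.mk' _) _ = _
  rw [map_list_prod, List.map_map, hB]
  congr 1
  apply List.map_congr_left
  intro c _
  exact (hs.jump_wallFlow x t c).symm

theorem continuous_twistSL (hs : HasSimpleAxis ρ a) (x : ℍ) (b : G) (B : SL(2, ℝ)) :
    Continuous (hs.twistSL x b B) := (hs.continuous_flowProd _ _).mul continuous_const

theorem twistSL_of_empty (hs : HasSimpleAxis ρ a) {x : ℍ} {b : G} (B : SL(2, ℝ))
    (h : separating (wallSide ρ a) x (ρ b • x) = ∅) (t : ℝ) : hs.twistSL x b B t = B := by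
  have : chain hs.isWallSystem x (ρ b • x) = [] := by
    rw [List.eq_nil_iff_forall_not_mem]
    intro c hc
    rw [(isChain_chain hs.isWallSystem x (ρ b • x)).mem, h] at hc
    exact hc
  rw [twistSL, this, flowProd]; simp

theorem isEnd_wallMove {c : WallOf a} {e : ℝ} {w : Fin 2 → ℝ} (g : G) {X : SL(2, ℝ)}
    (hX : toPSL X = ρ g) (h : IsEnd (wallGen ρ c) e w) :
    IsEnd (wallGen ρ (wallMove g c)) e (X.1.mulVec w) := by
  constructor
  · intro h0
    have : (X⁻¹).1.mulVec (X.1.mulVec w) = 0 := by rw [h0, Matrix.mulVec_zero]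
    rw [Matrix.mulVec_mulVec, coe_inv_mul_coe, Matrix.one_mulVec] at this
    exact h.1 this
  · rw [wallGen_wallMove ρ g c hX, Matrix.mulVec_mulVec, mul_assoc, coe_inv_mul_coe, mul_one,
      ← Matrix.mulVec_mulVec, h.2, Matrix.mulVec_smul]

/-- Under a twist of infinite size, the endpoints of the axis of `b` converge to endpoints of the
first walls that this axis crosses in its two directions. -/
theorem tendsto_twistSL (hs : HasSimpleAxis ρ a) (x : ℍ) {b : G} {B : SL(2, ℝ)}
    (hB : toPSL B = ρ b) (hne : (separating (wallSide ρ a) x (ρ b • x)).Nonempty) :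
    ∃ c₁ ∈ separating (wallSide ρ a) x (ρ b • x), ∃ c₀ ∈ separating (wallSide ρ a) x (ρ b⁻¹ • x),
    ∃ n : ℕ, ∀ e : ℝ, (e = 1 ∨ e = -1) → ∃ (k : ℝ) (u w : Fin 2 → ℝ), k ≠ 0 ∧
      IsEnd (wallGen ρ c₁) (wallSign ρ a x c₁ * e) u ∧
      IsEnd (wallGen ρ c₀) (wallSign ρ a x c₀ * e) w ∧
      Tendsto (fun t => Real.exp (-(n * t)) • (hs.twistSL x b B (e * t)).1) atTop
        (𝓝 (k • rankOne u w)) := by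
  have hch := isChain_chain hs.isWallSystem x (ρ b • x)
  have hne' : chain hs.isWallSystem x (ρ b • x) ≠ [] := by
    obtain ⟨c, hc⟩ := hne
    exact List.ne_nil_of_mem ((hch.mem c).2 hc)
  have hB' : toPSL B⁻¹ = ρ b⁻¹ := by rw [map_inv, ← hB]; rfl
  set l := chain hs.isWallSystem x (ρ b • x) with hl
  have hlast := (hch.mem _).1 (List.getLast_mem hne')
  have e1 : wallSide ρ a (wallMove b⁻¹ (l.getLast hne')) x ↔
      wallSide ρ a (l.getLast hne') (ρ b • x) := by
    have := wallSide_wallMove ρ b⁻¹ (l.getLast hne') (ρ b • x)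
    rw [map_inv, inv_smul_smul] at this
    exact this
  have e2 : wallSide ρ a (wallMove b⁻¹ (l.getLast hne')) (ρ b⁻¹ • x) ↔
      wallSide ρ a (l.getLast hne') x := wallSide_wallMove ρ b⁻¹ (l.getLast hne') x
  have hlast' : ¬(wallSide ρ a (l.getLast hne') x ↔ wallSide ρ a (l.getLast hne') (ρ b • x)) := hlast
  -- Moving the last wall back by `b⁻¹` places it between x and `b⁻¹ x`, with x now on its other
  -- side. The repelling endpoint thus carries the same kind of sign as the attracting endpoint of
  -- the first wall.
  have hsign : wallSign ρ a x (wallMove b⁻¹ (l.getLast hne')) = -wallSign ρ a x (l.getLast hne') := by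
    unfold wallSign
    by_cases h1 : wallSide ρ a (l.getLast hne') x
    · have h2 : ¬wallSide ρ a (wallMove b⁻¹ (l.getLast hne')) x := by
        rw [e1]; exact fun h2 => hlast' ⟨fun _ => h2, fun _ => h1⟩
      rw [if_pos h1, if_neg h2]; norm_num
    · have h2 : wallSide ρ a (wallMove b⁻¹ (l.getLast hne')) x := by
        rw [e1]; by_contra h2; exact hlast' ⟨fun h => absurd h h1, fun h => absurd h h2⟩
      rw [if_neg h1, if_pos h2]
  refine ⟨l.head hne', (hch.mem _).1 (List.head_mem hne'), wallMove b⁻¹ (l.getLast hne'), ?_,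
    l.length, ?_⟩
  · change ¬(_ ↔ _)
    rw [e1, e2]; exact fun h => hlast' h.symm
  · intro e he
    have hf : ∀ c, wallSign ρ a x c * e = 1 ∨ wallSign ρ a x c * e = -1 := by
      intro c
      rcases wallSign_cases ρ a x c with h | h <;> rcases he with rfl | rfl <;> rw [h] <;> norm_num
    obtain ⟨k, u, w, hk, hu, hw, hlim⟩ := hs.tendsto_flowProd (fun c => wallSign ρ a x c * e) hf l
      hch.nodup hne'
    refine ⟨k, u, (B⁻¹).1.mulVec w, hk, hu, ?_, ?_⟩
    · have := isEnd_wallMove b⁻¹ hB' hw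
      rw [hsign]
      convert this using 1
      ring
    · have h3 := hlim.mul_const B.1
      rw [Matrix.smul_mul, rankOne_mul] at h3
      refine h3.congr fun t => ?_
      rw [Matrix.smul_mul]
      congr 1
      have : hs.flowProd (fun c => wallSign ρ a x c * e) l t =
          hs.flowProd (wallSign ρ a x) l (e * t) := by
        simp only [flowProd, mul_assoc]
      rw [this]; rfl

end HasSimpleAxis

/-! ### Limits of angles under twisting -/

theorem crossDet_smul_smul (p q : ℝ) (X Y : Mat2) :
    crossDet (p • X) (q • Y) = p ^ 2 * q ^ 2 * crossDet X Y := by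
  simp only [crossDet_eq, Matrix.smul_apply, smul_eq_mul]; ring

theorem crossNum_smul_smul (p q : ℝ) (X Y : Mat2) :
    crossNum (p • X) (q • Y) = p * q * crossNum X Y := by
  simp only [crossNum_eq, Matrix.smul_apply, smul_eq_mul]; ring

theorem crossDet_comm (X Y : Mat2) : crossDet X Y = crossDet Y X := by
  rw [crossDet_eq, crossDet_eq]; ring

theorem continuous_entry (i j : Fin 2) : Continuous fun M : Mat2 => M i j :=
  continuous_apply_apply i j

theorem tendsto_entry {α : Type*} {l : Filter α} {f : α → Mat2} {A : Mat2}
    (hf : Tendsto f l (𝓝 A)) (i j : Fin 2) : Tendsto (fun t => f t i j) l (𝓝 (A i j)) :=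
  ((continuous_entry i j).tendsto A).comp hf

theorem tendsto_crossDet {α : Type*} {l : Filter α} {f g : α → Mat2} {A B : Mat2}
    (hf : Tendsto f l (𝓝 A)) (hg : Tendsto g l (𝓝 B)) :
    Tendsto (fun t => crossDet (f t) (g t)) l (𝓝 (crossDet A B)) := by
  have F := tendsto_entry hf
  have H := tendsto_entry hg
  simp only [crossDet_eq]
  exact ((((F 0 1).mul (H 1 0)).sub ((H 0 1).mul (F 1 0))).pow 2).neg.sub
    ((((H 0 1).mul ((F 0 0).sub (F 1 1))).sub ((F 0 1).mul ((H 0 0).sub (H 1 1)))).mul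
      (((F 1 0).mul ((H 0 0).sub (H 1 1))).sub ((H 1 0).mul ((F 0 0).sub (F 1 1)))))

theorem tendsto_crossNum {α : Type*} {l : Filter α} {f g : α → Mat2} {A B : Mat2}
    (hf : Tendsto f l (𝓝 A)) (hg : Tendsto g l (𝓝 B)) :
    Tendsto (fun t => crossNum (f t) (g t)) l (𝓝 (crossNum A B)) := by
  have F := tendsto_entry hf
  have H := tendsto_entry hg
  simp only [crossNum_eq]
  exact (((F 0 0).sub (F 1 1)).mul ((H 0 0).sub (H 1 1))).add
    ((((F 0 1).mul (H 1 0)).add ((F 1 0).mul (H 0 1))).const_mul 2)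

theorem tendsto_trace {α : Type*} {l : Filter α} {f : α → Mat2} {A : Mat2}
    (hf : Tendsto f l (𝓝 A)) : Tendsto (fun t => (f t).trace) l (𝓝 A.trace) :=
  ((continuous_id.matrix_trace).tendsto A).comp hf

theorem crossDet_rankOne_rankOne (k k' : ℝ) (u w u' w' : Fin 2 → ℝ) :
    crossDet (k • rankOne u w) (k' • rankOne u' w') = (k * k') ^ 2 *
      (wedge w u' * wedge w' u * wedge u u' * wedge w w') := by
  rw [crossDet_smul_smul, crossDet_eq]
  simp only [rankOne, wedge, Matrix.of_apply, Matrix.cons_val', Matrix.cons_val_zero,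
    Matrix.cons_val_one, Matrix.cons_val_fin_one]
  ring

theorem crossNum_rankOne_rankOne (k k' : ℝ) (u w u' w' : Fin 2 → ℝ) :
    crossNum (k • rankOne u w) (k' • rankOne u' w') =
      k * k' * (2 * (wedge w u' * wedge w' u) - wedge w u * wedge w' u') := by
  rw [crossNum_smul_smul, crossNum, rankOne_mul_rankOne, Matrix.trace_smul, trace_rankOne,
    trace_rankOne, trace_rankOne, smul_eq_mul]

theorem wedge_plucker (u w u' w' : Fin 2 → ℝ) :
    wedge w u' * wedge w' u = wedge w u * wedge w' u' + wedge u u' * wedge w' w := by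
  unfold wedge; ring

/-- The height function of a geodesic along the orbit of a point on the axis of `B`. -/
theorem height_add_height_inv (J : Mat2) (B : SL(2, ℝ)) (z : ℍ) (hz : height B.1 z = 0) :
    height J (B • z) + height J (B⁻¹ • z) = (B.1.trace ^ 2 - 2) * height J z := by
  have hd := SL2_det B
  have hB := entry_of_height_eq_zero hz
  have hy := z.im_ne_zero
  rw [height_smul, height_smul, inv_inv, SL2_inv_coe, ← height_add, Matrix.trace_fin_two]
  simp only [height, Matrix.add_apply, Matrix.mul_apply, Fin.sum_univ_two, Matrix.of_apply,
    Matrix.cons_val', Matrix.cons_val_zero, Matrix.cons_val_one, Matrix.cons_val_fin_one]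
  rw [hB] at hd ⊢
  field_simp
  linear_combination (-2 : ℝ) *
    (J 1 0 * (z.re ^ 2 + z.im ^ 2) + (J 1 1 - J 0 0) * z.re - J 0 1) * hd

theorem eq_of_eq_or_eq_neg_of_continuous {f : ℝ → ℝ} (hf : Continuous f) (h : ∀ t, f t ≠ 0)
    (s t : ℝ) : 0 < f s * f t := by
  by_contra! hle
  have : ∃ p, f p = 0 := by
    rcases lt_or_gt_of_ne (h s) with h1 | h1
    · exact mem_range_of_exists_le_of_exists_ge hf ⟨s, h1.le⟩ ⟨t, by
        by_contra! h2; nlinarith⟩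
    · exact mem_range_of_exists_le_of_exists_ge hf ⟨t, by
        by_contra! h2; nlinarith⟩ ⟨s, h1.le⟩
  obtain ⟨p, hp⟩ := this
  exact h p hp

namespace HasSimpleAxis

variable {ρ : G →* PSL2R} {a : G}

/-- The axis of `b` does not cross a wall in both directions from `x`: by `height_add_height_inv`
the heights one step ahead and one step behind sum to a positive multiple of the height at x, so
they cannot both have changed sign. -/
theorem separating_disjoint (hs : HasSimpleAxis ρ a) {x : ℍ} {b : G} (hb : b ≠ 1)
    (hx : x ∈ axis (ρ b)) {c : WallOf a} (h : c ∈ separating (wallSide ρ a) x (ρ b • x))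
    (h' : c ∈ separating (wallSide ρ a) x (ρ b⁻¹ • x)) : False := by
  have hB := toPSL_lift (ρ b)
  have hz := (mem_axis_iff hs.rep hb hB x).1 hx
  have hh := isHyp_of_mem_axis hs.rep hb hx
  have hid := height_add_height_inv (wallGen ρ c) (lift (ρ b)) x hz
  rw [← toPSL_smul, ← toPSL_smul, show toPSL (lift (ρ b))⁻¹ = (toPSL (lift (ρ b)))⁻¹ from rfl, hB,
    ← map_inv] at hid
  unfold IsHyp at hh
  change ¬(_ ↔ _) at h
  change ¬(_ ↔ _) at h'
  unfold wallSide at h h'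
  by_cases h0 : 0 < height (wallGen ρ c) x
  · have h1 : ¬ 0 < height (wallGen ρ c) (ρ b • x) := by tauto
    have h2 : ¬ 0 < height (wallGen ρ c) (ρ b⁻¹ • x) := by tauto
    nlinarith
  · have h1 : 0 < height (wallGen ρ c) (ρ b • x) := by tauto
    have h2 : 0 < height (wallGen ρ c) (ρ b⁻¹ • x) := by tauto
    nlinarith

theorem wedge_mulVec_ne_zero (hs : HasSimpleAxis ρ a) {b : G} (hb : b ≠ 1) {B : SL(2, ℝ)}
    (hB : toPSL B = ρ b) (hBt : 4 < B.1.trace ^ 2) {c : WallOf a}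
    (hc : axis (ρ b) ≠ axis (ρ c.1)) {e : ℝ} {u : Fin 2 → ℝ} (hu : IsEnd (wallGen ρ c) e u) :
    wedge u (B.1.mulVec u) ≠ 0 := by
  intro h0
  obtain ⟨k, hk⟩ := exists_smul_of_wedge_eq_zero hu.1 h0
  obtain ⟨l, hl⟩ := hs.eigenvector c hu.2
  exact hc (axis_eq_of_common_eigenvector hs.rep hb (hs.wall_ne_one c) hB (toPSL_lift _) hBt
    (hs.wall_isHyp c) hu.1 hk hl)

/-- If, under twisting along `a`, the cotangent of an angle tends to infinities of opposite signs,
then one of the two geodesics is `a`. -/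
theorem exists_wall_of_tendsto_cot (hs : HasSimpleAxis ρ a) {x : ℍ} {b₁ b₂ : G} (hb₁ : b₁ ≠ 1)
    (hb₂ : b₂ ≠ 1) (hx₁ : x ∈ axis (ρ b₁)) (hx₂ : x ∈ axis (ρ b₂))
    (hang : ∀ t, axisAngle (hs.twist x t b₁) (hs.twist x t b₂) ≠ 0) {s : ℝ}
    (htop : Tendsto (fun t => s * (Real.cos (axisAngle (hs.twist x t b₁) (hs.twist x t b₂)) /
      Real.sin (axisAngle (hs.twist x t b₁) (hs.twist x t b₂)))) atTop atTop)
    (hbot : Tendsto (fun t => s * (Real.cos (axisAngle (hs.twist x (-t) b₁) (hs.twist x (-t) b₂)) /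
      Real.sin (axisAngle (hs.twist x (-t) b₁) (hs.twist x (-t) b₂)))) atTop atBot) :
    (∃ c : WallOf a, axis (ρ b₁) = axis (ρ c.1)) ∨ ∃ c : WallOf a, axis (ρ b₂) = axis (ρ c.1) := by
  by_contra! hno
  obtain ⟨hno₁, hno₂⟩ := hno
  have hB₁ := toPSL_lift (ρ b₁)
  have hB₂ := toPSL_lift (ρ b₂)
  have hh₁ : 4 < (lift (ρ b₁)).1.trace ^ 2 := isHyp_of_mem_axis hs.rep hb₁ hx₁
  have hh₂ : 4 < (lift (ρ b₂)).1.trace ^ 2 := isHyp_of_mem_axis hs.rep hb₂ hx₂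
  set B₁ := lift (ρ b₁)
  set B₂ := lift (ρ b₂)
  set X : ℝ → SL(2, ℝ) := hs.twistSL x b₁ B₁ with hXdef
  set Y : ℝ → SL(2, ℝ) := hs.twistSL x b₂ B₂ with hYdef
  have hXt : ∀ t, toPSL (X t) = hs.twist x t b₁ := hs.toPSL_twistSL x hB₁
  have hYt : ∀ t, toPSL (Y t) = hs.twist x t b₂ := hs.toPSL_twistSL x hB₂
  have hXc : Continuous fun t => (X t).1 :=
    continuous_subtype_val.comp (hs.continuous_twistSL x b₁ B₁)
  have hYc : Continuous fun t => (Y t).1 :=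
    continuous_subtype_val.comp (hs.continuous_twistSL x b₂ B₂)
  set r : ℝ → ℝ := fun t => Real.cos (axisAngle (hs.twist x t b₁) (hs.twist x t b₂)) /
      Real.sin (axisAngle (hs.twist x t b₁) (hs.twist x t b₂)) with hr
  have hD : ∀ t, 0 < crossDet (X t).1 (Y t).1 := fun t =>
    crossDet_pos_of_axisAngle_ne_zero _ _ (by rw [hXt, hYt]; exact hang t)
  have hkey : ∀ t, ∃ k : ℝ, k ^ 2 = crossDet (X t).1 (Y t).1 ∧ 0 < k * comm (X t).1 (Y t).1 1 0 ∧
      r t = crossNum (X t).1 (Y t).1 / (2 * k) := by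
    intro t
    obtain ⟨-, -, k, h1, h2, h3⟩ := axisAngle_of_crossDet_pos (X t) (Y t) (hD t)
    rw [hXt, hYt] at h3
    exact ⟨k, h1, h2, h3⟩
  choose k hk1 hk2 hk3 using hkey
  have hk0 : ∀ t, k t ≠ 0 := fun t h => by have := hk2 t; rw [h] at this; simp at this
  have hr2 : ∀ t, r t ^ 2 = crossNum (X t).1 (Y t).1 ^ 2 / (4 * crossDet (X t).1 (Y t).1) := by
    intro t; rw [hk3, div_pow, mul_pow, hk1]; norm_num
  -- limits of the two matrices are never transverse
  have claim : ∀ (n m : ℝ) (A B : Mat2),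
      Tendsto (fun t => Real.exp (-(n * t)) • (X t).1) atTop (𝓝 A) →
      Tendsto (fun t => Real.exp (-(m * t)) • (Y t).1) atTop (𝓝 B) → crossDet A B = 0 := by
    intro n m A B hA hB
    by_contra hne
    -- The squared cotangent does not change when the matrices are rescaled, so it would converge if
    -- the limits were transverse.
    have h1 := ((tendsto_crossNum hA hB).pow 2).div ((tendsto_crossDet hA hB).const_mul 4)
      (mul_ne_zero four_ne_zero hne)
    have h2 : Tendsto (fun t => s ^ 2 * r t ^ 2) atTop
        (𝓝 (s ^ 2 * (crossNum A B ^ 2 / (4 * crossDet A B)))) := by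
      refine (h1.const_mul (s ^ 2)).congr fun t => ?_
      simp only [Pi.div_apply]
      rw [crossNum_smul_smul, crossDet_smul_smul, hr2]
      have e1 := (Real.exp_pos (-(n * t))).ne'
      have e2 := (Real.exp_pos (-(m * t))).ne'
      have e3 := (hD t).ne'
      field_simp
    have h3 : Tendsto (fun t => s ^ 2 * r t ^ 2) atTop atTop := by
      refine (htop.atTop_mul_atTop₀ htop).congr fun t => ?_
      ring
    exact not_tendsto_nhds_of_tendsto_atTop h3 _ h2
  have hconst : ∀ (Z : ℝ → SL(2, ℝ)) (B : SL(2, ℝ)), (∀ t, Z t = B) →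
      Tendsto (fun t => Real.exp (-(0 * t)) • (Z t).1) atTop (𝓝 B.1) := by
    intro Z B h
    simp [h]
  rcases Set.eq_empty_or_nonempty (separating (wallSide ρ a) x (ρ b₁ • x)) with hS₁ | hS₁ <;>
    rcases Set.eq_empty_or_nonempty (separating (wallSide ρ a) x (ρ b₂ • x)) with hS₂ | hS₂
  · have h1 := claim 0 0 _ _ (hconst X B₁ (hs.twistSL_of_empty B₁ hS₁))
      (hconst Y B₂ (hs.twistSL_of_empty B₂ hS₂))
    have h2 := hD 0
    rw [hXdef, hYdef, hs.twistSL_of_empty B₁ hS₁, hs.twistSL_of_empty B₂ hS₂, h1] at h2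
    exact lt_irrefl _ h2
  -- Here `b₁` is not twisted at all, and the endpoints of walls are not endpoints of its axis. So
  -- the limits are transverse.
  · obtain ⟨c₁, -, c₀, -, n, hlim⟩ := hs.tendsto_twistSL x hB₂ hS₂
    obtain ⟨κ, u, w, hκ, hu, hw, hlim⟩ := hlim 1 (Or.inl rfl)
    simp only [one_mul] at hlim
    have h1 := claim 0 n _ _ (hconst X B₁ (hs.twistSL_of_empty B₁ hS₁)) hlim
    rw [crossDet_rankOne] at h1
    have h2 := hs.wedge_mulVec_ne_zero hb₁ hB₁ hh₁ (hno₁ c₁) hu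
    have h3 := hs.wedge_mulVec_ne_zero hb₁ hB₁ hh₁ (hno₁ c₀) hw
    exact (neg_ne_zero.2 (mul_ne_zero (mul_ne_zero (pow_ne_zero 2 hκ) h2) h3)) h1
  · obtain ⟨c₁, -, c₀, -, n, hlim⟩ := hs.tendsto_twistSL x hB₁ hS₁
    obtain ⟨κ, u, w, hκ, hu, hw, hlim⟩ := hlim 1 (Or.inl rfl)
    simp only [one_mul] at hlim
    have h1 := claim n 0 _ _ hlim (hconst Y B₂ (hs.twistSL_of_empty B₂ hS₂))
    rw [crossDet_comm, crossDet_rankOne] at h1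
    have h2 := hs.wedge_mulVec_ne_zero hb₂ hB₂ hh₂ (hno₂ c₁) hu
    have h3 := hs.wedge_mulVec_ne_zero hb₂ hB₂ hh₂ (hno₂ c₀) hw
    exact (neg_ne_zero.2 (mul_ne_zero (mul_ne_zero (pow_ne_zero 2 hκ) h2) h3)) h1
  · obtain ⟨c₁, hc₁, c₀, hc₀, n, hlimX⟩ := hs.tendsto_twistSL x hB₁ hS₁
    obtain ⟨d₁, hd₁, d₀, hd₀, m, hlimY⟩ := hs.tendsto_twistSL x hB₂ hS₂
    have hc : c₁ ≠ c₀ := by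
      rintro rfl; exact hs.separating_disjoint hb₁ hx₁ hc₁ hc₀
    have hd : d₁ ≠ d₀ := by
      rintro rfl; exact hs.separating_disjoint hb₂ hx₂ hd₁ hd₀
    -- `crossDet` of the two rank one limits is the product of the four mixed wedges, each of which
    -- is nonzero if the walls involved are different.
    have hshare : c₁ = d₁ ∨ c₀ = d₀ ∨ c₁ = d₀ ∨ c₀ = d₁ := by
      by_contra! hcon
      obtain ⟨q1, q2, q3, q4⟩ := hcon
      obtain ⟨κ, u, w, hκ, hu, hw, hl⟩ := hlimX 1 (Or.inl rfl)
      obtain ⟨κ', u', w', hκ', hu', hw', hl'⟩ := hlimY 1 (Or.inl rfl)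
      simp only [one_mul] at hl hl'
      have h1 := claim n m _ _ hl hl'
      rw [crossDet_rankOne_rankOne] at h1
      exact mul_ne_zero (pow_ne_zero 2 (mul_ne_zero hκ hκ')) (mul_ne_zero (mul_ne_zero (mul_ne_zero
        (hs.wedge_ne_zero q4 hw hu') (hs.wedge_ne_zero q3.symm hw' hu))
        (hs.wedge_ne_zero q1 hu hu')) (hs.wedge_ne_zero q2 hw hw')) h1
    -- the sign of the cosine is then the same at both ends
    have hpar : ∀ {c : WallOf a} {e : ℝ} {u v : Fin 2 → ℝ}, e ^ 2 = 1 → IsEnd (wallGen ρ c) e u →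
        IsEnd (wallGen ρ c) e v → wedge u v = 0 := by
      intro c e u v he hu hv
      have h1 := wedge_mulVec_mulVec (wallGen ρ c) u v
      rw [hu.2, hv.2, wedge_smul_left, wedge_smul_right, (hs.isGenerator c).det_eq, ← mul_assoc,
        ← pow_two, he] at h1
      linarith
    have hsq : ∀ (c : WallOf a) (e : ℝ), (e = 1 ∨ e = -1) → (wallSign ρ a x c * e) ^ 2 = 1 := by
      intro c e he
      rcases wallSign_cases ρ a x c with h | h <;> rcases he with rfl | rfl <;> rw [h] <;> norm_num
    obtain ⟨σ, hσ⟩ : ∃ σ : ℝ, ∀ e : ℝ, (e = 1 ∨ e = -1) → ∀ᶠ t in atTop,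
        0 < σ * (crossNum (X (e * t)).1 (Y (e * t)).1 *
          ((X (e * t)).1.trace * (Y (e * t)).1.trace)) := by
      -- A shared wall contributes the same endpoint to both limits, which kills one product in the
      -- Plücker relation. What remains of `crossNum` is the product of the traces, with sign `+1`
      -- for `c₁ = d₁` or `c₀ = d₀` and `-1` for the mixed coincidences, whatever the direction `e`
      -- of the twist.
      obtain ⟨σ, hσ0, hσ⟩ : ∃ σ : ℝ, σ ^ 2 = 1 ∧ ∀ e : ℝ, (e = 1 ∨ e = -1) →
          ∀ (κ κ' : ℝ) (u w u' w' : Fin 2 → ℝ),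
          IsEnd (wallGen ρ c₁) (wallSign ρ a x c₁ * e) u →
          IsEnd (wallGen ρ c₀) (wallSign ρ a x c₀ * e) w →
          IsEnd (wallGen ρ d₁) (wallSign ρ a x d₁ * e) u' →
          IsEnd (wallGen ρ d₀) (wallSign ρ a x d₀ * e) w' →
          crossNum (κ • rankOne u w) (κ' • rankOne u' w') =
            σ * (κ * wedge w u * (κ' * wedge w' u')) := by
        rcases hshare with h | h | h | h
        · subst h
          refine ⟨1, by norm_num, fun e he κ κ' u w u' w' hu hw hu' hw' => ?_⟩
          rw [crossNum_rankOne_rankOne, wedge_plucker, hpar (hsq _ e he) hu hu']; ring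
        · subst h
          refine ⟨1, by norm_num, fun e he κ κ' u w u' w' hu hw hu' hw' => ?_⟩
          rw [crossNum_rankOne_rankOne, wedge_plucker, hpar (hsq _ e he) hw' hw]; ring
        · subst h
          refine ⟨-1, by norm_num, fun e he κ κ' u w u' w' hu hw hu' hw' => ?_⟩
          rw [crossNum_rankOne_rankOne, hpar (hsq _ e he) hw' hu]; ring
        · subst h
          refine ⟨-1, by norm_num, fun e he κ κ' u w u' w' hu hw hu' hw' => ?_⟩
          rw [crossNum_rankOne_rankOne, hpar (hsq _ e he) hw hu']; ring
      refine ⟨σ, fun e he => ?_⟩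
      obtain ⟨κ, u, w, hκ, hu, hw, hl⟩ := hlimX e he
      obtain ⟨κ', u', w', hκ', hu', hw', hl'⟩ := hlimY e he
      have h1 := hσ e he κ κ' u w u' w' hu hw hu' hw'
      have h2 := ((tendsto_crossNum hl hl').mul ((tendsto_trace hl).mul (tendsto_trace hl'))).const_mul σ
      rw [h1, Matrix.trace_smul, Matrix.trace_smul, trace_rankOne, trace_rankOne, smul_eq_mul,
        smul_eq_mul] at h2
      have hpos : 0 < σ * (σ * (κ * wedge w u * (κ' * wedge w' u')) *
          (κ * wedge w u * (κ' * wedge w' u'))) := by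
        have : κ * wedge w u * (κ' * wedge w' u') ≠ 0 := mul_ne_zero
          (mul_ne_zero hκ (hs.wedge_ne_zero hc.symm hw hu))
          (mul_ne_zero hκ' (hs.wedge_ne_zero hd.symm hw' hu'))
        have h3 := sq_pos_of_ne_zero this
        nlinarith
      filter_upwards [h2.eventually (lt_mem_nhds hpos)] with t ht
      rw [crossNum_smul_smul, Matrix.trace_smul, Matrix.trace_smul, smul_eq_mul, smul_eq_mul] at ht
      have e1 := Real.exp_pos (-(n * t))
      have e2 := Real.exp_pos (-(m * t))
      have e3 : 0 < (Real.exp (-(n * t)) * Real.exp (-(m * t))) ^ 2 := by positivity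
      refine pos_of_mul_pos_right (a := (Real.exp (-(n * t)) * Real.exp (-(m * t))) ^ 2) ?_ e3.le
      refine ht.trans_eq ?_
      ring
    have htr : ∀ t, (X t).1.trace * (Y t).1.trace ≠ 0 := by
      intro t
      obtain ⟨h1, h2⟩ := trace_sq_of_crossDet_pos (X t) (Y t) (hD t)
      refine mul_ne_zero ?_ ?_
      · intro h; rw [h] at h1; norm_num at h1
      · intro h; rw [h] at h2; norm_num at h2
    have htrpos := eq_of_eq_or_eq_neg_of_continuous
      (hXc.matrix_trace.mul hYc.matrix_trace) htr
    have hcpos := eq_of_eq_or_eq_neg_of_continuous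
      (f := fun t => comm (X t).1 (Y t).1 1 0)
      ((continuous_entry 1 0).comp ((hXc.mul hYc).sub (hYc.mul hXc)))
      (fun t => comm_one_zero_ne_zero _ _ (hD t))
    -- The product of the traces and the orientation `comm … 1 0` never vanish, so their signs are
    -- constant in t. Thus `crossNum` and `k` have the same sign at t and -t, while the cotangent is
    -- to change sign.
    have hev := ((hσ 1 (Or.inl rfl)).and (hσ (-1) (Or.inr rfl))).and
      ((htop.eventually_gt_atTop 0).and (hbot.eventually_lt_atBot 0))
    obtain ⟨t, ⟨g1, g2⟩, g3, g4⟩ := hev.exists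
    rw [one_mul] at g1
    rw [neg_one_mul] at g2
    have g5 := htrpos t (-t)
    have g6 := hcpos t (-t)
    have g7 : s * r t * (s * r (-t)) < 0 := mul_neg_of_pos_of_neg g3 g4
    have n1 : crossNum (X t).1 (Y t).1 = r t * (2 * k t) := by
      rw [hk3, div_mul_cancel₀]; exact mul_ne_zero two_ne_zero (hk0 t)
    have n2 : crossNum (X (-t)).1 (Y (-t)).1 = r (-t) * (2 * k (-t)) := by
      rw [hk3, div_mul_cancel₀]; exact mul_ne_zero two_ne_zero (hk0 (-t))
    have g8 := mul_pos g1 g2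
    have g9 := mul_pos (hk2 t) (hk2 (-t))
    have kk : 0 < k t * k (-t) := by
      by_contra! h
      nlinarith
    have rr : r t * r (-t) < 0 := by
      by_contra! h
      nlinarith [mul_nonneg (sq_nonneg s) h]
    have nn : 0 < crossNum (X t).1 (Y t).1 * crossNum (X (-t)).1 (Y (-t)).1 := by
      by_contra! h
      have : 0 ≤ σ ^ 2 * ((X t).1.trace * (Y t).1.trace * ((X (-t)).1.trace * (Y (-t)).1.trace)) :=
        mul_nonneg (sq_nonneg _) g5.le
      nlinarith [mul_nonpos_of_nonneg_of_nonpos this h]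
    rw [n1, n2] at nn
    nlinarith [mul_pos_of_neg_of_neg rr (neg_lt_zero.2 kk)]

end HasSimpleAxis

/-! ### Twisting two simple geodesics that meet once -/

/-- If the axes cross, then `|trace (J * Y)| < |trace Y|`. These are the coefficients of cosh and
sinh in the twisted angle, so the sinh term dominates. -/
theorem trace_identity {J : Mat2} (h : IsGenerator J) (Y : SL(2, ℝ)) :
    Y.1.trace ^ 2 - 4 = (J * Y.1).trace ^ 2 + crossDet J Y.1 := by
  obtain ⟨h1, h2⟩ := h.entry
  have hd := SL2_det Y
  rw [crossDet_eq, Matrix.trace_fin_two, Matrix.trace_fin_two]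
  simp only [Matrix.mul_apply, Fin.sum_univ_two, h1]
  linear_combination (-(Y.1 0 0 - Y.1 1 1) ^ 2 - 4 * Y.1 0 1 * Y.1 1 0) * h2 + 4 * hd

theorem tendsto_sinh_add_cosh {m : ℝ} (hm : |m| < 1) :
    Tendsto (fun t => Real.sinh t + m * Real.cosh t) atTop atTop ∧
    Tendsto (fun t => Real.sinh (-t) + m * Real.cosh (-t)) atTop atBot := by
  obtain ⟨h1, h2⟩ := abs_lt.1 hm
  have hexp : Tendsto (fun t : ℝ => Real.exp (-t)) atTop (𝓝 0) :=
    Real.tendsto_exp_atBot.comp tendsto_neg_atTop_atBot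
  constructor
  · have h3 := (Real.tendsto_exp_atTop.const_mul_atTop (show 0 < (1 + m) / 2 by linarith)).atTop_add
      (hexp.const_mul (-(1 - m) / 2))
    refine h3.congr fun t => ?_
    rw [Real.sinh_eq, Real.cosh_eq]; ring
  · have h3 := (Real.tendsto_exp_atTop.const_mul_atTop_of_neg
      (show -(1 - m) / 2 < 0 by linarith)).atBot_add (hexp.const_mul ((1 + m) / 2))
    refine h3.congr fun t => ?_
    rw [Real.sinh_eq, Real.cosh_eq, neg_neg]; ring

/-- The behaviour of an angle whose numerator is a hyperbolic function. -/
theorem tendsto_cot_of_crossNum {g h : ℝ → PSL2R} {X : SL(2, ℝ)} {M : ℝ → SL(2, ℝ)}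
    (hg : ∀ t, toPSL X = g t) (hh : ∀ t, toPSL (M t) = h t) (hM : Continuous fun t => (M t).1)
    {D p q : ℝ} (hD : 0 < D) (hcd : ∀ t, crossDet X.1 (M t).1 = D) (hpq : p ^ 2 < q ^ 2)
    (hcn : ∀ t, crossNum X.1 (M t).1 = p * Real.cosh t + q * Real.sinh t) :
    (∀ t, 0 < axisAngle (g t) (h t) ∧ axisAngle (g t) (h t) < Real.pi) ∧ ∃ s : ℝ,
      Tendsto (fun t => s * (Real.cos (axisAngle (g t) (h t)) / Real.sin (axisAngle (g t) (h t))))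
        atTop atTop ∧
      Tendsto (fun t => s * (Real.cos (axisAngle (g (-t)) (h (-t))) /
        Real.sin (axisAngle (g (-t)) (h (-t))))) atTop atBot := by
  have hpos : ∀ t, 0 < crossDet X.1 (M t).1 := fun t => by rw [hcd]; exact hD
  refine ⟨fun t => ?_, ?_⟩
  · have := axisAngle_of_crossDet_pos X (M t) (hpos t)
    rw [hg t, hh t] at this
    exact ⟨this.1, this.2.1⟩
  have hex : ∀ t, ∃ k : ℝ, k ^ 2 = D ∧ 0 < k * comm X.1 (M t).1 1 0 ∧
      Real.cos (axisAngle (g t) (h t)) / Real.sin (axisAngle (g t) (h t)) =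
        (p * Real.cosh t + q * Real.sinh t) / (2 * k) := by
    intro t
    obtain ⟨-, -, k, h1, h2, h3⟩ := axisAngle_of_crossDet_pos X (M t) (hpos t)
    rw [hg t, hh t, hcn] at h3
    rw [hcd] at h1
    exact ⟨k, h1, h2, h3⟩
  choose k hk1 hk2 hk3 using hex
  have hc := eq_of_eq_or_eq_neg_of_continuous (f := fun t => comm X.1 (M t).1 1 0)
    ((continuous_entry 1 0).comp ((continuous_const.mul hM).sub (hM.mul continuous_const)))
    (fun t => comm_one_zero_ne_zero _ _ (hpos t))
  -- `k` has constant square, and its sign is that of a commutator entry which is continuous and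
  -- never zero.
  have hkk : ∀ t, k t = k 0 := by
    intro t
    have h1 : (k t - k 0) * (k t + k 0) = 0 := by linear_combination hk1 t - hk1 0
    rcases mul_eq_zero.1 h1 with h2 | h2
    · linarith
    · exfalso
      have h3 := hc t 0
      have h4 := mul_pos (hk2 t) (hk2 0)
      have h5 : k t = -k 0 := by linarith
      rw [h5] at h4
      have h6 : 0 < k 0 ^ 2 := by rw [hk1]; exact hD
      nlinarith
  have hk0 : k 0 ≠ 0 := by
    intro h0; have := hk1 0; rw [h0] at this; norm_num at this; linarith
  have hq : q ≠ 0 := by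
    rintro rfl; nlinarith [sq_nonneg p]
  have hm : |p / q| < 1 := by
    rw [abs_div, div_lt_one (abs_pos.2 hq)]
    exact sq_lt_sq.1 hpq
  obtain ⟨l1, l2⟩ := tendsto_sinh_add_cosh hm
  -- This factor turns the cotangent into `sinh t + (p / q) cosh t`.
  refine ⟨2 * k 0 / q, l1.congr fun t => ?_, l2.congr fun t => ?_⟩
  · rw [hk3 t, hkk t]; field_simp; ring
  · rw [hk3 (-t), hkk (-t)]; field_simp; ring

theorem crossDet_one_add_left (α β : ℝ) (J M : Mat2) :
    crossDet (α • (1 : Mat2) + β • J) M = β ^ 2 * crossDet J M := by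
  simp only [crossDet_eq, Matrix.add_apply, Matrix.smul_apply, smul_eq_mul, Matrix.one_apply_eq,
    Matrix.one_apply_ne (show (0 : Fin 2) ≠ 1 by decide),
    Matrix.one_apply_ne (show (1 : Fin 2) ≠ 0 by decide)]
  ring

theorem crossNum_one_add_left (α β : ℝ) {J : Mat2} (hJ : J.trace = 0) (M : Mat2) :
    crossNum (α • (1 : Mat2) + β • J) M = 2 * β * (J * M).trace := by
  rw [crossNum, add_mul, Matrix.trace_add, Matrix.trace_add, Matrix.smul_mul, Matrix.smul_mul,
    Matrix.trace_smul, Matrix.trace_smul, Matrix.trace_smul, Matrix.trace_smul, hJ, one_mul,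
    Matrix.trace_one]
  simp; ring

theorem crossDet_flow_mul {J : Mat2} (h : IsGenerator J) (t : ℝ) (Y : Mat2) :
    crossDet J (flowMat J t * Y) = crossDet J Y := by
  have e : comm J (flowMat J t * Y) = flowMat J t * comm J Y := by
    rw [comm, comm, mul_sub, ← mul_assoc, commute_flowMat, mul_assoc, mul_assoc]
  rw [crossDet, e, Matrix.det_mul, flowMat_det h, one_mul, crossDet]

theorem crossDet_mul_flow {J : Mat2} (h : IsGenerator J) (t : ℝ) (Y : Mat2) :
    crossDet J (Y * flowMat J t) = crossDet J Y := by
  have e : comm J (Y * flowMat J t) = comm J Y * flowMat J t := by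
    rw [comm, comm, sub_mul, mul_assoc Y, ← commute_flowMat, mul_assoc, mul_assoc]
  rw [crossDet, e, Matrix.det_mul, flowMat_det h, mul_one, crossDet]

theorem trace_mul_flow_mul {J : Mat2} (h : IsGenerator J) (t : ℝ) (Y : Mat2) :
    (J * (flowMat J t * Y)).trace = (J * Y).trace * Real.cosh t + Y.trace * Real.sinh t := by
  rw [flowMat, add_mul, mul_add, Matrix.smul_mul, Matrix.smul_mul, Matrix.mul_smul,
    Matrix.mul_smul, one_mul, ← mul_assoc, h.mul_self, one_mul, Matrix.trace_add,
    Matrix.trace_smul, Matrix.trace_smul, smul_eq_mul, smul_eq_mul]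
  ring

theorem trace_mul_mul_flow {J : Mat2} (h : IsGenerator J) (t : ℝ) (Y : Mat2) :
    (J * (Y * flowMat J t)).trace = (J * Y).trace * Real.cosh t + Y.trace * Real.sinh t := by
  rw [← trace_mul_flow_mul h, ← mul_assoc, Matrix.trace_mul_comm, ← mul_assoc, ← commute_flowMat,
    mul_assoc]

theorem flow_zsmul {J : Mat2} (h : IsGenerator J) (n : ℤ) (l : ℝ) :
    flow h (n * l) = flow h l ^ n := by
  let φ : Multiplicative ℝ →* SL(2, ℝ) :=
    { toFun := fun t => flow h t.toAdd, map_one' := flow_zero h, map_mul' := fun s t => flow_add h _ _ }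
  have := map_zpow φ (Multiplicative.ofAdd l) n
  rw [← ofAdd_zsmul, zsmul_eq_mul] at this
  exact this

theorem height_flow_smul {J : Mat2} (h : IsGenerator J) (s : ℝ) (z : ℍ) :
    height J (flow h s • z) = height J z := by
  rw [height_smul, mul_assoc, flow_coe, commute_flowMat, ← flow_coe h, ← mul_assoc,
    coe_inv_mul_coe, one_mul]

theorem flow_smul_injective {J : Mat2} (h : IsGenerator J) {z : ℍ} (hz : height J z = 0)
    {s t : ℝ} (hst : flow h s • z = flow h t • z) : s = t := by
  have h1 : flow h (s - t) • z = z := by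
    rw [sub_eq_neg_add, flow_add, mul_smul, hst, flow_neg, inv_smul_smul]
  rw [smul_eq_self_iff, flow_coe, height_flowMat, hz, flowMat_trace h] at h1
  have h2 := Real.cosh_sq (s - t)
  have h3 : Real.sinh (s - t) ^ 2 = 0 := by linarith
  have h4 := Real.sinh_eq_zero.1 (pow_eq_zero_iff two_ne_zero |>.1 h3)
  linarith

theorem continuous_flow_smul {J : Mat2} (h : IsGenerator J) (z : ℍ) :
    Continuous fun s => flow h s • z := (continuous_flow h).smul continuous_const

/-- Elements of a surface group translate along their axes. -/
theorem exists_flow_rep {ρ : G →* PSL2R} {a : G} (h : IsHyp (ρ a)) :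
    ∃ l : ℝ, 0 < l ∧ (∀ n : ℤ, ρ (a ^ n) = toPSL (flow h.isGenerator (n * l))) ∧
      ∀ x : ℍ, ρ a • x = flow h.isGenerator l • x := by
  obtain ⟨l, hl, he⟩ := exists_flow h
  have e : ρ a = toPSL (flow h.isGenerator l) := (toPSL_lift (ρ a)).symm.trans he
  refine ⟨l, hl, fun n => ?_, fun x => congrArg (fun p : PSL2R => p • x) e⟩
  rw [flow_zsmul, map_zpow]
  exact congrArg (· ^ n) e

theorem mem_axis_flow {ρ : G →* PSL2R} (hρ : IsClosedSurfaceRep ρ) {a : G} (ha : a ≠ 1)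
    (h : IsHyp (ρ a)) {z : ℍ} (hz : z ∈ axis (ρ a)) (s : ℝ) :
    flow h.isGenerator s • z ∈ axis (ρ a) := by
  rw [mem_axis_iff_genP hρ ha h] at hz ⊢
  rw [height_flow_smul, hz]

/-- A closed geodesic is not a point. -/
theorem closedGeodesic_ne_singleton {ρ : G →* PSL2R} (hρ : IsClosedSurfaceRep ρ) {a : G}
    (ha : IsSimple ρ a) {x : ℍ} (hx : x ∈ axis (ρ a)) (p : Surface ρ) :
    closedGeodesic ρ a ≠ {p} := by
  intro hp
  have hh := isHyp_of_mem_axis hρ ha.1 hx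
  -- If the geodesic were a point, simplicity would make every point of the axis a translate of x by
  -- a power of `a`, which embeds ℝ into ℤ.
  have h1 : ∀ s : ℝ, ∃ n : ℤ, flow hh.isGenerator s • x = ρ (a ^ n) • x := by
    intro s
    have hs := mem_axis_flow hρ ha.1 hh hx s
    apply ha.2 x hx _ hs
    have e1 : proj ρ x ∈ closedGeodesic ρ a := ⟨x, hx, rfl⟩
    have e2 : proj ρ (flow hh.isGenerator s • x) ∈ closedGeodesic ρ a := ⟨_, hs, rfl⟩
    rw [hp, Set.mem_singleton_iff] at e1 e2
    rw [e1, e2]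
  choose f hf using h1
  have hinj : Function.Injective f := by
    intro s t hst
    apply flow_smul_injective hh.isGenerator ((mem_axis_iff_genP hρ ha.1 hh x).1 hx)
    rw [hf, hf, hst]
  have : Countable ℝ := hinj.countable
  exact not_countable (α := ℝ) this

theorem comm_eq_zero_of_heights {X Y : Mat2} {z : ℍ} (hX : height X z = 0) (hY : height Y z = 0)
    (h : comm X Y 1 0 = 0) : comm X Y = 0 := by
  have e1 := entry_of_height_eq_zero hX
  have e2 := entry_of_height_eq_zero hY
  have h' := h
  rw [comm_one_zero] at h'
  ext i j
  fin_cases i <;> fin_cases j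
  · change comm X Y 0 0 = 0
    rw [comm_zero_zero, e1, e2]; linear_combination z.re * h'
  · change comm X Y 0 1 = 0
    rw [comm_zero_one, e1, e2]; linear_combination -(z.re ^ 2 + z.im ^ 2) * h'
  · exact h
  · change comm X Y 1 1 = 0
    rw [comm_one_one, e1, e2]; linear_combination -z.re * h'

/-- Two different axes that meet cross. -/
theorem crossDet_pos_of_axis_ne {ρ : G →* PSL2R} (hρ : IsClosedSurfaceRep ρ) {a b : G}
    (ha : a ≠ 1) (hb : b ≠ 1) {x : ℍ} (hxa : x ∈ axis (ρ a)) (hxb : x ∈ axis (ρ b))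
    (hne : axis (ρ a) ≠ axis (ρ b)) : 0 < crossDet (lift (ρ a)).1 (lift (ρ b)).1 := by
  have h1 := (mem_axis_iff hρ ha (toPSL_lift _) x).1 hxa
  have h2 := (mem_axis_iff hρ hb (toPSL_lift _) x).1 hxb
  rw [crossDet_of_heights h1 h2]
  refine sq_pos_of_ne_zero (mul_ne_zero (fun h0 => hne ?_) x.im_ne_zero)
  have h3 := sub_eq_zero.1 (comm_eq_zero_of_heights h1 h2 h0)
  ext z
  rw [mem_axis_iff hρ ha (toPSL_lift _), mem_axis_iff hρ hb (toPSL_lift _)]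
  exact ⟨height_eq_zero_of_comm_eq_zero _ _ z h3
      (nonscalar_of_trace_sq _ (isHyp_of_mem_axis hρ ha hxa)),
    height_eq_zero_of_comm_eq_zero _ _ z h3.symm
      (nonscalar_of_trace_sq _ (isHyp_of_mem_axis hρ hb hxb))⟩

/-- The wall of `a` itself. -/
def baseWall (a : G) : WallOf a := ⟨a, IsConj.refl a⟩

namespace HasSimpleAxis

variable {ρ : G →* PSL2R} {a : G}

theorem mem_baseWall (hs : HasSimpleAxis ρ a) {x : ℍ} (hx : x ∈ axis (ρ a)) :
    height (wallGen ρ (baseWall a)) x = 0 := (hs.mem_wall_iff (baseWall a) x).1 hx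

/-- The path along the axis stays in its own wall and meets no other. Hence the twist leaves `a`
unchanged. -/
theorem separating_self_eq_empty (hs : HasSimpleAxis ρ a) {x : ℍ} (hx : x ∈ axis (ρ a)) :
    separating (wallSide ρ a) x (ρ a • x) = ∅ := by
  have hh := isHyp_of_mem_axis hs.rep hs.simple.1 hx
  obtain ⟨l, -, -, hl⟩ := exists_flow_rep hh
  have hax := hl x
  have hx0 : flow hh.isGenerator 0 • x = x := by rw [flow_zero, one_smul]
  rw [Set.eq_empty_iff_forall_notMem]
  intro c hc
  apply hc
  rw [hax]
  unfold wallSide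
  by_cases hcb : c = baseWall a
  · rw [hcb, hs.mem_baseWall hx, hs.mem_baseWall (mem_axis_flow hs.rep hs.simple.1 hh hx l)]
  · have h1 := eq_of_eq_or_eq_neg_of_continuous
      (f := fun s => height (wallGen ρ c) (flow hh.isGenerator s • x))
      ((continuous_height _).comp (continuous_flow_smul hh.isGenerator x))
      (fun s h0 => hcb (hs.wall_eq_of_mem h0
        (hs.mem_baseWall (mem_axis_flow hs.rep hs.simple.1 hh hx s)))) 0 l
    simp only [hx0] at h1
    constructor
    · intro h2; exact pos_of_mul_pos_right h1 h2.le
    · intro h2; exact pos_of_mul_pos_left h1 h2.le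

theorem twist_apply_of_separating_eq_empty (hs : HasSimpleAxis ρ a) {x : ℍ} {b : G}
    (h : separating (wallSide ρ a) x (ρ b • x) = ∅) (t : ℝ) : hs.twist x t b = ρ b := by
  rw [← hs.toPSL_twistSL x (toPSL_lift (ρ b)), hs.twistSL_of_empty _ h, toPSL_lift]

theorem twist_apply_of_separating_eq_singleton (hs : HasSimpleAxis ρ a) {x : ℍ} {b : G}
    {c : WallOf a} (h : separating (wallSide ρ a) x (ρ b • x) = {c}) (t : ℝ) :
    hs.twist x t b = jump (wallSide ρ a) (hs.wallFlow t) x c * ρ b := by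
  have hc : IsChain (wallSide ρ a) x (ρ b • x) [c] :=
    ⟨List.nodup_singleton c, fun d => by rw [h]; simp, List.pairwise_singleton _ _⟩
  rw [twist_apply, transport_eq hs.isWallSystem _ hc]
  simp

/-- The geodesics meet only at the image of x, and `b` is simple, so the axis of `b` meets lifts of
`a` only at translates of x by powers of `b`. Between x and `b x` these are the two ends. -/
theorem separating_subset (hs : HasSimpleAxis ρ a) {b : G} (hb : IsSimple ρ b) {x : ℍ}
    (hxa : x ∈ axis (ρ a)) (hxb : x ∈ axis (ρ b))
    (hz : closedGeodesic ρ a ∩ closedGeodesic ρ b = {proj ρ x}) :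
    separating (wallSide ρ a) x (ρ b • x) ⊆ {baseWall a, wallMove b (baseWall a)} := by
  intro c hc
  have hh := isHyp_of_mem_axis hs.rep hb.1 hxb
  obtain ⟨l, hl0, hl, hlx⟩ := exists_flow_rep hh
  have hbx := hlx x
  have hx0 : flow hh.isGenerator 0 • x = x := by rw [flow_zero, one_smul]
  have hcont : ContinuousOn (fun s => height (wallGen ρ c) (flow hh.isGenerator s • x))
      (Set.Icc 0 l) :=
    ((continuous_height _).comp (continuous_flow_smul hh.isGenerator x)).continuousOn
  have hex : ∃ s ∈ Set.Icc (0 : ℝ) l, height (wallGen ρ c) (flow hh.isGenerator s • x) = 0 := by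
    change ¬(_ ↔ _) at hc
    rw [hbx] at hc
    unfold wallSide at hc
    by_cases h0 : 0 < height (wallGen ρ c) x
    · have h1 : height (wallGen ρ c) (flow hh.isGenerator l • x) ≤ 0 := by
        by_contra! h; exact hc ⟨fun _ => h, fun _ => h0⟩
      exact intermediate_value_Icc' hl0.le hcont ⟨h1, by simp only [hx0]; exact h0.le⟩
    · have h1 : 0 < height (wallGen ρ c) (flow hh.isGenerator l • x) := by
        by_contra h; exact hc ⟨fun h' => absurd h' h0, fun h' => absurd h' h⟩
      exact intermediate_value_Icc hl0.le hcont ⟨by simp only [hx0]; exact not_lt.1 h0, h1.le⟩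
  obtain ⟨s, hs1, hs2⟩ := hex
  have hyb := mem_axis_flow hs.rep hb.1 hh hxb s
  set y := flow hh.isGenerator s • x with hy
  have hyc : y ∈ axis (ρ c.1) := (hs.mem_wall_iff c y).2 hs2
  have hya : proj ρ y ∈ closedGeodesic ρ a := by
    obtain ⟨g, hg⟩ := wall_conj c
    rw [hg, map_mul, map_mul, map_inv, axis_conj] at hyc
    obtain ⟨w, hw, hwy⟩ := hyc
    exact ⟨w, hw, (proj_eq_iff ρ _ _).2 ⟨g⁻¹, by rw [map_inv, ← hwy, inv_smul_smul]⟩⟩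
  have hyp : proj ρ y = proj ρ x := by
    have : proj ρ y ∈ closedGeodesic ρ a ∩ closedGeodesic ρ b := ⟨hya, ⟨y, hyb, rfl⟩⟩
    rw [hz] at this; exact this
  obtain ⟨n, hn⟩ := hb.2 x hxb y hyb hyp.symm
  rw [hl, toPSL_smul] at hn
  have hsn : s = n * l := flow_smul_injective hh.isGenerator
    ((mem_axis_iff_genP hs.rep hb.1 hh x).1 hxb) hn
  have hn0 : 0 ≤ n := by
    have : (0 : ℝ) ≤ n := by
      by_contra! h
      nlinarith [hs1.1]
    exact_mod_cast this
  have hn1 : n ≤ 1 := by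
    have : (n : ℝ) ≤ 1 := by
      by_contra! h
      nlinarith [hs1.2]
    exact_mod_cast this
  have hn01 : n = 0 ∨ n = 1 := by omega
  rcases hn01 with rfl | rfl
  · left
    rw [hsn, Int.cast_zero, zero_mul, hx0] at hy
    rw [hy] at hs2
    exact hs.wall_eq_of_mem hs2 (hs.mem_baseWall hxa)
  · right
    rw [hsn, Int.cast_one, one_mul, ← hbx] at hy
    rw [hy] at hs2
    refine hs.wall_eq_of_mem hs2 ?_
    rw [height_wallMove]; exact hs.mem_baseWall hxa

/-- The angle between two simple closed geodesics that meet once varies over the whole interval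
`(0, π)` when one twists along one of them. -/
theorem tendsto_cot_twist (hs : HasSimpleAxis ρ a) {b : G} (hb : IsSimple ρ b) {x : ℍ}
    (hxa : x ∈ axis (ρ a)) (hxb : x ∈ axis (ρ b))
    (hz : closedGeodesic ρ a ∩ closedGeodesic ρ b = {proj ρ x}) :
    (∀ t, 0 < axisAngle (hs.twist x t a) (hs.twist x t b) ∧
      axisAngle (hs.twist x t a) (hs.twist x t b) < Real.pi) ∧ ∃ s : ℝ,
      Tendsto (fun t => s * (Real.cos (axisAngle (hs.twist x t a) (hs.twist x t b)) /
        Real.sin (axisAngle (hs.twist x t a) (hs.twist x t b)))) atTop atTop ∧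
      Tendsto (fun t => s * (Real.cos (axisAngle (hs.twist x (-t) a) (hs.twist x (-t) b)) /
        Real.sin (axisAngle (hs.twist x (-t) a) (hs.twist x (-t) b)))) atTop atBot := by
  have hne : axis (ρ a) ≠ axis (ρ b) := by
    intro h
    have : closedGeodesic ρ a = closedGeodesic ρ b := by rw [closedGeodesic, closedGeodesic, h]
    rw [← this, Set.inter_self] at hz
    exact closedGeodesic_ne_singleton hs.rep hs.simple hxa _ hz
  have hD := crossDet_pos_of_axis_ne hs.rep hs.simple.1 hb.1 hxa hxb hne
  have hX := toPSL_lift (ρ a)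
  have hY := toPSL_lift (ρ b)
  have hXt : 4 < (lift (ρ a)).1.trace ^ 2 := isHyp_of_mem_axis hs.rep hs.simple.1 hxa
  have hJ : IsGenerator (genP (ρ a)) := hs.isGenerator (baseWall a)
  have hXJ : (lift (ρ a)).1 = _ := coe_eq_gen hXt
  change _ = _ + _ • genP (ρ a) at hXJ
  have hYax := (mem_axis_iff hs.rep hb.1 hY x).1 hxb
  have hid := height_add_height_inv (wallGen ρ (baseWall a)) (lift (ρ b)) x hYax
  rw [hs.mem_baseWall hxa, mul_zero, ← toPSL_smul, ← toPSL_smul,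
    show toPSL (lift (ρ b))⁻¹ = (toPSL (lift (ρ b)))⁻¹ from rfl, hY, ← map_inv] at hid
  set X := lift (ρ a) with hXdef
  set Y := lift (ρ b) with hYdef
  set J := genP (ρ a) with hJdef
  generalize X.1.trace / 2 = α at hXJ
  generalize Real.sign X.1.trace * Real.sqrt (X.1.trace ^ 2 - 4) / 2 = β at hXJ
  have hD' := hD
  rw [hXJ, crossDet_one_add_left] at hD'
  have hβ : β ≠ 0 := by rintro rfl; simp at hD'
  have hJD : 0 < crossDet J Y.1 := pos_of_mul_pos_right hD' (sq_nonneg β)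
  have hpq : (J * Y.1).trace ^ 2 < Y.1.trace ^ 2 := by
    have := trace_identity hJ Y; linarith
  have hpq' : (2 * β * (J * Y.1).trace) ^ 2 < (2 * β * Y.1.trace) ^ 2 := by
    rw [mul_pow (2 * β), mul_pow (2 * β)]
    exact mul_lt_mul_of_pos_left hpq (sq_pos_of_ne_zero (mul_ne_zero two_ne_zero hβ))
  have hta : ∀ t, toPSL X = hs.twist x t a := fun t => by
    rw [hs.twist_apply_of_separating_eq_empty (hs.separating_self_eq_empty hxa), hX]
  -- Otherwise `b` would be a power of `a`, and commuting matrices have `crossDet` equal to 0.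
  have hf1 : height (wallGen ρ (baseWall a)) (ρ b • x) ≠ 0 := by
    intro h0
    rw [← hs.mem_wall_iff] at h0
    obtain ⟨n, hn⟩ := hs.simple.stabilizer hs.rep hxa h0
    have h1 : toPSL Y = toPSL (X ^ n) := by
      rw [hY, hn, map_zpow, ← hX]; rfl
    have h2 : X.1 * (X ^ n).1 = (X ^ n).1 * X.1 :=
      congrArg Subtype.val ((Commute.refl X).zpow_right n).eq
    have h3 : X.1 * Y.1 = Y.1 * X.1 := by
      rcases (toPSL_eq_iff _ _).1 h1 with h | h
      · rw [h, h2]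
      · rw [h, mul_neg, neg_mul, h2]
    have h4 : crossDet X.1 Y.1 = 0 := by
      rw [crossDet, comm, h3, sub_self]; simp
    rw [h4] at hD; exact lt_irrefl _ hD
  have hsub := hs.separating_subset hb hxa hxb hz
  have m1 : baseWall a ∈ separating (wallSide ρ a) x (ρ b • x) ↔
      0 < height (wallGen ρ (baseWall a)) (ρ b • x) := by
    change ¬(_ ↔ _) ↔ _
    unfold wallSide
    rw [hs.mem_baseWall hxa]; simp
  have m2 : wallMove b (baseWall a) ∈ separating (wallSide ρ a) x (ρ b • x) ↔
      0 < height (wallGen ρ (baseWall a)) (ρ b⁻¹ • x) := by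
    have e1 := height_wallMove ρ b (baseWall a) (ρ b⁻¹ • x)
    rw [map_inv, smul_inv_smul, ← map_inv] at e1
    change ¬(_ ↔ _) ↔ _
    unfold wallSide
    rw [height_wallMove, hs.mem_baseWall hxa, e1]; simp
  -- The base point lies on a wall and counts as its nonpositive side. By `hid` the heights at `b x`
  -- and `b⁻¹ x` are opposite, so exactly one of the two end walls is separating: the twist
  -- multiplies `Y` by a translation on the right in the first case, on the left in the second.
  rcases lt_or_gt_of_ne hf1 with hf | hf
  · have hsep : separating (wallSide ρ a) x (ρ b • x) = {wallMove b (baseWall a)} := by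
      apply Set.Subset.antisymm
      · intro c hc
        rcases hsub hc with h | h
        · rw [h, m1] at hc; linarith
        · exact h
      · rw [Set.singleton_subset_iff, m2]; linarith
    have hside : wallSide ρ a (wallMove b (baseWall a)) x := by
      have e1 := height_wallMove ρ b (baseWall a) (ρ b⁻¹ • x)
      rw [map_inv, smul_inv_smul, ← map_inv] at e1
      unfold wallSide
      rw [e1]; linarith
    have htb : ∀ t, toPSL (Y * flow hJ (-t)) = hs.twist x t b := fun t => by
      rw [hs.twist_apply_of_separating_eq_singleton hsep, jump, if_pos hside, wallFlow_wallMove,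
        MulAut.conj_apply, flow_neg]
      change toPSL Y * (toPSL (flow hJ t))⁻¹ = _
      rw [hY]
      change _ = (ρ b * toPSL (flow hJ t) * (ρ b)⁻¹)⁻¹ * ρ b
      group
    refine tendsto_cot_of_crossNum hta htb ?_ hD (fun t => ?_) (p := 2 * β * (J * Y.1).trace)
      (q := -(2 * β * Y.1.trace)) (by rw [neg_sq]; exact hpq') (fun t => ?_)
    · exact continuous_subtype_val.comp (continuous_const.mul ((continuous_flow hJ).comp continuous_neg))
    · change crossDet X.1 (Y.1 * flowMat J (-t)) = _
      rw [hXJ, crossDet_one_add_left, crossDet_one_add_left, crossDet_mul_flow hJ]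
    · change crossNum X.1 (Y.1 * flowMat J (-t)) = _
      rw [hXJ, crossNum_one_add_left _ _ hJ.1, trace_mul_mul_flow hJ, Real.cosh_neg, Real.sinh_neg]
      ring
  · have hsep : separating (wallSide ρ a) x (ρ b • x) = {baseWall a} := by
      apply Set.Subset.antisymm
      · intro c hc
        rcases hsub hc with h | h
        · exact h
        · rw [Set.mem_singleton_iff.1 h, m2] at hc; linarith
      · rw [Set.singleton_subset_iff, m1]; exact hf
    have hside : ¬wallSide ρ a (baseWall a) x := by
      unfold wallSide; rw [hs.mem_baseWall hxa]; exact lt_irrefl _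
    have htb : ∀ t, toPSL (flow hJ t * Y) = hs.twist x t b := fun t => by
      rw [hs.twist_apply_of_separating_eq_singleton hsep, jump, if_neg hside, ← hY]
      rfl
    refine tendsto_cot_of_crossNum hta htb ?_ hD (fun t => ?_) (p := 2 * β * (J * Y.1).trace)
      (q := 2 * β * Y.1.trace) hpq' (fun t => ?_)
    · exact continuous_subtype_val.comp ((continuous_flow hJ).mul continuous_const)
    · change crossDet X.1 (flowMat J t * Y.1) = _
      rw [hXJ, crossDet_one_add_left, crossDet_one_add_left, crossDet_flow_mul hJ]
    · change crossNum X.1 (flowMat J t * Y.1) = _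
      rw [hXJ, crossNum_one_add_left _ _ hJ.1, trace_mul_flow_mul hJ]
      ring

end HasSimpleAxis

/-! ### Symmetries of the angle -/

theorem axisAngle_nonneg (g h : PSL2R) : 0 ≤ axisAngle g h := by
  unfold axisAngle
  split_ifs with H
  · exact (toIcoMod_mem_Ico Real.pi_pos 0 _).1
  · exact le_rfl

theorem axisAngle_lt_pi (g h : PSL2R) : axisAngle g h < Real.pi := by
  unfold axisAngle
  split_ifs with H
  · have := (toIcoMod_mem_Ico Real.pi_pos 0
      (Complex.arg (discChart H.some (h • H.some) / discChart H.some (g • H.some)))).2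
    rwa [zero_add] at this
  · exact Real.pi_pos

theorem eq_of_cot_eq {s t : ℝ} (hs : 0 < s) (hs' : s < Real.pi) (ht : 0 < t) (ht' : t < Real.pi)
    (h : Real.cos s / Real.sin s = Real.cos t / Real.sin t) : s = t := by
  rw [div_eq_div_iff (Real.sin_pos_of_pos_of_lt_pi hs hs').ne'
    (Real.sin_pos_of_pos_of_lt_pi ht ht').ne'] at h
  have h1 : Real.sin (t - s) = 0 := by rw [Real.sin_sub]; linarith
  have := (Real.sin_eq_zero_iff_of_lt_of_lt (by linarith) (by linarith)).1 h1
  linarith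

theorem axisAngle_eq_zero_of_crossDet_nonpos (X Y : SL(2, ℝ)) (h : ¬0 < crossDet X.1 Y.1) :
    axisAngle (toPSL X) (toPSL Y) = 0 := by
  by_contra h0
  exact h (crossDet_pos_of_axisAngle_ne_zero X Y h0)

theorem eq_of_sq_eq_of_mul_pos {k l c d : ℝ} (h : k ^ 2 = l ^ 2) (hk : 0 < k * c) (hl : 0 < l * d)
    (hcd : 0 < c * d) : k = l := by
  rcases sq_eq_sq_iff_eq_or_eq_neg.1 h with h | h
  · exact h
  · exfalso
    rw [h] at hk
    have h1 := mul_pos hk hl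
    have h2 : (-l * c) * (l * d) = -(l ^ 2 * (c * d)) := by ring
    rw [h2] at h1
    have := mul_nonneg (sq_nonneg l) hcd.le
    linarith

theorem comm_conj (Q X Y : SL(2, ℝ)) : comm (Q * X * Q⁻¹).1 (Q * Y * Q⁻¹).1 =
    Q.1 * comm X.1 Y.1 * Q⁻¹.1 := by
  have h1 : (Q * X * Q⁻¹) * (Q * Y * Q⁻¹) = Q * (X * Y) * Q⁻¹ := by group
  have h2 : (Q * Y * Q⁻¹) * (Q * X * Q⁻¹) = Q * (Y * X) * Q⁻¹ := by group
  have h1' : (Q * X * Q⁻¹).1 * (Q * Y * Q⁻¹).1 = Q.1 * (X.1 * Y.1) * Q⁻¹.1 :=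
    congrArg Subtype.val h1
  have h2' : (Q * Y * Q⁻¹).1 * (Q * X * Q⁻¹).1 = Q.1 * (Y.1 * X.1) * Q⁻¹.1 :=
    congrArg Subtype.val h2
  rw [comm, comm, h1', h2', mul_sub, sub_mul]

theorem crossDet_conj (Q X Y : SL(2, ℝ)) :
    crossDet (Q * X * Q⁻¹).1 (Q * Y * Q⁻¹).1 = crossDet X.1 Y.1 := by
  rw [crossDet, comm_conj, Matrix.det_mul, Matrix.det_mul, Q.2, Q⁻¹.2, one_mul, mul_one, crossDet]

theorem crossNum_conj (Q X Y : SL(2, ℝ)) :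
    crossNum (Q * X * Q⁻¹).1 (Q * Y * Q⁻¹).1 = crossNum X.1 Y.1 := by
  have ht : ∀ Z : SL(2, ℝ), (Q * Z * Q⁻¹).1.trace = Z.1.trace := by
    intro Z
    change (Q.1 * Z.1 * Q⁻¹.1).trace = _
    rw [Matrix.trace_mul_comm, ← mul_assoc]
    have : Q⁻¹.1 * Q.1 = 1 := congrArg Subtype.val (inv_mul_cancel Q)
    rw [this, one_mul]
  have h1 : (Q * X * Q⁻¹) * (Q * Y * Q⁻¹) = Q * (X * Y) * Q⁻¹ := by group
  have h1' : (Q * X * Q⁻¹).1 * (Q * Y * Q⁻¹).1 = (Q * (X * Y) * Q⁻¹).1 := congrArg Subtype.val h1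
  rw [crossNum, h1', ht, ht, ht, crossNum]
  rfl

/-- The lower left entry of a conjugate is a quadratic form in the bottom row of `Q`. For a
traceless commutator of positive determinant this form is definite, so conjugation preserves the
orientation. -/
theorem comm_conj_mul_comm_pos (Q X Y : SL(2, ℝ)) (h : 0 < crossDet X.1 Y.1) :
    0 < comm (Q * X * Q⁻¹).1 (Q * Y * Q⁻¹).1 1 0 * comm X.1 Y.1 1 0 := by
  have h0 : comm (Q * X * Q⁻¹).1 (Q * Y * Q⁻¹).1 1 0 ≠ 0 := by
    apply comm_one_zero_ne_zero
    rw [crossDet_conj]; exact h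
  have hne := mul_ne_zero h0 (comm_one_zero_ne_zero _ _ h)
  refine lt_of_le_of_ne ?_ hne.symm
  rw [comm_conj]
  have htr : comm X.1 Y.1 1 1 = -comm X.1 Y.1 0 0 := by
    rw [comm_zero_zero, comm_one_one]
  have hdet : comm X.1 Y.1 0 0 * comm X.1 Y.1 1 1 - comm X.1 Y.1 0 1 * comm X.1 Y.1 1 0 =
      crossDet X.1 Y.1 := by rw [crossDet, Matrix.det_fin_two]
  generalize comm X.1 Y.1 = C at *
  have e : (Q.1 * C * Q⁻¹.1) 1 0 =
      (Q.1 1 0 * C 0 0 + Q.1 1 1 * C 1 0) * Q.1 1 1 -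
        (Q.1 1 0 * C 0 1 + Q.1 1 1 * C 1 1) * Q.1 1 0 := by
    have e0 : Q⁻¹.1 0 0 = Q.1 1 1 := by rw [Matrix.SpecialLinearGroup.SL2_inv_expl]; rfl
    have e1 : Q⁻¹.1 1 0 = -Q.1 1 0 := by rw [Matrix.SpecialLinearGroup.SL2_inv_expl]; rfl
    simp only [Matrix.mul_apply, Fin.sum_univ_two, e0, e1]
    ring
  rw [e, htr]
  rw [htr] at hdet
  nlinarith [sq_nonneg (Q.1 1 1 * C 1 0 + Q.1 1 0 * C 0 0), mul_nonneg (sq_nonneg (Q.1 1 0)) h.le]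

/-- The cotangent is expressed by conjugation invariants and a preserved sign. This frees the angle
from the choice of base point of the twist. -/
theorem axisAngle_conj (q g h : PSL2R) :
    axisAngle (q * g * q⁻¹) (q * h * q⁻¹) = axisAngle g h := by
  obtain ⟨Q, rfl⟩ := exists_toPSL q
  obtain ⟨X, rfl⟩ := exists_toPSL g
  obtain ⟨Y, rfl⟩ := exists_toPSL h
  change axisAngle (toPSL (Q * X * Q⁻¹)) (toPSL (Q * Y * Q⁻¹)) = _
  have hD := crossDet_conj Q X Y
  by_cases hp : 0 < crossDet X.1 Y.1
  · obtain ⟨l1, l2, k, k1, k2, k3⟩ := axisAngle_of_crossDet_pos X Y hp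
    obtain ⟨m1, m2, l, n1, n2, n3⟩ :=
      axisAngle_of_crossDet_pos (Q * X * Q⁻¹) (Q * Y * Q⁻¹) (by rw [hD]; exact hp)
    refine eq_of_cot_eq m1 m2 l1 l2 ?_
    rw [k3, n3, crossNum_conj,
      eq_of_sq_eq_of_mul_pos (by rw [k1, n1, hD]) n2 k2 (comm_conj_mul_comm_pos Q X Y hp)]
  · rw [axisAngle_eq_zero_of_crossDet_nonpos _ _ hp,
      axisAngle_eq_zero_of_crossDet_nonpos _ _ (by rw [hD]; exact hp)]

theorem comm_swap (X Y : Mat2) : comm Y X = -comm X Y := by rw [comm, comm, neg_sub]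

theorem crossDet_swap (X Y : Mat2) : crossDet Y X = crossDet X Y := by
  rw [crossDet_eq, crossDet_eq]; ring

theorem crossNum_swap (X Y : Mat2) : crossNum Y X = crossNum X Y := by
  rw [crossNum, crossNum, Matrix.trace_mul_comm, mul_comm X.trace]

theorem axisAngle_swap_of_ne_zero {g h : PSL2R} (hgh : axisAngle g h ≠ 0) :
    axisAngle h g = Real.pi - axisAngle g h := by
  obtain ⟨X, rfl⟩ := exists_toPSL g
  obtain ⟨Y, rfl⟩ := exists_toPSL h
  have hp := crossDet_pos_of_axisAngle_ne_zero X Y hgh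
  have hp' : 0 < crossDet Y.1 X.1 := by rw [crossDet_swap]; exact hp
  obtain ⟨l1, l2, k, k1, k2, k3⟩ := axisAngle_of_crossDet_pos X Y hp
  obtain ⟨m1, m2, l, n1, n2, n3⟩ := axisAngle_of_crossDet_pos Y X hp'
  refine eq_of_cot_eq m1 m2 (by linarith) (by linarith) ?_
  have hlk : -l = k := by
    refine eq_of_sq_eq_of_mul_pos (c := comm X.1 Y.1 1 0) (d := comm X.1 Y.1 1 0)
      (by rw [neg_sq, n1, k1, crossDet_swap]) ?_ k2
      (mul_self_pos.2 (comm_one_zero_ne_zero _ _ hp))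
    rw [comm_swap, Matrix.neg_apply] at n2
    linarith
  rw [Real.cos_pi_sub, Real.sin_pi_sub, neg_div, k3, n3, crossNum_swap, ← hlk, mul_neg, div_neg,
    neg_neg]

theorem axisAngle_swap_ne_zero {g h : PSL2R} (hgh : axisAngle g h ≠ 0) : axisAngle h g ≠ 0 := by
  rw [axisAngle_swap_of_ne_zero hgh]
  have := axisAngle_lt_pi g h
  linarith

/-- Allows the roles of the two geodesics to be exchanged; the default value 0 has to be treated
apart, since π minus the angle fails there. -/
theorem axisAngle_swap_eq {g h g' h' : PSL2R} (he : axisAngle g h = axisAngle g' h') :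
    axisAngle h g = axisAngle h' g' := by
  by_cases h0 : axisAngle g h = 0
  · have e1 : axisAngle h g = 0 := by
      by_contra h1; exact axisAngle_swap_ne_zero h1 h0
    have e2 : axisAngle h' g' = 0 := by
      by_contra h1; exact axisAngle_swap_ne_zero h1 (he ▸ h0)
    rw [e1, e2]
  · rw [axisAngle_swap_of_ne_zero h0, axisAngle_swap_of_ne_zero (fun h1 => h0 (he.trans h1)), he]

/-- An angle that varies over `(0, π)` cannot be shifted. -/
theorem eq_zero_of_tendsto_cot {θ : ℝ → ℝ} {c s : ℝ} (hθ : ∀ t, 0 < θ t ∧ θ t < Real.pi)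
    (hc : ∀ t, 0 ≤ θ t - c ∧ θ t - c < Real.pi)
    (htop : Tendsto (fun t => s * (Real.cos (θ t) / Real.sin (θ t))) atTop atTop)
    (hbot : Tendsto (fun t => s * (Real.cos (θ (-t)) / Real.sin (θ (-t)))) atTop atBot) :
    c = 0 := by
  have hs : s ≠ 0 := by
    rintro rfl
    obtain ⟨t, ht⟩ := (htop.eventually_gt_atTop 0).exists
    rw [zero_mul] at ht; exact lt_irrefl _ ht
  have hlarge : ∀ M : ℝ, (∃ t, M < Real.cos (θ t) / Real.sin (θ t)) ∧
      ∃ t, Real.cos (θ t) / Real.sin (θ t) < M := by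
    intro M
    obtain ⟨t, ht⟩ := (htop.eventually_gt_atTop (s * M)).exists
    obtain ⟨t', ht'⟩ := (hbot.eventually_lt_atBot (s * M)).exists
    rcases lt_or_gt_of_ne hs with h | h
    · exact ⟨⟨-t', (mul_lt_mul_left_of_neg h).1 ht'⟩, ⟨t, (mul_lt_mul_left_of_neg h).1 ht⟩⟩
    · exact ⟨⟨t, (mul_lt_mul_iff_right₀ h).1 ht⟩, ⟨-t', (mul_lt_mul_iff_right₀ h).1 ht'⟩⟩
  -- This is `sin (θ - c) ≥ 0`. Dividing by `sin θ`, a nonzero `c` would bound the cotangent by `cot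
  -- c` on one side; both bounds on the angles give `|c| < π`, so that `sin c ≠ 0`.
  have hsin : ∀ t, 0 ≤ Real.sin (θ t) * Real.cos c - Real.cos (θ t) * Real.sin c := by
    intro t
    rw [← Real.sin_sub]
    exact Real.sin_nonneg_of_nonneg_of_le_pi (hc t).1 (hc t).2.le
  have hpos : ∀ t, 0 < Real.sin (θ t) := fun t =>
    Real.sin_pos_of_pos_of_lt_pi (hθ t).1 (hθ t).2
  rcases lt_trichotomy c 0 with h | h | h
  · exfalso
    have hsc : Real.sin c < 0 := Real.sin_neg_of_neg_of_neg_pi_lt h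
      (by linarith [(hc 0).2, (hθ 0).1])
    obtain ⟨-, t, ht⟩ := hlarge (Real.cos c / Real.sin c)
    rw [lt_div_iff_of_neg hsc, div_mul_eq_mul_div, lt_div_iff₀ (hpos t)] at ht
    linarith [hsin t]
  · exact h
  · exfalso
    have hsc : 0 < Real.sin c := Real.sin_pos_of_pos_of_lt_pi h
      (by linarith [(hc 0).1, (hθ 0).2])
    obtain ⟨⟨t, ht⟩, -⟩ := hlarge (Real.cos c / Real.sin c)
    rw [div_lt_div_iff₀ hsc (hpos t)] at ht
    linarith [hsin t]

namespace HasSimpleAxis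

variable {ρ : G →* PSL2R} {a : G}

/-- A change of the base point conjugates the twisted representations. -/
theorem twist_basepoint (hs : HasSimpleAxis ρ a) (x y : ℍ) (t : ℝ) : ∃ q : PSL2R, ∀ g,
    hs.twist x t g = q * hs.twist y t g * q⁻¹ := by
  -- The two cocycles differ by the coboundary of the transport from x to y.
  refine ⟨transport hs.isWallSystem (hs.wallFlow t) x y, fun g => ?_⟩
  have h1 := transport_mul hs.isWallSystem (hs.wallFlow t) x y (ρ g • x)
  have h2 := transport_mul hs.isWallSystem (hs.wallFlow t) y (ρ g • y) (ρ g • x)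
  have h3 := transport_mul hs.isWallSystem (hs.wallFlow t) (ρ g • x) (ρ g • y) (ρ g • x)
  rw [transport_self, hs.transport_smul] at h3
  have h4 := eq_inv_of_mul_eq_one_right h3
  rw [twist_apply, twist_apply, ← h1, ← h2, h4]
  group

theorem angle_twist_basepoint (hs : HasSimpleAxis ρ a) (x y : ℍ) (t : ℝ) (g h : G) :
    angle (hs.twist x t) g h = angle (hs.twist y t) g h := by
  obtain ⟨q, hq⟩ := hs.twist_basepoint x y t
  rw [angle, angle, hq, hq, axisAngle_conj]

/-- The angle of the α's is computed by a twist based at x, the limit argument for the β's needs a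
base point y on their axes. Angles do not depend on the base point. -/
theorem exists_wall_of_angle_eq (hs : HasSimpleAxis ρ a) {b : G} (hb : IsSimple ρ b) {x : ℍ}
    (hxa : x ∈ axis (ρ a)) (hxb : x ∈ axis (ρ b))
    (hz : closedGeodesic ρ a ∩ closedGeodesic ρ b = {proj ρ x}) {b₁ b₂ : G} (hb₁ : b₁ ≠ 1)
    (hb₂ : b₂ ≠ 1) {y : ℍ} (hy₁ : y ∈ axis (ρ b₁)) (hy₂ : y ∈ axis (ρ b₂))
    (h : ∀ σ ∈ teichmueller ρ, angle σ a b = angle σ b₁ b₂) :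
    (∃ c : WallOf a, axis (ρ b₁) = axis (ρ c.1)) ∨
      ∃ c : WallOf a, axis (ρ b₂) = axis (ρ c.1) := by
  obtain ⟨hpos, s, htop, hbot⟩ := hs.tendsto_cot_twist hb hxa hxb hz
  have key : ∀ t, axisAngle (hs.twist x t a) (hs.twist x t b) =
      axisAngle (hs.twist y t b₁) (hs.twist y t b₂) := by
    intro t
    rw [← angle, hs.angle_twist_basepoint x y, h _ (hs.twist_mem_teichmueller y t), angle]
  simp only [key] at hpos htop hbot
  exact hs.exists_wall_of_tendsto_cot hb₁ hb₂ hy₁ hy₂ (fun t => (hpos t).1.ne') htop hbot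

/-- About the angle of the β's only its range [0, π) is used. -/
theorem eq_zero_of_angle_sub (hs : HasSimpleAxis ρ a) {b : G} (hb : IsSimple ρ b) {x : ℍ}
    (hxa : x ∈ axis (ρ a)) (hxb : x ∈ axis (ρ b))
    (hz : closedGeodesic ρ a ∩ closedGeodesic ρ b = {proj ρ x}) {b₁ b₂ : G} {c : ℝ}
    (h : ∀ σ ∈ teichmueller ρ, angle σ a b - angle σ b₁ b₂ = c) : c = 0 := by
  obtain ⟨hpos, s, htop, hbot⟩ := hs.tendsto_cot_twist hb hxa hxb hz
  refine eq_zero_of_tendsto_cot hpos (fun t => ?_) htop hbot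
  have h1 := h _ (hs.twist_mem_teichmueller x t)
  have h2 : axisAngle (hs.twist x t a) (hs.twist x t b) - c =
      angle (hs.twist x t) b₁ b₂ := by rw [← h1, angle]; ring
  rw [h2]
  exact ⟨axisAngle_nonneg _ _, axisAngle_lt_pi _ _⟩

/-- A primitive element whose axis is a wall generates the stabilizer of the wall. -/
theorem eq_or_eq_inv_of_axis_eq (hs : HasSimpleAxis ρ a) {b : G} (hb : IsPrimitive b)
    {c : WallOf a} {y : ℍ} (hy : y ∈ axis (ρ b)) (h : axis (ρ b) = axis (ρ c.1)) :
    b = c.1 ∨ b = c.1⁻¹ := by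
  obtain ⟨g, hg⟩ := wall_conj c
  have h1 : ρ b • y ∈ axis (ρ b) := by
    have := (smul_mem_axis_conj (ρ b) (ρ b) y).2 hy
    rwa [mul_inv_cancel_right] at this
  have hmem : ∀ w, w ∈ axis (ρ b) → ρ g⁻¹ • w ∈ axis (ρ a) := by
    intro w hw
    rw [h, hg, map_mul, map_mul, map_inv, ← smul_inv_smul (ρ g) w, smul_mem_axis_conj] at hw
    rwa [map_inv]
  have h2 := hmem _ h1
  have h3 : ρ g⁻¹ • ρ b • y = ρ (g⁻¹ * b * g) • ρ g⁻¹ • y := by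
    rw [smul_smul, smul_smul, ← map_mul, ← map_mul]; congr 2; group
  rw [h3] at h2
  obtain ⟨n, hn⟩ := hs.simple.stabilizer hs.rep (hmem y hy) h2
  have h4 : b = c.1 ^ n := by
    rw [hg, conj_zpow, ← hn]; group
  rcases Int.natAbs_eq n with h5 | h5
  · have h6 : c.1 ^ n.natAbs = b := by rw [h4, ← zpow_natCast, ← h5]
    have := hb.2 _ _ h6
    rw [this, pow_one] at h6
    exact Or.inl h6.symm
  · have h6 : c.1⁻¹ ^ n.natAbs = b := by rw [h4, inv_pow, ← zpow_natCast, ← zpow_neg, ← h5]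
    have := hb.2 _ _ h6
    rw [this, pow_one] at h6
    exact Or.inr h6.symm

end HasSimpleAxis

/-! ### Conjugate pairs -/

/-- The relation is purely algebraic and so passes from the initial representation to all others. -/
theorem axis_of_eq_conj (σ : G →* PSL2R) {a b k : G} (h : b = k * a * k⁻¹ ∨ b = (k * a * k⁻¹)⁻¹) :
    axis (σ b) = (fun z => σ k • z) '' axis (σ a) := by
  rcases h with rfl | rfl
  · rw [map_mul, map_mul, map_inv, axis_conj]
  · rw [map_inv, axis_inv, map_mul, map_mul, map_inv, axis_conj]

theorem proj_smul (σ : G →* PSL2R) (k : G) (z : ℍ) : proj σ (σ k • z) = proj σ z :=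
  (proj_eq_iff σ _ _).2 ⟨k, rfl⟩

theorem proj_image_smul (σ : G →* PSL2R) (k : G) (S : Set ℍ) :
    proj σ '' ((fun z => σ k • z) '' S) = proj σ '' S := by
  rw [Set.image_image]
  exact Set.image_congr fun z _ => proj_smul σ k z

theorem closedGeodesic_of_eq_conj (σ : G →* PSL2R) {a b k : G}
    (h : b = k * a * k⁻¹ ∨ b = (k * a * k⁻¹)⁻¹) : closedGeodesic σ b = closedGeodesic σ a := by
  rw [closedGeodesic, axis_of_eq_conj σ h, proj_image_smul, closedGeodesic]

theorem meetingPoint_of_eq_conj (σ : G →* PSL2R) {a a' b b' k : G}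
    (h : b = k * a * k⁻¹ ∨ b = (k * a * k⁻¹)⁻¹) (h' : b' = k * a' * k⁻¹ ∨ b' = (k * a' * k⁻¹)⁻¹) :
    meetingPoint σ b b' = meetingPoint σ a a' := by
  rw [meetingPoint, axis_of_eq_conj σ h, axis_of_eq_conj σ h',
    ← Set.image_inter (MulAction.injective (σ k)), proj_image_smul, meetingPoint]

theorem meetingPoint_comm (σ : G →* PSL2R) (a b : G) : meetingPoint σ a b = meetingPoint σ b a := by
  rw [meetingPoint, Set.inter_comm, meetingPoint]

theorem closedGeodesic_wall {ρ : G →* PSL2R} {a b : G} (c : WallOf a)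
    (h : axis (ρ b) = axis (ρ c.1)) : closedGeodesic ρ b = closedGeodesic ρ a := by
  obtain ⟨g, hg⟩ := HasSimpleAxis.wall_conj c
  rw [closedGeodesic, h, ← closedGeodesic, closedGeodesic_of_eq_conj ρ (Or.inl hg)]

/-- Walls that meet are simultaneously conjugate to the given pair of axes. -/
theorem exists_conj_pair {ρ : G →* PSL2R} {a₁ a₂ b₁ b₂ : G} (hs₁ : HasSimpleAxis ρ a₁)
    (hs₂ : HasSimpleAxis ρ a₂) {x y : ℍ} (hx₁ : x ∈ axis (ρ a₁)) (hx₂ : x ∈ axis (ρ a₂))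
    (hz : closedGeodesic ρ a₁ ∩ closedGeodesic ρ a₂ = {proj ρ x})
    (hb₁ : IsPrimitive b₁) (hb₂ : IsPrimitive b₂)
    (hy₁ : y ∈ axis (ρ b₁)) (hy₂ : y ∈ axis (ρ b₂)) {c₁ : WallOf a₁} {c₂ : WallOf a₂}
    (h₁ : axis (ρ b₁) = axis (ρ c₁.1)) (h₂ : axis (ρ b₂) = axis (ρ c₂.1)) :
    proj ρ y = proj ρ x ∧ ∃ k : G, (b₁ = k * a₁ * k⁻¹ ∨ b₁ = (k * a₁ * k⁻¹)⁻¹) ∧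
      (b₂ = k * a₂ * k⁻¹ ∨ b₂ = (k * a₂ * k⁻¹)⁻¹) := by
  have hp : proj ρ y = proj ρ x := by
    have : proj ρ y ∈ closedGeodesic ρ a₁ ∩ closedGeodesic ρ a₂ :=
      ⟨closedGeodesic_wall c₁ h₁ ▸ ⟨y, hy₁, rfl⟩, closedGeodesic_wall c₂ h₂ ▸ ⟨y, hy₂, rfl⟩⟩
    rw [hz] at this; exact this
  obtain ⟨k, rfl⟩ := (proj_eq_iff ρ y x).1 hp
  have key : ∀ {a b : G} (hs : HasSimpleAxis ρ a) (_ : x ∈ axis (ρ a)) (_ : IsPrimitive b)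
      (_ : ρ k • x ∈ axis (ρ b)) {c : WallOf a} (_ : axis (ρ b) = axis (ρ c.1)),
      b = k * a * k⁻¹ ∨ b = (k * a * k⁻¹)⁻¹ := by
    intro a b hs hx hb hy c h
    have h3 : c = wallMove k (baseWall a) := by
      apply hs.wall_eq_of_mem ((hs.mem_wall_iff c _).1 (h ▸ hy))
      rw [height_wallMove]
      exact hs.mem_baseWall hx
    have h4 := hs.eq_or_eq_inv_of_axis_eq hb hy h
    rw [h3] at h4
    exact h4
  exact ⟨hp, k, key hs₁ hx₁ hb₁ hy₁ h₁, key hs₂ hx₂ hb₂ hy₂ h₂⟩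

end AngleRigidity

end

/-! ### The main theorem -/

theorem mainTheorem5 {G : Type*} [Group G] (ρ₀ : G →* AngleRigidity.PSL2R)
    (hρ₀ : AngleRigidity.IsClosedSurfaceRep ρ₀)
    (a₁ a₂ b₁ b₂ : G) (z z' : AngleRigidity.Surface ρ₀)
    (ha₁ : AngleRigidity.IsSimple ρ₀ a₁) (ha₂ : AngleRigidity.IsSimple ρ₀ a₂)
    (hz : AngleRigidity.closedGeodesic ρ₀ a₁ ∩ AngleRigidity.closedGeodesic ρ₀ a₂ = {z})
    (hza : z ∈ AngleRigidity.meetingPoint ρ₀ a₁ a₂)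
    (hb₁ : AngleRigidity.IsPrimitive b₁) (hb₂ : AngleRigidity.IsPrimitive b₂)
    (hb : AngleRigidity.axis (ρ₀ b₁) ≠ AngleRigidity.axis (ρ₀ b₂))
    (hzb : z' ∈ AngleRigidity.meetingPoint ρ₀ b₁ b₂)
    (hconst : ∃ c : ℝ, ∀ ρ ∈ AngleRigidity.teichmueller ρ₀,
      AngleRigidity.angle ρ a₁ a₂ - AngleRigidity.angle ρ b₁ b₂ = c) :
    z = z' ∧
    ∀ ρ ∈ AngleRigidity.teichmueller ρ₀,
      AngleRigidity.angle ρ a₁ a₂ = AngleRigidity.angle ρ b₁ b₂ ∧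
      AngleRigidity.meetingPoint ρ a₁ a₂ = AngleRigidity.meetingPoint ρ b₁ b₂ ∧
      ((AngleRigidity.closedGeodesic ρ a₁ = AngleRigidity.closedGeodesic ρ b₁ ∧
          AngleRigidity.closedGeodesic ρ a₂ = AngleRigidity.closedGeodesic ρ b₂) ∨
        (AngleRigidity.closedGeodesic ρ a₁ = AngleRigidity.closedGeodesic ρ b₂ ∧
          AngleRigidity.closedGeodesic ρ a₂ = AngleRigidity.closedGeodesic ρ b₁)) := by
  open AngleRigidity in
  obtain ⟨x, ⟨hx₁, hx₂⟩, rfl⟩ := hza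
  obtain ⟨y, ⟨hy₁, hy₂⟩, rfl⟩ := hzb
  obtain ⟨c, hc⟩ := hconst
  have hs₁ : HasSimpleAxis ρ₀ a₁ := ⟨hρ₀, ha₁, ⟨x, hx₁⟩⟩
  have hs₂ : HasSimpleAxis ρ₀ a₂ := ⟨hρ₀, ha₂, ⟨x, hx₂⟩⟩
  have hc0 : c = 0 := hs₁.eq_zero_of_angle_sub ha₂ hx₁ hx₂ hz hc
  have heq : ∀ σ ∈ teichmueller ρ₀, angle σ a₁ a₂ = angle σ b₁ b₂ := fun σ hσ => by
    have := hc σ hσ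
    linarith
  -- The hypotheses are symmetric, so the argument also applies to the twist along `a₂`.
  have heq' : ∀ σ ∈ teichmueller ρ₀, angle σ a₂ a₁ = angle σ b₂ b₁ := fun σ hσ =>
    axisAngle_swap_eq (heq σ hσ)
  have hz' : closedGeodesic ρ₀ a₂ ∩ closedGeodesic ρ₀ a₁ = {proj ρ₀ x} := by
    rw [Set.inter_comm]; exact hz
  have hne : closedGeodesic ρ₀ a₁ ≠ closedGeodesic ρ₀ a₂ := by
    intro h
    rw [← h, Set.inter_self] at hz
    exact closedGeodesic_ne_singleton hρ₀ ha₁ hx₁ _ hz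
  have w₁ := hs₁.exists_wall_of_angle_eq ha₂ hx₁ hx₂ hz hb₁.1 hb₂.1 hy₁ hy₂ heq
  have w₂ := hs₂.exists_wall_of_angle_eq ha₁ hx₂ hx₁ hz' hb₂.1 hb₁.1 hy₂ hy₁ heq'
  rcases w₁ with ⟨c₁, h₁⟩ | ⟨c₁, h₁⟩ <;> rcases w₂ with ⟨c₂, h₂⟩ | ⟨c₂, h₂⟩
  · obtain ⟨hp, k, k₁, k₂⟩ := exists_conj_pair hs₁ hs₂ hx₁ hx₂ hz hb₁ hb₂ hy₁ hy₂ h₁ h₂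
    exact ⟨hp.symm, fun σ hσ => ⟨heq σ hσ, (meetingPoint_of_eq_conj σ k₁ k₂).symm,
      Or.inl ⟨(closedGeodesic_of_eq_conj σ k₁).symm, (closedGeodesic_of_eq_conj σ k₂).symm⟩⟩⟩
  -- Here one and the same β would be both α₁ and α₂.
  · exact absurd ((closedGeodesic_wall c₁ h₁).symm.trans (closedGeodesic_wall c₂ h₂)) hne
  · exact absurd ((closedGeodesic_wall c₁ h₁).symm.trans (closedGeodesic_wall c₂ h₂)) hne
  · obtain ⟨hp, k, k₁, k₂⟩ := exists_conj_pair hs₁ hs₂ hx₁ hx₂ hz hb₂ hb₁ hy₂ hy₁ h₁ h₂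
    exact ⟨hp.symm, fun σ hσ => ⟨heq σ hσ,
      (meetingPoint_of_eq_conj σ k₁ k₂).symm.trans (meetingPoint_comm σ b₂ b₁),
      Or.inr ⟨(closedGeodesic_of_eq_conj σ k₁).symm, (closedGeodesic_of_eq_conj σ k₂).symm⟩⟩⟩
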